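/- **Model.** Let $(\mathcal X_1,d_1)$ and $(\mathcal X_2,d_2)$ be compact metric spaces with Borel probability measures $P_1,P_2$, let $d_1\le D_1$ on $\mathcal X_1$, and let $f:\mathcal X_1\times\mathcal X_2\to\mathbb R$ satisfy $|f(x,y)-f(x',y')|\le L\max\{d_1(x,x'),d_2(y,y')\}$. For $u\in[m]$, $i\in[n]$ let $x_1(u)\sim P_1$, $x_2(i)\sim P_2$, let $\eta(u,i)$ be noise variables (not necessarily identically distributed) with $\mathbb E\,\eta(u,i)=0$, $\operatorname{Var}\eta(u,i)=\gamma^2$, $|\eta(u,i)|\le B_e$ almost surely, and let each entry $(u,i)$ be observed (that is, $(u,i)\in\mathcal D$) with probability $p\in[0,1]$, all of these independently. Put $A(u,i)=f(x_1(u),x_2(i))$, $Z(u,i)=A(u,i)+\eta(u,i)$ and $B_0=LD_1+2B_e$, where $L,D_1,B_e\ge0$, and assume $B_0>0$. **Estimator (user-user $k$-nearest neighbours with overlap parameter $\beta$).** Let $\mathcal O^{uv}=\{j:(u,j),(v,j)\in\mathcal D\}$, $$m_{uv}=\frac1{|\mathcal O^{uv}|}\sum_{j\in\mathcal O^{uv}}\bigl(Z(u,j)-Z(v,j)\bigr),\qquad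 s_{uv}^2=\frac1{|\mathcal O^{uv}|-1}\sum_{j\in\mathcal O^{uv}}\bigl(Z(u,j)-Z(v,j)-m_{uv}\bigr)^2 ,$$ and $\mathcal S_u^\beta(i)=\{v\ne u:(v,i)\in\mathcal D,\ |\mathcal O^{uv}|\ge\beta\}$. For each row $u$, the rows $v\neq u$ with $|\mathcal O^{uv}|\ge\beta$ are ranked by increasing $s_{uv}^2$, with ties broken by an arbitrary measurable, possibly data-dependent, rule. Let $\mathcal S_u^{\beta,k}(i)$ be the first (at most) $k$ rows of $\mathcal S_u^\beta(i)$ in this ranking, and let $$\hat A(u,i)=\frac1{|\mathcal S_u^{\beta,k}(i)|}\sum_{v\in\mathcal S_u^{\beta,k}(i)}\bigl(Z(v,i)+m_{uv}\bigr),$$ with $\hat A(u,i)=0$ if $\mathcal S_u^{\beta,k}(i)=\emptyset$. Let $MSE(\hat A)=\mathbb E\bigl[\frac1{mn}\sum_{u,i}(\hat A(u,i)-A(u,i))^2\bigr]$. **Corollary 4.4.** There are constants $C,c_1,c_2>0$, depending only on $L,D_1,B_e$ (so not on $m,n,p,\gamma$, nor on the spaces, their dimension, the measures, $f$ or the noise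 distributions), such that the following holds for every such model in which $P_1$ is supported on finitely many points. Let $\delta>0$, and take $\beta=np^2/2$ and $k=\lfloor\frac18(mp)^{1/3}\rfloor$. 1. For all sufficiently large $m,n$ (how large may depend on $\mathcal X_1,\mathcal X_2,P_1,P_2,f,L,D_1,B_e$ and $\delta$, but not on $p$, $\gamma$, the noise distributions or the tie-breaking rule) and all $p\in[0,1]$ with $p\ge\max\{m^{-1+\delta},n^{-1/2+\delta}\}$, $$MSE(\hat A)\le\frac{21}{4}F_1\ln\Bigl(\frac{2B_0}{F_1}\Bigr)+4B_0^2F_2,$$ where $$F_1=C\max\{(np^2)^{-1/3},(mp)^{-1/3}\},\qquad F_2=3\exp\bigl(-c_1(mp)^{1/3}\bigr)+6m\exp\bigl(-c_2(np^2)^{1/3}\bigr).$$ 2. If in addition $\log m<(np^2)^{\delta'/3}$ for some fixed $\delta'\in(0,1)$, then $\hat A$ is consistent: $MSE(\hat A)\to0$ as $m,n\to\infty$, uniformly over all $p$, $\gamma$, noise distributions and tie-breaking rules allowed above. -/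

import Mathlib

open MeasureTheory ProbabilityTheory
open scoped ENNReal unitInterval

noncomputable section

namespace BlindRegression

/-! ### The latent variable model -/

/-- Outcomes of the model of size `m × n`: the row features `x₁`, the column features `x₂`, the noise
matrix `η`, and the observation pattern `D` (`D (u, i) = true` iff entry `(u, i)` is observed). -/
abbrev Outcome (m n : ℕ) (X₁ X₂ : Type*) : Type _ :=
  (Fin m → X₁) × (Fin n → X₂) × (Fin m × Fin n → ℝ) × (Fin m × Fin n → Bool)

/-- The joint law: all row features are i.i.d. `P₁`, all column features are i.i.d. `P₂`, the noise
variables are independent with `η (u, i) ∼ ν (u, i)`, every entry is observed with probability `p`,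
and everything is independent. -/
def modelLaw {m n : ℕ} {X₁ X₂ : Type*} [MeasurableSpace X₁] [MeasurableSpace X₂]
    (P₁ : Measure X₁) (P₂ : Measure X₂) (ν : Fin m × Fin n → Measure ℝ) (p : I) :
    Measure (Outcome m n X₁ X₂) :=
  (Measure.pi fun _ => P₁).prod <| (Measure.pi fun _ => P₂).prod <|
    (Measure.pi ν).prod (Measure.pi fun _ => bernoulliMeasure true false p)

/-- A noise distribution: mean zero, variance `γ²`, and bounded by `Be`. -/
structure IsNoiseLaw (γ Be : ℝ) (ν : Measure ℝ) : Prop where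
  isProbabilityMeasure : IsProbabilityMeasure ν
  bounded : ∀ᵐ x ∂ν, |x| ≤ Be
  mean_zero : ∫ x, x ∂ν = 0
  variance : ∫ x, x ^ 2 ∂ν = γ ^ 2

/-- `P` is supported on finitely many points. -/
def FinitelySupported {X : Type*} [MeasurableSpace X] (P : Measure X) : Prop :=
  ∃ T : Set X, T.Finite ∧ P Tᶜ = 0

/-- The unknown matrix `A (u, i) = f (x₁ u) (x₂ i)`. -/
def signal {m n : ℕ} {X₁ X₂ : Type*} (f : X₁ → X₂ → ℝ) (ω : Outcome m n X₁ X₂) :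
    Fin m × Fin n → ℝ :=
  fun e => f (ω.1 e.1) (ω.2.1 e.2)

/-- The noisy matrix `Z = A + η`; the estimator only reads its observed entries. -/
def noisy {m n : ℕ} {X₁ X₂ : Type*} (f : X₁ → X₂ → ℝ) (ω : Outcome m n X₁ X₂) :
    Fin m × Fin n → ℝ :=
  fun e => signal f ω e + ω.2.2.1 e

/-- The observation pattern. -/
def observed {m n : ℕ} {X₁ X₂ : Type*} (ω : Outcome m n X₁ X₂) : Fin m × Fin n → Bool :=
  ω.2.2.2

/-! ### The user-user `k`-nearest neighbour algorithm -/

/-- The overlap of rows `u` and `v`: the columns observed in both rows. -/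
def overlap {m n : ℕ} (D : Fin m × Fin n → Bool) (u v : Fin m) : Finset (Fin n) :=
  Finset.univ.filter fun j => D (u, j) = true ∧ D (v, j) = true

/-- The sample mean of the row difference over the overlap. -/
def rowMean {m n : ℕ} (D : Fin m × Fin n → Bool) (Z : Fin m × Fin n → ℝ) (u v : Fin m) : ℝ :=
  (∑ j ∈ overlap D u v, (Z (u, j) - Z (v, j))) / (overlap D u v).card

/-- The sample variance of the row difference over the overlap. -/
def rowVar {m n : ℕ} (D : Fin m × Fin n → Bool) (Z : Fin m × Fin n → ℝ) (u v : Fin m) : ℝ :=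
  (∑ j ∈ overlap D u v, (Z (u, j) - Z (v, j) - rowMean D Z u v) ^ 2) /
    (((overlap D u v).card : ℝ) - 1)

/-- The rows `v ≠ u` whose overlap with row `u` has at least `β` columns. -/
def comparableRows {m n : ℕ} (β : ℝ) (D : Fin m × Fin n → Bool) (u : Fin m) : Finset (Fin m) :=
  Finset.univ.filter fun v => v ≠ u ∧ β ≤ ((overlap D u v).card : ℝ)

/-- The candidate rows for entry `(u, i)`: the comparable rows in which column `i` is observed. -/
def candidates {m n : ℕ} (β : ℝ) (D : Fin m × Fin n → Bool) (u : Fin m) (i : Fin n) :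
    Finset (Fin m) :=
  (comparableRows β D u).filter fun v => D (v, i) = true

/-- `r` ranks the rows around row `u` by increasing sample variance. Distinct rows get distinct
ranks; which of two rows with equal sample variance comes first is left open. -/
def IsVarianceRanking {m n : ℕ} (β : ℝ) (D : Fin m × Fin n → Bool) (Z : Fin m × Fin n → ℝ)
    (u : Fin m) (r : Fin m → ℕ) : Prop :=
  Function.Injective r ∧
    ∀ v ∈ comparableRows β D u, ∀ w ∈ comparableRows β D u,
      rowVar D Z u v < rowVar D Z u w → r v < r w

/-- The (at most) `k` candidates of lowest rank. -/
def neighbours {m n : ℕ} (β : ℝ) (k : ℕ) (D : Fin m × Fin n → Bool) (r : Fin m → ℕ)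
    (u : Fin m) (i : Fin n) : Finset (Fin m) :=
  (candidates β D u i).filter fun v =>
    ((candidates β D u i).filter fun w => r w < r v).card < k

/-- The user-user `k`-nearest neighbour estimate of entry `(u, i)`. It is `0` when there is no
neighbour (the quotient by zero is zero). -/
def estimate {m n : ℕ} (β : ℝ) (k : ℕ) (D : Fin m × Fin n → Bool) (Z : Fin m × Fin n → ℝ)
    (r : Fin m → ℕ) (u : Fin m) (i : Fin n) : ℝ :=
  (∑ v ∈ neighbours β k D r u i, (Z (v, i) + rowMean D Z u v)) /
    ((neighbours β k D r u i).card : ℝ)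

/-- A measurable choice, for every outcome `ω` and every row `u`, of a ranking of the rows around `u`
by increasing sample variance, i.e. an arbitrary (possibly data-dependent) way to break ties. -/
structure IsRankingRule {m n : ℕ} {X₁ X₂ : Type*} [MeasurableSpace X₁] [MeasurableSpace X₂]
    (f : X₁ → X₂ → ℝ) (β : ℝ) (r : Outcome m n X₁ X₂ → Fin m → Fin m → ℕ) : Prop where
  measurable : ∀ u v, Measurable fun ω => r ω u v
  isRanking : ∀ ω u, IsVarianceRanking β (observed ω) (noisy f ω) u (r ω u)

/-- The mean squared error of the user-user `k`-nearest neighbour estimator, as an expectation in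
`[0, ∞]`. -/
def mse {m n : ℕ} {X₁ X₂ : Type*} [MeasurableSpace X₁] [MeasurableSpace X₂]
    (P₁ : Measure X₁) (P₂ : Measure X₂) (f : X₁ → X₂ → ℝ) (ν : Fin m × Fin n → Measure ℝ) (p : I)
    (β : ℝ) (k : ℕ) (r : Outcome m n X₁ X₂ → Fin m → Fin m → ℕ) : ℝ≥0∞ :=
  ∫⁻ ω, ENNReal.ofReal ((1 / ((m : ℝ) * (n : ℝ))) * ∑ u : Fin m, ∑ i : Fin n,
    (estimate β k (observed ω) (noisy f ω) (r ω u) u i - signal f ω (u, i)) ^ 2)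
    ∂(modelLaw P₁ P₂ ν p)

/-! ### Parameters and error terms -/

/-- The overlap threshold `β = n p² / 2`. -/
def overlapThreshold (n : ℕ) (p : ℝ) : ℝ := (n : ℝ) * p ^ 2 / 2

/-- The number of neighbours `k = (m p)^{1/3} / 8`, rounded down. -/
def numNeighbours (m : ℕ) (p : ℝ) : ℕ := ⌊(1 / 8 : ℝ) * ((m : ℝ) * p) ^ (1 / 3 : ℝ)⌋₊

/-- `F₁ = C max {(n p²)^{-1/3}, (m p)^{-1/3}}`. -/
def F₁ (C : ℝ) (m n : ℕ) (p : ℝ) : ℝ :=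
  C * max (((n : ℝ) * p ^ 2) ^ (-(1 / 3) : ℝ)) (((m : ℝ) * p) ^ (-(1 / 3) : ℝ))

/-- `F₂ = 3 exp (-c₁ (m p)^{1/3}) + 6 m exp (-c₂ (n p²)^{1/3})`. -/
def F₂ (c₁ c₂ : ℝ) (m n : ℕ) (p : ℝ) : ℝ :=
  3 * Real.exp (-c₁ * ((m : ℝ) * p) ^ (1 / 3 : ℝ)) +
    6 * (m : ℝ) * Real.exp (-c₂ * ((n : ℝ) * p ^ 2) ^ (1 / 3 : ℝ))

end BlindRegression

end

/-! Since `P₁` has finitely many atoms, the variance over the columns of the difference of two rows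
(`varDiff`) takes finitely many values on the support, so its positive values exceed some `2 t > 0`.
The noise shifts every such variance by the same `2 γ ^ 2` and leaves the order alone. Write y = (n
p²)^{1/3} and z = (m p)^{1/3}. If y is large and log m ≤ y, then with high probability all sample
variances are within `t` of their targets, and the k nearest neighbours of row u all have variance
zero relative to u (`le_add_of_mem_neighbours`). Their rows differ from row u by a constant
(`ae_eq_meanDiff`), which the correction m_uv removes. What remains is the sampling error of m_uv,
of square at most B₀²/y, and the average of the noise over the neighbours.

The difficulty is that the neighbours are chosen using this same noise and an arbitrary tie-breaking
rule. The remedy is uniformity. Outside a few columns, all neighbour sets of row u are determined by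
the observation pattern and by the ordered list of the K ≈ 2k/p best ranked rows
(`neighbours_eq_firstObserved`), and there are at most m^K lists. For a fixed list the normalised
squared noise sums are independent over the columns and have bounded exponential moments
(`IsNoiseLaw.measure_sum_sq_le`), so a union bound over the lists puts their total over the n
columns at order n + K log m. Per entry this is 1/k + log m / (n p), which is O(1/z + 1/y). A union
bound in each column separately would give K log m / k, of order log m / p, which is useless. The
exceptional columns, where fewer than k of the K rows are observed, are few
(`patternLaw_sparse_columns_le`) and are bounded trivially. This gives a mean squared error of at
most F₁ with C = 636 B₀², and the logarithm in the claim exceeds 1 once F₁ ≤ 2B₀/e.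

If log m ≥ y, then m exp(-y) ≥ 1, so with c₂ = 1 the claimed bound is at least 24 B₀². It then
suffices that a neighbour usually exists (`exists_mse_le_const`). The hypothesis for consistency
forces the first regime. -/

section Tools

/-! ### Concentration inequalities and product measures. -/

variable {Ω : Type*} [MeasurableSpace Ω]

theorem hasSubgaussianMGF_of_abs_le {μ : Measure Ω} [IsProbabilityMeasure μ] {X : Ω → ℝ} {B : ℝ}
    (hm : AEMeasurable X μ) (hb : ∀ᵐ ω ∂μ, |X ω| ≤ B) (hc : ∫ ω, X ω ∂μ = 0) :
    HasSubgaussianMGF X (‖B‖₊ ^ 2) μ := by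
  have h := hasSubgaussianMGF_of_mem_Icc_of_integral_eq_zero (a := -B) (b := B) hm
    (by filter_upwards [hb] with ω h using abs_le.1 h) hc
  have hB : ‖B‖₊ = ‖B - -B‖₊ / 2 := by
    rw [sub_neg_eq_add, ← two_mul, nnnorm_mul, Real.nnnorm_ofNat, mul_div_cancel_left₀ _ two_ne_zero]
  rwa [hB]

theorem measureReal_abs_sum_ge_le_of_iIndepFun {μ : Measure Ω} [IsProbabilityMeasure μ]
    {ι : Type*} {X : ι → Ω → ℝ} (hind : iIndepFun X μ) {B : ℝ} (s : Finset ι)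
    (hm : ∀ i ∈ s, AEMeasurable (X i) μ) (hb : ∀ i ∈ s, ∀ᵐ ω ∂μ, |X i ω| ≤ B)
    (hc : ∀ i ∈ s, ∫ ω, X i ω ∂μ = 0) {t : ℝ} (ht : 0 ≤ t) :
    μ.real {ω | t * s.card ≤ |∑ i ∈ s, X i ω|} ≤
      2 * Real.exp (-(t ^ 2 * s.card) / (2 * B ^ 2)) := by
  have hsub : ∀ i ∈ s, HasSubgaussianMGF (X i) (‖B‖₊ ^ 2) μ := fun i hi =>
    hasSubgaussianMGF_of_abs_le (hm i hi) (hb i hi) (hc i hi)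
  have hsum := HasSubgaussianMGF.sum_of_iIndepFun hind hsub
  have h0 : 0 ≤ t * (s.card : ℝ) := by positivity
  have h1 := hsum.measure_ge_le h0
  have h2 := hsum.neg.measure_ge_le h0
  have hexp : Real.exp (-(t * s.card) ^ 2 / (2 * ↑(∑ _i ∈ s, ‖B‖₊ ^ 2))) =
      Real.exp (-(t ^ 2 * s.card) / (2 * B ^ 2)) := by
    congr 1
    simp only [Finset.sum_const, nsmul_eq_mul, NNReal.coe_mul, NNReal.coe_natCast,
      NNReal.coe_pow, coe_nnnorm, Real.norm_eq_abs, sq_abs]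
    rcases Nat.eq_zero_or_pos s.card with h | h
    · simp [h]
    · have : (s.card : ℝ) ≠ 0 := by positivity
      by_cases hB : B = 0
      · simp [hB]
      · field_simp
  rw [hexp] at h1 h2
  calc μ.real {ω | t * s.card ≤ |∑ i ∈ s, X i ω|}
      ≤ μ.real ({ω | t * s.card ≤ ∑ i ∈ s, X i ω} ∪
          {ω | t * s.card ≤ (-fun ω => ∑ i ∈ s, X i ω) ω}) := by
        refine measureReal_mono (fun ω h => ?_) (measure_ne_top _ _)
        rcases le_abs.1 (show t * s.card ≤ |∑ i ∈ s, X i ω| from h) with h | h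
        · exact Or.inl h
        · exact Or.inr h
    _ ≤ _ := measureReal_union_le _ _
    _ ≤ _ := by linarith

/-- Chernoff's bound with parameter -1: as 1 - 1/e ≥ 0.6, each factor is at most exp(-0.6 q), and
the threshold q/2 per term leaves exp(-q/10). -/
theorem measureReal_sum_le_half_of_iIndepFun {μ : Measure Ω} [IsProbabilityMeasure μ]
    {ι : Type*} {Y : ι → Ω → ℝ} (hind : iIndepFun Y μ) (hm : ∀ i, Measurable (Y i))
    (h01 : ∀ i ω, Y i ω = 0 ∨ Y i ω = 1) {q : ℝ} (s : Finset ι)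
    (hq : ∀ i ∈ s, ∫ ω, Y i ω ∂μ = q) :
    μ.real {ω | ∑ i ∈ s, Y i ω ≤ s.card * q / 2} ≤ Real.exp (-(s.card * q) / 10) := by
  have hY : ∀ i, Integrable (Y i) μ := fun i => Integrable.of_mem_Icc 0 1 (hm i).aemeasurable
    (.of_forall fun ω => by rcases h01 i ω with h | h <;> simp [h])
  have he : (0.6 : ℝ) ≤ 1 - Real.exp (-1) := by
    have := Real.exp_neg_one_lt_d9
    linarith
  have hmgf : ∀ i ∈ s, mgf (Y i) μ (-1) ≤ Real.exp (-(0.6 * q)) := by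
    intro i hi
    have hpt : (fun ω => Real.exp (-1 * Y i ω)) = fun ω => 1 - (1 - Real.exp (-1)) * Y i ω := by
      ext ω
      rcases h01 i ω with h | h <;> simp [h]
    have hq0 : 0 ≤ q := by
      rw [← hq i hi]
      exact integral_nonneg fun ω => by rcases h01 i ω with h | h <;> simp [h]
    rw [mgf, hpt, integral_sub (integrable_const _) ((hY i).const_mul _), integral_const_mul,
      hq i hi]
    simp only [integral_const, probReal_univ, smul_eq_mul, mul_one]
    have := Real.add_one_le_exp (-(0.6 * q))
    nlinarith
  have hset : {ω | ∑ i ∈ s, Y i ω ≤ s.card * q / 2} =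
      {ω | (∑ i ∈ s, Y i) ω ≤ s.card * q / 2} := by ext; simp
  have hsumle : ∀ ω, |(∑ i ∈ s, Y i) ω| ≤ s.card := fun ω => by
    rw [Finset.sum_apply]
    refine (Finset.abs_sum_le_sum_abs _ _).trans ?_
    calc ∑ i ∈ s, |Y i ω| ≤ ∑ i ∈ s, (1 : ℝ) := Finset.sum_le_sum fun i _ => by
          rcases h01 i ω with h | h <;> simp [h]
      _ = s.card := by simp
  have hint : Integrable (fun ω => Real.exp (-1 * (∑ i ∈ s, Y i) ω)) μ :=
    integrable_exp_mul_of_mem_Icc (a := -(s.card : ℝ)) (b := s.card)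
      (Finset.aemeasurable_sum s fun i _ => (hm i).aemeasurable)
      (.of_forall fun ω => abs_le.1 (hsumle ω))
  rw [hset]
  refine (measure_le_le_exp_mul_mgf _ (by norm_num) hint).trans ?_
  rw [hind.mgf_sum hm]
  have hprod : ∏ i ∈ s, mgf (Y i) μ (-1) ≤ ∏ i ∈ s, Real.exp (-(0.6 * q)) :=
    Finset.prod_le_prod (fun i _ => mgf_nonneg) hmgf
  rw [Finset.prod_const, ← Real.exp_nat_mul] at hprod
  calc _ ≤ Real.exp (- -1 * (s.card * q / 2)) * Real.exp (s.card * -(0.6 * q)) := by gcongr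
    _ = _ := by rw [← Real.exp_add]; congr 1; ring

/-- The weight turns the standard Gaussian density into √2 times the density of variance 2. -/
theorem lintegral_exp_sq_gaussianReal :
    ∫⁻ g, ENNReal.ofReal (Real.exp (g ^ 2 / 4)) ∂gaussianReal 0 1 ≤ 2 := by
  rw [gaussianReal_of_var_ne_zero 0 one_ne_zero,
    lintegral_withDensity_eq_lintegral_mul _ (measurable_gaussianPDF 0 1) (by fun_prop)]
  have h : ∀ g : ℝ, (gaussianPDF 0 1 * fun g => ENNReal.ofReal (Real.exp (g ^ 2 / 4))) g =
      ENNReal.ofReal (√2) * gaussianPDF 0 2 g := by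
    intro g
    simp only [Pi.mul_apply, gaussianPDF, gaussianPDFReal]
    rw [← ENNReal.ofReal_mul (by positivity), ← ENNReal.ofReal_mul (by positivity)]
    congr 1
    rw [mul_assoc, ← Real.exp_add, ← mul_assoc]
    congr 1
    · simp only [NNReal.coe_one, mul_one, NNReal.coe_ofNat]
      rw [Real.sqrt_mul (by positivity) 2, mul_inv]
      field_simp
    · congr 1
      simp only [NNReal.coe_one, NNReal.coe_ofNat]
      ring
  simp_rw [h]
  rw [lintegral_const_mul _ (measurable_gaussianPDF 0 2), lintegral_gaussianPDF_eq_one 0 two_ne_zero,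
    mul_one]
  have : √2 ≤ 2 := by rw [Real.sqrt_le_left (by norm_num)]; norm_num
  calc ENNReal.ofReal (√2) ≤ ENNReal.ofReal 2 := ENNReal.ofReal_le_ofReal this
    _ = 2 := by simp

/-- Gaussian linearisation: exp(x²/(4c)) is the mean of exp(a x g) over a standard Gaussian g with
a² = 1/(2c). After exchanging the integrals the sub-Gaussian bound reduces the claim to the Gaussian
case. -/
theorem lintegral_exp_sq_le_of_hasSubgaussianMGF {μ : Measure Ω} [IsProbabilityMeasure μ]
    {X : Ω → ℝ} (hm : Measurable X) {c : NNReal} (hX : HasSubgaussianMGF X c μ) :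
    ∫⁻ ω, ENNReal.ofReal (Real.exp (X ω ^ 2 / (4 * c))) ∂μ ≤ 2 := by
  -- For `c = 0` the quotient is zero, so the integrand is 1.
  rcases eq_or_ne c 0 with rfl | hc
  · simp
  have hc' : (0 : ℝ) < c := by positivity
  set a : ℝ := (√(2 * c))⁻¹ with ha
  have ha2 : a ^ 2 = 1 / (2 * c) := by
    rw [ha, inv_pow, Real.sq_sqrt (by positivity), one_div]
  have h1 : ∀ x : ℝ, ENNReal.ofReal (Real.exp (x ^ 2 / (4 * c))) =
      ∫⁻ g, ENNReal.ofReal (Real.exp ((a * x) * g)) ∂gaussianReal 0 1 := by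
    intro x
    rw [← ofReal_integral_eq_lintegral_ofReal (integrable_exp_mul_gaussianReal _)
      (.of_forall fun g => (Real.exp_pos _).le)]
    have h := congrFun (mgf_fun_id_gaussianReal (μ := 0) (v := 1)) (a * x)
    rw [mgf] at h
    rw [h]
    congr 2
    simp only [zero_mul, NNReal.coe_one, one_mul, zero_add]
    rw [mul_pow, ha2]
    field_simp
    ring
  simp_rw [h1]
  rw [lintegral_lintegral_swap (by fun_prop)]
  calc ∫⁻ g, ∫⁻ ω, ENNReal.ofReal (Real.exp ((a * X ω) * g)) ∂μ ∂gaussianReal 0 1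
      ≤ ∫⁻ g, ENNReal.ofReal (Real.exp (g ^ 2 / 4)) ∂gaussianReal 0 1 := by
        apply lintegral_mono
        intro g
        have he : ∀ ω, (a * X ω) * g = (a * g) * X ω := fun ω => by ring
        simp_rw [he]
        rw [← ofReal_integral_eq_lintegral_ofReal (hX.integrable_exp_mul _)
          (.of_forall fun g => (Real.exp_pos _).le)]
        apply ENNReal.ofReal_le_ofReal
        refine (hX.mgf_le (a * g)).trans (le_of_eq ?_)
        congr 1
        rw [mul_pow, ha2]
        field_simp
        ring
    _ ≤ 2 := lintegral_exp_sq_gaussianReal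

theorem map_swap_uncurry_pi {α β E : Type*} [Fintype α] [Fintype β] [MeasurableSpace E]
    (ν : α × β → Measure E) [∀ e, IsProbabilityMeasure (ν e)] :
    (Measure.pi fun b => Measure.pi fun a => ν (a, b)).map
      (fun (g : β → α → E) (e : α × β) => g e.2 e.1) = Measure.pi ν := by
  refine (Measure.pi_eq fun s hs => ?_).symm
  rw [Measure.map_apply (by fun_prop) (.univ_pi hs)]
  have : (fun (g : β → α → E) (e : α × β) => g e.2 e.1) ⁻¹' Set.univ.pi s =
      Set.univ.pi fun b => Set.univ.pi fun a => s (a, b) := by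
    ext g
    simp only [Set.mem_preimage, Set.mem_pi, Set.mem_univ, true_imp_iff, Prod.forall]
    exact forall_comm
  rw [this]
  simp only [Measure.pi_pi]
  rw [Fintype.prod_prod_type_right]

/-- Regrouping a product over entries as a product over columns makes functions of different columns
independent. -/
theorem iIndepFun_columns {α β E : Type*} [Fintype α] [Fintype β] [MeasurableSpace E]
    (ν : α × β → Measure E) [∀ e, IsProbabilityMeasure (ν e)] :
    iIndepFun (fun (b : β) (ω : α × β → E) (a : α) => ω (a, b)) (Measure.pi ν) := by
  have hmap : (Measure.pi ν).map (fun (ω : α × β → E) (b : β) (a : α) => ω (a, b)) =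
      Measure.pi fun b => Measure.pi fun a => ν (a, b) := by
    rw [← map_swap_uncurry_pi, Measure.map_map (by fun_prop) (by fun_prop)]
    exact Measure.map_id
  rw [iIndepFun_iff_map_fun_eq_pi_map (fun b => Measurable.aemeasurable (by fun_prop)), hmap]
  congr 1
  funext b
  have hb : (fun (ω : α × β → E) (a : α) => ω (a, b)) =
      (fun g : β → α → E => g b) ∘ (fun (ω : α × β → E) (b : β) (a : α) => ω (a, b)) := rfl
  rw [hb, ← Measure.map_map (by fun_prop) (by fun_prop), hmap]
  exact (measurePreserving_eval (fun b => Measure.pi fun a => ν (a, b)) b).map_eq.symm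

theorem ProbabilityTheory.iIndepFun.prodMap {Ω' ι E F : Type*} [MeasurableSpace Ω'] [Fintype ι]
    [MeasurableSpace E] [MeasurableSpace F] {μ : Measure Ω} {μ' : Measure Ω'}
    [IsProbabilityMeasure μ] [IsProbabilityMeasure μ'] {X : ι → Ω → E} {Y : ι → Ω' → F}
    (hX : iIndepFun X μ) (hY : iIndepFun Y μ') (mX : ∀ i, Measurable (X i))
    (mY : ∀ i, Measurable (Y i)) :
    iIndepFun (fun i (ω : Ω × Ω') => (X i ω.1, Y i ω.2)) (μ.prod μ') := by
  have hpX : ∀ i, IsProbabilityMeasure (μ.map (X i)) :=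
    fun i => Measure.isProbabilityMeasure_map (mX i).aemeasurable
  have hpY : ∀ i, IsProbabilityMeasure (μ'.map (Y i)) :=
    fun i => Measure.isProbabilityMeasure_map (mY i).aemeasurable
  have hmarg : ∀ i, (μ.prod μ').map (fun ω => (X i ω.1, Y i ω.2)) =
      (μ.map (X i)).prod (μ'.map (Y i)) := fun i => (Measure.map_prod_map μ μ' (mX i) (mY i)).symm
  rw [iIndepFun_iff_map_fun_eq_pi_map (fun i => by fun_prop)]
  simp_rw [hmarg]
  have hmp := measurePreserving_arrowProdEquivProdArrow E F ι (fun i => μ.map (X i))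
    (fun i => μ'.map (Y i))
  have h1 : (fun (ω : Ω × Ω') i => (X i ω.1, Y i ω.2)) =
      (MeasurableEquiv.arrowProdEquivProdArrow E F ι).symm ∘
        Prod.map (fun ω i => X i ω) (fun ω i => Y i ω) := rfl
  rw [h1, ← Measure.map_map (MeasurableEquiv.measurable _) (by fun_prop),
    ← Measure.map_prod_map μ μ' (by fun_prop) (by fun_prop),
    hX.map_fun_eq_pi_map (fun i => (mX i).aemeasurable),
    hY.map_fun_eq_pi_map (fun i => (mY i).aemeasurable)]
  exact hmp.symm.map_eq

/-- Conditioning on a finite-valued coordinate. The slices `B d` need not be measurable, as the set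
is covered by finitely many rectangles. -/
theorem measure_prod_finite_le {α δ : Type*} [MeasurableSpace α] [MeasurableSpace δ] [Fintype δ]
    [MeasurableSingletonClass δ] (μ : Measure α) [SFinite μ] (ρ : Measure δ)
    [IsProbabilityMeasure ρ] (B : δ → Set α) {ε : ℝ≥0∞} (h : ∀ d, μ (B d) ≤ ε) :
    (μ.prod ρ) {z | z.1 ∈ B z.2} ≤ ε := by
  have hsub : {z : α × δ | z.1 ∈ B z.2} ⊆ ⋃ d, B d ×ˢ {d} := by
    intro z hz
    exact Set.mem_iUnion.2 ⟨z.2, hz, rfl⟩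
  calc (μ.prod ρ) {z | z.1 ∈ B z.2} ≤ (μ.prod ρ) (⋃ d, B d ×ˢ {d}) := measure_mono hsub
    _ ≤ ∑ d, (μ.prod ρ) (B d ×ˢ {d}) := measure_iUnion_fintype_le _ _
    _ = ∑ d, μ (B d) * ρ {d} := by simp only [Measure.prod_prod]
    _ ≤ ∑ d, ε * ρ {d} := by gcongr with d; exact h d
    _ = ε * ∑ d, ρ {d} := by rw [Finset.mul_sum]
    _ = ε := by rw [sum_measure_singleton]; simp

end Tools

/-! ### Combinatorics of rankings. -/

/-- Counting predecessors is a bijection from `C` onto `range C.card`. -/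
theorem Finset.card_filter_card_filter_lt {α : Type*} (C : Finset α) {r : α → ℕ}
    (hr : Function.Injective r) (k : ℕ) :
    (C.filter fun v => (C.filter fun w => r w < r v).card < k).card = min k C.card := by
  classical
  set g : α → ℕ := fun v => (C.filter fun w => r w < r v).card with hg
  have hmono : ∀ v ∈ C, ∀ w, r v < r w → g v < g w := by
    intro v hv w hvw
    apply Finset.card_lt_card
    rw [Finset.ssubset_iff_of_subset]
    · exact ⟨v, by simp [hv, hvw], by simp⟩
    · intro x hx
      rw [Finset.mem_filter] at hx ⊢
      exact ⟨hx.1, hx.2.trans hvw⟩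
  have hinj : Set.InjOn g C := by
    intro v hv w hw hvw
    rcases lt_trichotomy (r v) (r w) with h | h | h
    · exact absurd hvw (hmono v hv w h).ne
    · exact hr h
    · exact absurd hvw (hmono w hw v h).ne'
  have himg : C.image g = Finset.range C.card := by
    apply Finset.eq_of_subset_of_card_le
    · intro x hx
      obtain ⟨v, hv, rfl⟩ := Finset.mem_image.1 hx
      rw [Finset.mem_range]
      apply Finset.card_lt_card
      rw [Finset.ssubset_iff_of_subset (Finset.filter_subset _ _)]
      exact ⟨v, hv, by simp⟩
    · rw [Finset.card_range, Finset.card_image_of_injOn hinj]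
  have h1 : (C.filter fun v => g v < k).card = ((C.image g).filter fun x => x < k).card := by
    rw [Finset.filter_image, Finset.card_image_of_injOn]
    exact hinj.mono fun x hx => (Finset.mem_filter.1 hx).1
  rw [h1, himg]
  have : (Finset.range C.card).filter (fun x => x < k) = Finset.range (min k C.card) := by
    ext x
    simp only [Finset.mem_filter, Finset.mem_range, lt_min_iff]
    tauto
  rw [this, Finset.card_range]

theorem Finset.exists_rank_enumeration {α : Type*} (P : Finset α) {r : α → ℕ}
    (hr : Function.Injective r) {K : ℕ} (hK : K ≤ P.card) :
    ∃ ρ : Fin K → α, (∀ j, ρ j ∈ P) ∧ StrictMono (r ∘ ρ) ∧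
      ∀ w ∈ P, (∃ j, ρ j = w) ∨ ∀ j, r (ρ j) < r w := by
  classical
  have hcard : (P.image r).card = P.card := Finset.card_image_of_injective _ hr
  set e := (P.image r).orderEmbOfFin hcard with he
  have hmem : ∀ l, ∃ v ∈ P, r v = e l := fun l =>
    Finset.mem_image.1 ((P.image r).orderEmbOfFin_mem hcard l)
  choose ρ' hρ' hrρ' using hmem
  refine ⟨fun j => ρ' (Fin.castLE hK j), fun j => hρ' _, ?_, ?_⟩
  · intro a b hab
    simp only [Function.comp_apply, hrρ']
    exact e.strictMono (by simpa using hab)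
  · intro w hw
    have hw' : r w ∈ Set.range e := by
      rw [he, Finset.range_orderEmbOfFin]
      simpa using ⟨w, hw, rfl⟩
    obtain ⟨l, hl⟩ := hw'
    by_cases hlK : (l : ℕ) < K
    · left
      refine ⟨⟨l, hlK⟩, hr ?_⟩
      rw [hrρ', ← hl]
      rfl
    · right
      intro j
      rw [hrρ', ← hl]
      apply e.strictMono
      rw [Fin.lt_def]
      simp only [Fin.val_castLE]
      omega

namespace BlindRegression

/-! ### Deterministic analysis of the estimator. -/

section Deterministic

variable {m n : ℕ}

/-- The first `k` rows along the sequence `ρ` in which column `i` is observed. -/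
def firstObserved {K : ℕ} (k : ℕ) (D : Fin m × Fin n → Bool) (ρ : Fin K → Fin m) (i : Fin n) :
    Finset (Fin m) :=
  (Finset.univ.filter fun j => D (ρ j, i) = true ∧
    (Finset.univ.filter fun l => l < j ∧ D (ρ l, i) = true).card < k).image ρ

theorem mem_candidates {β : ℝ} {D : Fin m × Fin n → Bool} {u v : Fin m} {i : Fin n} :
    v ∈ candidates β D u i ↔ v ∈ comparableRows β D u ∧ D (v, i) = true := by
  simp [candidates]

theorem card_neighbours {β : ℝ} {k : ℕ} {D : Fin m × Fin n → Bool} {r : Fin m → ℕ}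
    (hr : Function.Injective r) (u : Fin m) (i : Fin n) :
    (neighbours β k D r u i).card = min k (candidates β D u i).card :=
  Finset.card_filter_card_filter_lt _ hr k

/-- This removes the dependence on the noise: once the top `K` rows `ρ` are fixed, the neighbour
sets in all sufficiently observed columns depend on the observation pattern alone. -/
theorem neighbours_eq_firstObserved {β : ℝ} {k K : ℕ} {D : Fin m × Fin n → Bool} {r : Fin m → ℕ}
    {u : Fin m} (hcomp : ∀ v, v ≠ u → v ∈ comparableRows β D u) {ρ : Fin K → Fin m}
    (hρu : ∀ j, ρ j ≠ u) (hρ : StrictMono (r ∘ ρ))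
    (hall : ∀ w, w ≠ u → (∃ j, ρ j = w) ∨ ∀ j, r (ρ j) < r w) {i : Fin n}
    (hi : k ≤ (Finset.univ.filter fun j => D (ρ j, i) = true).card) :
    neighbours β k D r u i = firstObserved k D ρ i := by
  have hcand : ∀ v, v ∈ candidates β D u i ↔ v ≠ u ∧ D (v, i) = true := by
    intro v
    rw [mem_candidates]
    constructor
    · rintro ⟨h1, h2⟩
      simp only [comparableRows, Finset.mem_filter] at h1
      exact ⟨h1.2.1, h2⟩
    · rintro ⟨h1, h2⟩
      exact ⟨hcomp v h1, h2⟩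
  have hinj : Function.Injective ρ := hρ.injective.of_comp
  ext v
  simp only [neighbours, firstObserved, Finset.mem_filter, Finset.mem_image, Finset.mem_univ,
    true_and]
  constructor
  · rintro ⟨hv, hlt⟩
    rcases hall v ((hcand v).1 hv).1 with ⟨j, rfl⟩ | h
    · refine ⟨j, ⟨((hcand _).1 hv).2, lt_of_le_of_lt ?_ hlt⟩, rfl⟩
      rw [← Finset.card_image_of_injective _ hinj]
      apply Finset.card_le_card
      intro w hw
      obtain ⟨l, hl, rfl⟩ := Finset.mem_image.1 hw
      rw [Finset.mem_filter] at hl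
      rw [Finset.mem_filter, hcand]
      exact ⟨⟨hρu l, hl.2.2⟩, hρ hl.2.1⟩
    · exfalso
      refine absurd hlt (not_lt.2 (hi.trans ?_))
      rw [← Finset.card_image_of_injective _ hinj]
      apply Finset.card_le_card
      intro w hw
      obtain ⟨l, hl, rfl⟩ := Finset.mem_image.1 hw
      rw [Finset.mem_filter] at hl
      rw [Finset.mem_filter, hcand]
      exact ⟨⟨hρu l, hl.2⟩, h l⟩
  · rintro ⟨j, ⟨hj, hlt⟩, rfl⟩
    refine ⟨(hcand _).2 ⟨hρu j, hj⟩, lt_of_le_of_lt ?_ hlt⟩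
    rw [← Finset.card_image_of_injective (Finset.univ.filter fun l => l < j ∧ D (ρ l, i) = true)
      hinj]
    apply Finset.card_le_card
    intro w hw
    rw [Finset.mem_filter, hcand] at hw
    rcases hall w hw.1.1 with ⟨l, rfl⟩ | h
    · refine Finset.mem_image.2 ⟨l, ?_, rfl⟩
      rw [Finset.mem_filter]
      exact ⟨Finset.mem_univ _, hρ.lt_iff_lt.1 hw.2, hw.1.2⟩
    · exact absurd hw.2 (h j).not_gt

/-- The list `ρ` of top ranked rows is random, so the hypotheses are uniform over all injective
lists. The subset `J` is arbitrary because the set of good columns is random too. -/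
theorem sum_sq_average_le {β : ℝ} {k K : ℕ} (hk : 0 < k) {D : Fin m × Fin n → Bool}
    {r : Fin m → ℕ} (hr : Function.Injective r) {u : Fin m}
    (hcomp : ∀ v, v ≠ u → v ∈ comparableRows β D u) (hK : K + 1 ≤ m) {h : Fin m × Fin n → ℝ}
    {B s : ℝ} {b : ℕ} (hB : ∀ e, |h e| ≤ B)
    (hs : ∀ ρ : Fin K → Fin m, Function.Injective ρ →
      ∑ i, (∑ v ∈ firstObserved k D ρ i, h (v, i)) ^ 2 / (firstObserved k D ρ i).card ≤ s)
    (hb : ∀ ρ : Fin K → Fin m, Function.Injective ρ →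
      (Finset.univ.filter fun i => (Finset.univ.filter fun j => D (ρ j, i) = true).card < k).card
        ≤ b)
    {J : Finset (Fin n)} (hJ : ∀ i ∈ J, (neighbours β k D r u i).card = k) :
    ∑ i ∈ J, ((∑ v ∈ neighbours β k D r u i, h (v, i)) / k) ^ 2 ≤ s / k + b * B ^ 2 := by
  classical
  have hk' : (0 : ℝ) < k := by exact_mod_cast hk
  obtain ⟨ρ, hρP, hρ, hall⟩ := (Finset.univ.erase u).exists_rank_enumeration hr (K := K)
    (by rw [Finset.card_erase_of_mem (Finset.mem_univ _), Finset.card_univ, Fintype.card_fin]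
        omega)
  have hρu : ∀ j, ρ j ≠ u := fun j => (Finset.mem_erase.1 (hρP j)).1
  have hinj : Function.Injective ρ := hρ.injective.of_comp
  have hall' : ∀ w, w ≠ u → (∃ j, ρ j = w) ∨ ∀ j, r (ρ j) < r w := fun w hw =>
    hall w (Finset.mem_erase.2 ⟨hw, Finset.mem_univ _⟩)
  -- The columns with too few observations along `ρ`: there each squared average is at most `B ^ 2`,
  -- and there are at most `b` of them.
  set p : Fin n → Prop := fun i => (Finset.univ.filter fun j => D (ρ j, i) = true).card < k with hp
  rw [← Finset.sum_filter_add_sum_filter_not J p, add_comm]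
  apply add_le_add
  · calc _ ≤ ∑ i ∈ J.filter (fun i => ¬ p i),
          ((∑ v ∈ firstObserved k D ρ i, h (v, i)) ^ 2 / (firstObserved k D ρ i).card) / k := by
          apply Finset.sum_le_sum
          intro i hi
          rw [Finset.mem_filter] at hi
          have heq := neighbours_eq_firstObserved hcomp hρu hρ hall' (not_lt.1 hi.2)
          rw [← heq, hJ i hi.1, div_pow, div_div, sq (k : ℝ)]
      _ ≤ ∑ i, ((∑ v ∈ firstObserved k D ρ i, h (v, i)) ^ 2 / (firstObserved k D ρ i).card) / k :=
          Finset.sum_le_univ_sum_of_nonneg fun i => by positivity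
      _ ≤ s / k := by
          rw [← Finset.sum_div]
          gcongr
          exact hs ρ hinj
  · calc _ ≤ ∑ i ∈ J.filter p, B ^ 2 := by
          apply Finset.sum_le_sum
          intro i hi
          rw [Finset.mem_filter] at hi
          rw [← sq_abs, abs_div, Nat.abs_cast]
          have h1 : |∑ v ∈ neighbours β k D r u i, h (v, i)| ≤ B * k := by
            refine (Finset.abs_sum_le_sum_abs _ _).trans ?_
            refine (Finset.sum_le_sum fun v _ => hB (v, i)).trans ?_
            rw [Finset.sum_const, hJ i hi.1, nsmul_eq_mul, mul_comm]
          gcongr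
          rwa [div_le_iff₀ hk']
      _ ≤ b * B ^ 2 := by
          rw [Finset.sum_const, nsmul_eq_mul]
          gcongr
          refine le_trans ?_ (hb ρ hinj)
          exact Finset.card_le_card (Finset.filter_subset_filter _ (Finset.subset_univ _))

/-- Otherwise the `k` candidates at level `g₀` would all have smaller sample variance than `v`,
hence lower rank, and `v` would not be among the first `k`. -/
theorem le_add_of_mem_neighbours {β : ℝ} {k : ℕ} {D : Fin m × Fin n → Bool}
    {Z : Fin m × Fin n → ℝ} {r : Fin m → ℕ} {u : Fin m} (hr : IsVarianceRanking β D Z u r)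
    {G : Fin m → ℝ} {g₀ t : ℝ} (hG : ∀ v ∈ comparableRows β D u, |rowVar D Z u v - G v| ≤ t)
    {i : Fin n} (hk : k ≤ ((candidates β D u i).filter fun w => G w = g₀).card) {v : Fin m}
    (hv : v ∈ neighbours β k D r u i) : G v ≤ g₀ + 2 * t := by
  by_contra! hlt
  simp only [neighbours, Finset.mem_filter] at hv
  refine absurd hv.2 (not_lt.2 (hk.trans (Finset.card_le_card fun w hw => ?_)))
  rw [Finset.mem_filter] at hw ⊢
  have hvc := (mem_candidates.1 hv.1).1
  have hwc := (mem_candidates.1 hw.1).1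
  refine ⟨hw.1, hr.2 w hwc v hvc ?_⟩
  have h1 := abs_le.1 (hG v hvc)
  have h2 := abs_le.1 (hG w hwc)
  rw [hw.2] at h2
  linarith

theorem abs_sampleMean_sub_le {ι : Type*} {O : Finset ι} (hO : 0 < O.card) {x : ι → ℝ} {μ τ : ℝ}
    (h : |∑ j ∈ O, (x j - μ)| ≤ τ * O.card) : |(∑ j ∈ O, x j) / O.card - μ| ≤ τ := by
  have hN : (0 : ℝ) < O.card := by exact_mod_cast hO
  rw [Finset.sum_sub_distrib, Finset.sum_const, nsmul_eq_mul] at h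
  rw [div_sub' hN.ne', abs_div, abs_of_pos hN, div_le_iff₀ hN]
  exact h

theorem abs_sampleVar_sub_le {ι : Type*} {O : Finset ι} (hO : 2 ≤ O.card) {x : ι → ℝ}
    {μ v τ τ' b : ℝ} (hv : 0 ≤ v) (hvb : v ≤ b) (h : |∑ j ∈ O, (x j - μ)| ≤ τ * O.card)
    (h' : |∑ j ∈ O, ((x j - μ) ^ 2 - v)| ≤ τ' * O.card) :
    |(∑ j ∈ O, (x j - (∑ j ∈ O, x j) / O.card) ^ 2) / ((O.card : ℝ) - 1) - v| ≤
      b / ((O.card : ℝ) - 1) + 2 * τ' + 2 * τ ^ 2 := by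
  have hM := abs_sampleMean_sub_le (by omega) h
  set N : ℝ := ((O.card : ℕ) : ℝ) with hN
  have hN2 : (2 : ℝ) ≤ N := by rw [hN]; exact_mod_cast hO
  set M := (∑ j ∈ O, x j) / N with hMdef
  have hsum : ∑ j ∈ O, x j = N * M := by rw [hMdef]; field_simp
  have hsq : ∑ j ∈ O, (x j - M) ^ 2 =
      ∑ j ∈ O, ((x j - μ) ^ 2 - v) + N * v - N * (M - μ) ^ 2 := by
    have e1 : ∀ j, (x j - M) ^ 2 = ((x j - μ) ^ 2 - v) + v - 2 * (M - μ) * x j +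
        (M ^ 2 - μ ^ 2) := fun j => by ring
    simp_rw [e1]
    rw [Finset.sum_add_distrib, Finset.sum_sub_distrib, Finset.sum_add_distrib, ← Finset.mul_sum,
      hsum]
    simp only [Finset.sum_const, nsmul_eq_mul]
    rw [← hN]
    ring
  have hM2 : (M - μ) ^ 2 ≤ τ ^ 2 := by
    rw [← sq_abs]
    gcongr
  have hM0 := sq_nonneg (M - μ)
  have hb := abs_le.1 h'
  have hN1 : 0 < N - 1 := by linarith
  have hτ' : 0 ≤ τ' := by
    by_contra! hneg
    have := (abs_nonneg _).trans h'
    nlinarith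
  rw [hsq, div_sub' hN1.ne', abs_div, abs_of_pos hN1, div_le_iff₀ hN1]
  have e2 : (b / (N - 1) + 2 * τ' + 2 * τ ^ 2) * (N - 1) =
      b + 2 * τ' * (N - 1) + 2 * τ ^ 2 * (N - 1) := by field_simp
  rw [e2, abs_le]
  -- The difference is the centred sum plus `v` minus `N (M - μ)²`; then `N ≤ 2 (N - 1)` absorbs the
  -- denominator.
  constructor <;> nlinarith [sq_nonneg τ]

/-- For neighbours that differ from row `u` by exact constants `g v`, the error is the noise average
plus the average error of the row means. -/
theorem sq_estimate_sub_le {β : ℝ} {k : ℕ} (hk : 0 < k) {D : Fin m × Fin n → Bool}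
    {a h : Fin m × Fin n → ℝ} {r : Fin m → ℕ} {u : Fin m} {i : Fin n} {g : Fin m → ℝ} {τ : ℝ}
    (hcard : (neighbours β k D r u i).card = k)
    (hg : ∀ v ∈ neighbours β k D r u i, a (v, i) + g v = a (u, i))
    (hτ : ∀ v ∈ neighbours β k D r u i, |rowMean D (fun e => a e + h e) u v - g v| ≤ τ) :
    (estimate β k D (fun e => a e + h e) r u i - a (u, i)) ^ 2 ≤
      2 * ((∑ v ∈ neighbours β k D r u i, h (v, i)) / k) ^ 2 + 2 * τ ^ 2 := by
  have hk' : (0 : ℝ) < k := by exact_mod_cast hk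
  set S := neighbours β k D r u i
  have e1 : estimate β k D (fun e => a e + h e) r u i - a (u, i) =
      (∑ v ∈ S, h (v, i)) / k +
        (∑ v ∈ S, (rowMean D (fun e => a e + h e) u v - g v)) / k := by
    rw [estimate]
    change (∑ v ∈ S, _) / (S.card : ℝ) - _ = _
    rw [hcard, ← add_div, ← Finset.sum_add_distrib, div_sub' hk'.ne']
    congr 1
    have : (k : ℝ) * a (u, i) = ∑ v ∈ S, a (u, i) := by
      rw [Finset.sum_const, hcard, nsmul_eq_mul]
    rw [this, ← Finset.sum_sub_distrib]
    refine Finset.sum_congr rfl fun v hv => ?_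
    rw [← hg v hv]
    ring
  have e2 : |(∑ v ∈ S, (rowMean D (fun e => a e + h e) u v - g v)) / k| ≤ τ := by
    rw [abs_div, Nat.abs_cast, div_le_iff₀ hk']
    refine (Finset.abs_sum_le_sum_abs _ _).trans ((Finset.sum_le_sum hτ).trans ?_)
    rw [Finset.sum_const, hcard, nsmul_eq_mul, mul_comm]
  have e3 := sq_le_sq' (abs_le.1 e2).1 (abs_le.1 e2).2
  rw [e1]
  refine (add_sq_le).trans ?_
  linarith

/-- A crude bound that holds for any neighbours, good or bad; it matters when the sample variances
are not controlled. -/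
theorem sq_estimate_sub_le_of_nonempty {β : ℝ} {k : ℕ} {D : Fin m × Fin n → Bool}
    {a h : Fin m × Fin n → ℝ} {r : Fin m → ℕ} {u : Fin m} {i : Fin n} {c B : ℝ}
    (hne : (neighbours β k D r u i).Nonempty) (ha : ∀ v w j, |a (v, j) - a (w, j)| ≤ c)
    (hh : ∀ e, |h e| ≤ B) :
    (estimate β k D (fun e => a e + h e) r u i - a (u, i)) ^ 2 ≤ (2 * c + 3 * B) ^ 2 := by
  set S := neighbours β k D r u i with hS
  have hc : 0 ≤ c := (abs_nonneg _).trans (ha u u i)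
  have hB : 0 ≤ B := (abs_nonneg _).trans (hh (u, i))
  have hN : (0 : ℝ) < S.card := by exact_mod_cast hne.card_pos
  have hmean : ∀ v, |rowMean D (fun e => a e + h e) u v| ≤ c + 2 * B := by
    intro v
    rw [rowMean, abs_div, Nat.abs_cast]
    refine div_le_of_le_mul₀ (by positivity) (by positivity) ?_
    refine (Finset.abs_sum_le_sum_abs _ _).trans ?_
    have : ∀ j ∈ overlap D u v, |a (u, j) + h (u, j) - (a (v, j) + h (v, j))| ≤ c + 2 * B := by
      intro j _
      have h1 := abs_le.1 (ha u v j)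
      have h2 := abs_le.1 (hh (u, j))
      have h3 := abs_le.1 (hh (v, j))
      rw [abs_le]
      constructor <;> linarith
    refine (Finset.sum_le_sum this).trans ?_
    rw [Finset.sum_const, nsmul_eq_mul, mul_comm]
  have e1 : estimate β k D (fun e => a e + h e) r u i - a (u, i) =
      (∑ v ∈ S, (a (v, i) - a (u, i) + h (v, i) + rowMean D (fun e => a e + h e) u v)) /
        S.card := by
    rw [estimate]
    change (∑ v ∈ S, _) / (S.card : ℝ) - _ = _
    rw [div_sub' hN.ne']
    congr 1
    have : (S.card : ℝ) * a (u, i) = ∑ v ∈ S, a (u, i) := by rw [Finset.sum_const, nsmul_eq_mul]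
    rw [this, ← Finset.sum_sub_distrib]
    exact Finset.sum_congr rfl fun v _ => by ring
  rw [e1, ← sq_abs, abs_div, Nat.abs_cast]
  gcongr
  rw [div_le_iff₀ hN]
  refine (Finset.abs_sum_le_sum_abs _ _).trans ?_
  have : ∀ v ∈ S, |a (v, i) - a (u, i) + h (v, i) + rowMean D (fun e => a e + h e) u v| ≤
      2 * c + 3 * B := by
    intro v _
    have h1 := abs_le.1 (ha v u i)
    have h2 := abs_le.1 (hh (v, i))
    have h3 := abs_le.1 (hmean v)
    rw [abs_le]
    constructor <;> linarith
  refine (Finset.sum_le_sum this).trans ?_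
  rw [Finset.sum_const, nsmul_eq_mul, mul_comm]

theorem estimate_eq_zero {β : ℝ} {k : ℕ} {D : Fin m × Fin n → Bool} {Z : Fin m × Fin n → ℝ}
    {r : Fin m → ℕ} {u : Fin m} {i : Fin n} (h : ¬ (neighbours β k D r u i).Nonempty) :
    estimate β k D Z r u i = 0 := by
  rw [Finset.not_nonempty_iff_eq_empty] at h
  simp [estimate, h]

end Deterministic

end BlindRegression

theorem measure_le_ofReal_of_measureReal_le {Ω : Type*} [MeasurableSpace Ω] {μ : Measure Ω}
    [IsFiniteMeasure μ] {s : Set Ω} {c : ℝ} (h : μ.real s ≤ c) : μ s ≤ ENNReal.ofReal c := by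
  rw [← ofReal_measureReal]
  exact ENNReal.ofReal_le_ofReal h

namespace BlindRegression

/-! ### Probabilities of the exceptional events. -/

section Events

variable {m n : ℕ} {X₁ X₂ : Type*} [MeasurableSpace X₁] [MeasurableSpace X₂]

/-- The law of the observation pattern. -/
noncomputable def patternLaw (m n : ℕ) (p : I) : Measure (Fin m × Fin n → Bool) :=
  Measure.pi fun _ => bernoulliMeasure true false p

instance (p : I) : IsProbabilityMeasure (patternLaw m n p) := by
  unfold patternLaw
  infer_instance

instance {P₁ : Measure X₁} {P₂ : Measure X₂} [IsProbabilityMeasure P₁] [IsProbabilityMeasure P₂]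
    {ν : Fin m × Fin n → Measure ℝ} [∀ e, IsProbabilityMeasure (ν e)] {p : I} :
    IsProbabilityMeasure (modelLaw P₁ P₂ ν p) := by
  unfold modelLaw
  infer_instance

/-- Conditioning on the observation pattern, after which overlaps and the sets `firstObserved` are
deterministic. -/
theorem modelLaw_setOf_mem_le (P₁ : Measure X₁) (P₂ : Measure X₂) [IsProbabilityMeasure P₁]
    [IsProbabilityMeasure P₂] (ν : Fin m × Fin n → Measure ℝ) [∀ e, IsProbabilityMeasure (ν e)]
    (p : I) (B : (Fin m × Fin n → Bool) →
      Set ((Fin m → X₁) × (Fin n → X₂) × (Fin m × Fin n → ℝ))) {ε : ℝ≥0∞}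
    (h : ∀ D, ((Measure.pi fun _ => P₁).prod ((Measure.pi fun _ => P₂).prod (Measure.pi ν))) (B D)
      ≤ ε) :
    modelLaw P₁ P₂ ν p {ω | (ω.1, ω.2.1, ω.2.2.1) ∈ B ω.2.2.2} ≤ ε := by
  have h1 := measurePreserving_prodAssoc (Measure.pi fun _ : Fin m => P₁)
    ((Measure.pi fun _ : Fin n => P₂).prod (Measure.pi ν)) (patternLaw m n p)
  have h2 := (MeasurePreserving.id (Measure.pi fun _ : Fin m => P₁)).prod
    (measurePreserving_prodAssoc (Measure.pi fun _ : Fin n => P₂) (Measure.pi ν)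
      (patternLaw m n p))
  have h3 := h2.comp h1
  have h4 : MeasurableEmbedding (Prod.map id (MeasurableEquiv.prodAssoc (α := Fin n → X₂)
      (β := Fin m × Fin n → ℝ) (γ := Fin m × Fin n → Bool)) ∘
      (MeasurableEquiv.prodAssoc (α := Fin m → X₁) (β := (Fin n → X₂) × (Fin m × Fin n → ℝ))
        (γ := Fin m × Fin n → Bool))) :=
    ((MeasurableEquiv.refl (Fin m → X₁)).prodCongr MeasurableEquiv.prodAssoc).measurableEmbedding.comp
      (MeasurableEquiv.measurableEmbedding _)
  have h5 := h3.measure_preimage_emb h4 {ω | (ω.1, ω.2.1, ω.2.2.1) ∈ B ω.2.2.2}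
  refine (le_of_eq h5.symm).trans ?_
  exact measure_prod_finite_le _ (patternLaw m n p) B h

theorem modelLaw_pattern_le (P₁ : Measure X₁) (P₂ : Measure X₂) [IsProbabilityMeasure P₁]
    [IsProbabilityMeasure P₂] (ν : Fin m × Fin n → Measure ℝ) [∀ e, IsProbabilityMeasure (ν e)]
    (p : I) (A : Set (Fin m × Fin n → Bool)) :
    modelLaw P₁ P₂ ν p {ω | ω.2.2.2 ∈ A} = patternLaw m n p A := by
  have : {ω : Outcome m n X₁ X₂ | ω.2.2.2 ∈ A} =
      Set.univ ×ˢ (Set.univ ×ˢ (Set.univ ×ˢ A)) := by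
    ext ω
    simp
  rw [this, modelLaw, Measure.prod_prod, Measure.prod_prod, Measure.prod_prod]
  simp [patternLaw]

/-! ### Events about the observation pattern -/

theorem iIndepFun_pattern (p : I) :
    iIndepFun (fun (e : Fin m × Fin n) (D : Fin m × Fin n → Bool) =>
      if D e = true then (1 : ℝ) else 0) (patternLaw m n p) := by
  have h := iIndepFun_pi (μ := fun _ : Fin m × Fin n => bernoulliMeasure true false p)
    (X := fun _ (d : Bool) => if d = true then (1 : ℝ) else 0)
    (fun e => (measurable_of_finite _).aemeasurable)
  exact h

theorem integral_pattern (p : I) (e : Fin m × Fin n) :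
    ∫ D, (if D e = true then (1 : ℝ) else 0) ∂patternLaw m n p = p := by
  have h := (measurePreserving_eval (fun _ : Fin m × Fin n => bernoulliMeasure true false p) e)
  have h2 : ∫ D, (if D e = true then (1 : ℝ) else 0) ∂patternLaw m n p =
      ∫ d, (if d = true then (1 : ℝ) else 0) ∂bernoulliMeasure true false p := by
    rw [← h.map_eq, integral_map h.measurable.aemeasurable (measurable_of_finite _).aestronglyMeasurable]
    rfl
  rw [h2, integral_bernoulliMeasure]
  simp

theorem patternLaw_count_le (p : I) (E : Finset (Fin m × Fin n)) :
    (patternLaw m n p).real {D | ((E.filter fun e => D e = true).card : ℝ) ≤ E.card * p / 2} ≤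
      Real.exp (-(E.card * p) / 10) := by
  have h := measureReal_sum_le_half_of_iIndepFun (iIndepFun_pattern (m := m) (n := n) p)
    (fun e => measurable_of_finite _) (fun e D => by by_cases h : D e = true <;> simp [h]) E
    (fun e _ => integral_pattern p e)
  simpa using h

theorem patternLaw_overlap_le (p : I) {u v : Fin m} (huv : u ≠ v) :
    (patternLaw m n p).real {D | ((overlap D u v).card : ℝ) ≤ overlapThreshold n p} ≤
      Real.exp (-(n * (p : ℝ) ^ 2) / 10) := by
  have hind : iIndepFun (fun (j : Fin n) (D : Fin m × Fin n → Bool) =>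
      if D (u, j) = true ∧ D (v, j) = true then (1 : ℝ) else 0) (patternLaw m n p) :=
    (iIndepFun_columns (fun _ : Fin m × Fin n => bernoulliMeasure true false p)).comp
      (fun _ (d : Fin m → Bool) => if d u = true ∧ d v = true then (1 : ℝ) else 0)
      (fun _ => measurable_of_finite _)
  have hint : ∀ j : Fin n, ∫ D, (if D (u, j) = true ∧ D (v, j) = true then (1 : ℝ) else 0)
      ∂patternLaw m n p = (p : ℝ) ^ 2 := by
    intro j
    have hne : (u, j) ≠ (v, j) := fun h => huv (congrArg Prod.fst h)
    have h1 := ((iIndepFun_pattern (m := m) (n := n) p).indepFun hne).integral_fun_mul_eq_mul_integral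
      (measurable_of_finite _).aestronglyMeasurable (measurable_of_finite _).aestronglyMeasurable
    rw [integral_pattern, integral_pattern] at h1
    rw [sq, ← h1]
    congr 1
    ext D
    by_cases h : D (u, j) = true <;> by_cases h' : D (v, j) = true <;> simp [h, h']
  have h := measureReal_sum_le_half_of_iIndepFun hind
    (fun e => measurable_of_finite _)
    (fun j D => by by_cases h : D (u, j) = true ∧ D (v, j) = true <;> simp [h]) Finset.univ
    (fun j _ => hint j)
  simp only [Finset.sum_boole, Finset.card_univ, Fintype.card_fin] at h
  exact h

/-- If `b` columns are sparse, the block formed by them and the `K` rows has at most `b k`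
observations, at most half its mean. This is Chernoff for each block, with a union over at most `2 ^
n` sets of columns. -/
theorem patternLaw_sparse_columns_le (p : I) {K k b : ℕ} {ρ : Fin K → Fin m}
    (hρ : Function.Injective ρ) (hk : (k : ℝ) ≤ K * p / 2) :
    (patternLaw m n p).real {D | b ≤ (Finset.univ.filter fun i =>
      (Finset.univ.filter fun j => D (ρ j, i) = true).card < k).card} ≤
      2 ^ n * Real.exp (-(b * K * p) / 10) := by
  classical
  set E : Finset (Fin n) → Finset (Fin m × Fin n) := fun J =>
    (J ×ˢ (Finset.univ : Finset (Fin K))).map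
      ⟨fun q => (ρ q.2, q.1), fun q q' h => by
        simp only [Prod.mk.injEq] at h
        exact Prod.ext h.2 (hρ h.1)⟩ with hE
  have hEcard : ∀ J, (E J).card = J.card * K := fun J => by simp [hE]
  have hsub : {D : Fin m × Fin n → Bool | b ≤ (Finset.univ.filter fun i =>
      (Finset.univ.filter fun j => D (ρ j, i) = true).card < k).card} ⊆
      ⋃ J ∈ (Finset.univ.powerset.filter fun J : Finset (Fin n) => J.card = b),
        {D | (((E J).filter fun e => D e = true).card : ℝ) ≤ (E J).card * p / 2} := by
    intro D hD
    obtain ⟨J, hJsub, hJ⟩ := Finset.exists_subset_card_eq (show b ≤ _ from hD)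
    simp only [Set.mem_iUnion]
    refine ⟨J, by simp [hJ], ?_⟩
    have hcount : ((E J).filter fun e => D e = true).card =
        ∑ i ∈ J, (Finset.univ.filter fun j => D (ρ j, i) = true).card := by
      rw [hE, Finset.filter_map, Finset.card_map, Finset.card_filter, Finset.sum_product]
      refine Finset.sum_congr rfl fun i _ => ?_
      rw [Finset.card_filter]
      rfl
    have hle : ∑ i ∈ J, (Finset.univ.filter fun j => D (ρ j, i) = true).card ≤ J.card * k := by
      rw [← smul_eq_mul, ← Finset.sum_const]
      exact Finset.sum_le_sum fun i hi => (Finset.mem_filter.1 (hJsub hi)).2.le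
    rw [Set.mem_ofPred_eq, hcount, hEcard]
    calc ((∑ i ∈ J, (Finset.univ.filter fun j => D (ρ j, i) = true).card : ℕ) : ℝ)
        ≤ ((J.card * k : ℕ) : ℝ) := by exact_mod_cast hle
      _ = J.card * k := by push_cast; ring
      _ ≤ J.card * (K * p / 2) := by gcongr
      _ = _ := by push_cast; ring
  refine (measureReal_mono hsub (measure_ne_top _ _)).trans ?_
  refine (measureReal_biUnion_finset_le _ _).trans ?_
  calc _ ≤ ∑ J ∈ (Finset.univ.powerset.filter fun J : Finset (Fin n) => J.card = b),
        Real.exp (-(b * K * p) / 10) := by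
        apply Finset.sum_le_sum
        intro J hJ
        refine (patternLaw_count_le p (E J)).trans (le_of_eq ?_)
        rw [hEcard, (Finset.mem_filter.1 hJ).2]
        push_cast
        rfl
    _ ≤ 2 ^ n * Real.exp (-(b * K * p) / 10) := by
        rw [Finset.sum_const, nsmul_eq_mul]
        gcongr
        have := Finset.card_filter_le (Finset.univ : Finset (Fin n)).powerset fun J => J.card = b
        rw [Finset.card_powerset, Finset.card_univ, Fintype.card_fin] at this
        exact_mod_cast this

/-! ### Events about the noise -/

theorem IsNoiseLaw.ae_pi {γ B : ℝ} {ν : Fin m × Fin n → Measure ℝ}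
    (hν : ∀ e, IsNoiseLaw γ B (ν e)) : ∀ᵐ η ∂Measure.pi ν, ∀ e, |η e| ≤ B := by
  have := fun e => (hν e).isProbabilityMeasure
  rw [ae_all_iff]
  intro e
  exact (Measure.quasiMeasurePreserving_eval ν e).ae (hν e).bounded

theorem IsNoiseLaw.integral_eval {γ B : ℝ} {ν : Fin m × Fin n → Measure ℝ}
    (hν : ∀ e, IsNoiseLaw γ B (ν e)) (e : Fin m × Fin n) : ∫ η, η e ∂Measure.pi ν = 0 := by
  have := fun e => (hν e).isProbabilityMeasure
  have h := measurePreserving_eval ν e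
  have h' := integral_map (μ := Measure.pi ν) h.measurable.aemeasurable
    (f := fun x : ℝ => x) (by fun_prop)
  rw [h.map_eq, (hν e).mean_zero] at h'
  exact h'.symm

theorem IsNoiseLaw.integral_eval_sq {γ B : ℝ} {ν : Fin m × Fin n → Measure ℝ}
    (hν : ∀ e, IsNoiseLaw γ B (ν e)) (e : Fin m × Fin n) :
    ∫ η, η e ^ 2 ∂Measure.pi ν = γ ^ 2 := by
  have := fun e => (hν e).isProbabilityMeasure
  have h := measurePreserving_eval ν e
  have h' := integral_map (μ := Measure.pi ν) h.measurable.aemeasurable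
    (f := fun x : ℝ => x ^ 2) (by fun_prop)
  rw [h.map_eq, (hν e).variance] at h'
  exact h'.symm

theorem iIndepFun_noise (ν : Fin m × Fin n → Measure ℝ) [∀ e, IsProbabilityMeasure (ν e)] :
    iIndepFun (fun (e : Fin m × Fin n) (η : Fin m × Fin n → ℝ) => η e) (Measure.pi ν) :=
  iIndepFun_pi (X := fun _ x => x) fun _ => aemeasurable_id'

/-- Each column contributes an exponential moment of at most 2, the columns are independent, and
Markov's inequality applies to the product. Working with the sum over columns is what makes a union
over `m ^ K` lists affordable. -/
theorem IsNoiseLaw.measure_sum_sq_le {γ B : ℝ} (hB : 0 < B) {ν : Fin m × Fin n → Measure ℝ}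
    (hν : ∀ e, IsNoiseLaw γ B (ν e)) (S : Fin n → Finset (Fin m)) (s : ℝ) :
    Measure.pi ν {η | 4 * B ^ 2 * s ≤ ∑ i, (∑ v ∈ S i, η (v, i)) ^ 2 / (S i).card} ≤
      ENNReal.ofReal (2 ^ n * Real.exp (-s)) := by
  classical
  have := fun e => (hν e).isProbabilityMeasure
  set Y : Fin n → (Fin m × Fin n → ℝ) → ℝ := fun i η =>
    (∑ v ∈ S i, η (v, i)) ^ 2 / (4 * (B ^ 2 * (S i).card)) with hY
  have hmom : ∀ i, ∫⁻ η, ENNReal.ofReal (Real.exp (Y i η)) ∂Measure.pi ν ≤ 2 := by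
    intro i
    have hind : iIndepFun (fun (v : Fin m) (η : Fin m × Fin n → ℝ) => η (v, i)) (Measure.pi ν) :=
      (iIndepFun_noise ν).precomp (g := fun v => (v, i)) fun v w h => congrArg Prod.fst h
    have hsub : ∀ v ∈ S i, HasSubgaussianMGF (fun η : Fin m × Fin n → ℝ => η (v, i)) (‖B‖₊ ^ 2)
        (Measure.pi ν) := fun v _ =>
      hasSubgaussianMGF_of_abs_le (measurable_pi_apply _).aemeasurable
        (by filter_upwards [IsNoiseLaw.ae_pi hν] with η h using h _) (IsNoiseLaw.integral_eval hν _)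
    have h := lintegral_exp_sq_le_of_hasSubgaussianMGF (by fun_prop)
      (HasSubgaussianMGF.sum_of_iIndepFun hind hsub)
    refine le_trans (le_of_eq ?_) h
    congr 1
    ext η
    congr 3
    simp only [Finset.sum_const, nsmul_eq_mul, NNReal.coe_mul, NNReal.coe_natCast,
      NNReal.coe_pow, coe_nnnorm, Real.norm_eq_abs, sq_abs]
    ring
  have hindcol : iIndepFun (fun i η => ENNReal.ofReal (Real.exp (Y i η))) (Measure.pi ν) :=
    (iIndepFun_columns ν).comp
      (fun i (x : Fin m → ℝ) => ENNReal.ofReal (Real.exp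
        ((∑ v ∈ S i, x v) ^ 2 / (4 * (B ^ 2 * (S i).card))))) (fun i => by fun_prop)
  have hsub : {η : Fin m × Fin n → ℝ |
      4 * B ^ 2 * s ≤ ∑ i, (∑ v ∈ S i, η (v, i)) ^ 2 / (S i).card} ⊆
      {η | ENNReal.ofReal (Real.exp s) ≤ ∏ i, ENNReal.ofReal (Real.exp (Y i η))} := by
    intro η hη
    rw [Set.mem_ofPred_eq] at hη ⊢
    rw [← ENNReal.ofReal_prod_of_nonneg fun i _ => (Real.exp_pos _).le, ← Real.exp_sum]
    apply ENNReal.ofReal_le_ofReal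
    rw [Real.exp_le_exp]
    have : ∑ i, Y i η = (∑ i, (∑ v ∈ S i, η (v, i)) ^ 2 / (S i).card) / (4 * B ^ 2) := by
      rw [Finset.sum_div]
      refine Finset.sum_congr rfl fun i _ => ?_
      rw [hY, div_div]
      ring_nf
    rw [this, le_div_iff₀ (by positivity)]
    linarith
  have hmeas : ∀ i, Measurable fun η => ENNReal.ofReal (Real.exp (Y i η)) := fun i => by
    simp only [hY]
    fun_prop
  refine (measure_mono hsub).trans ?_
  have hmarkov := meas_ge_le_lintegral_div (μ := Measure.pi ν)
    (f := fun η => ∏ i, ENNReal.ofReal (Real.exp (Y i η)))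
    (Finset.measurable_prod _ fun i _ => hmeas i).aemeasurable
    (ε := ENNReal.ofReal (Real.exp s)) (by simp [Real.exp_pos]) ENNReal.ofReal_ne_top
  refine hmarkov.trans ?_
  rw [lintegral_prod_eq_prod_lintegral_of_indepFun Finset.univ _ hindcol hmeas]
  have hprod : ∏ i, ∫⁻ η, ENNReal.ofReal (Real.exp (Y i η)) ∂Measure.pi ν ≤ 2 ^ n := by
    refine (Finset.prod_le_prod' fun i _ => hmom i).trans ?_
    simp
  calc _ ≤ 2 ^ n / ENNReal.ofReal (Real.exp s) := by gcongr
    _ = ENNReal.ofReal (2 ^ n * Real.exp (-s)) := by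
      rw [Real.exp_neg, ← div_eq_mul_inv, ENNReal.ofReal_div_of_pos (Real.exp_pos _),
        ENNReal.ofReal_pow (by norm_num)]
      simp

/-! ### Events about the row features -/

theorem measureReal_card_eq_le (P₁ : Measure X₁) [IsProbabilityMeasure P₁]
    [MeasurableSingletonClass X₁] (R : Finset (Fin m)) (a : X₁) [DecidableEq X₁] :
    (Measure.pi fun _ : Fin m => P₁).real
      {x | ((R.filter fun v => x v = a).card : ℝ) ≤ R.card * P₁.real {a} / 2} ≤
      Real.exp (-(R.card * P₁.real {a}) / 10) := by
  have hmeas : Measurable fun y : X₁ => if y = a then (1 : ℝ) else 0 :=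
    Measurable.ite (measurableSet_singleton a) measurable_const measurable_const
  have hind : iIndepFun (fun (v : Fin m) (x : Fin m → X₁) => if x v = a then (1 : ℝ) else 0)
      (Measure.pi fun _ => P₁) :=
    iIndepFun_pi (X := fun _ (y : X₁) => if y = a then (1 : ℝ) else 0)
      fun _ => hmeas.aemeasurable
  have hint : ∀ v : Fin m, ∫ x, (if x v = a then (1 : ℝ) else 0) ∂(Measure.pi fun _ => P₁) =
      P₁.real {a} := by
    intro v
    have h := measurePreserving_eval (fun _ : Fin m => P₁) v
    have h' := integral_map (μ := Measure.pi fun _ : Fin m => P₁) h.measurable.aemeasurable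
      (f := fun y : X₁ => if y = a then (1 : ℝ) else 0) hmeas.aestronglyMeasurable
    rw [h.map_eq] at h'
    refine (Eq.trans h'.symm ?_)
    have : (fun y : X₁ => if y = a then (1 : ℝ) else 0) = Set.indicator {a} 1 := by
      ext y
      simp [Set.indicator_apply]
    rw [this, integral_indicator_one (measurableSet_singleton a)]
  have h := measureReal_sum_le_half_of_iIndepFun hind
    (fun v => hmeas.comp (measurable_pi_apply v))
    (fun v x => by by_cases h : x v = a <;> simp [h]) R (fun v _ => hint v)
  simpa using h

end Events

end BlindRegression

/-! ### Moments and concentration of row differences. -/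

theorem integral_sq_add_sub_of_indepFun {Ω : Type*} [MeasurableSpace Ω] {μ : Measure Ω}
    [IsProbabilityMeasure μ] {H U V : Ω → ℝ} (hH : MemLp H 2 μ) (hU : MemLp U 2 μ)
    (hV : MemLp V 2 μ) (hHU : IndepFun H U μ) (hHV : IndepFun H V μ) (hH0 : ∫ ω, H ω ∂μ = 0)
    (hUV : ∫ ω, U ω * V ω ∂μ = 0) :
    ∫ ω, (H ω + U ω - V ω) ^ 2 ∂μ = ∫ ω, H ω ^ 2 ∂μ + ∫ ω, U ω ^ 2 ∂μ + ∫ ω, V ω ^ 2 ∂μ := by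
  have e : ∀ ω, (H ω + U ω - V ω) ^ 2 =
      H ω ^ 2 + U ω ^ 2 + V ω ^ 2 + (2 * (H ω * U ω) - 2 * (H ω * V ω) - 2 * (U ω * V ω)) :=
    fun ω => by ring
  have i1 := hH.integrable_sq
  have i2 := hU.integrable_sq
  have i3 := hV.integrable_sq
  have j1 : Integrable (fun ω => 2 * (H ω * U ω)) μ := (hH.integrable_mul hU).const_mul 2
  have j2 : Integrable (fun ω => 2 * (H ω * V ω)) μ := (hH.integrable_mul hV).const_mul 2
  have j3 : Integrable (fun ω => 2 * (U ω * V ω)) μ := (hU.integrable_mul hV).const_mul 2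
  have i12 : Integrable (fun ω => H ω ^ 2 + U ω ^ 2) μ := i1.add i2
  have i123 : Integrable (fun ω => H ω ^ 2 + U ω ^ 2 + V ω ^ 2) μ := i12.add i3
  have j12 : Integrable (fun ω => 2 * (H ω * U ω) - 2 * (H ω * V ω)) μ := j1.sub j2
  have j123 : Integrable (fun ω => 2 * (H ω * U ω) - 2 * (H ω * V ω) - 2 * (U ω * V ω)) μ :=
    j12.sub j3
  simp_rw [e]
  rw [integral_add i123 j123, integral_add i12 i3, integral_add i1 i2, integral_sub j12 j3,
    integral_sub j1 j2, integral_const_mul, integral_const_mul, integral_const_mul,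
    hHU.integral_fun_mul_eq_mul_integral hH.1 hU.1,
    hHV.integral_fun_mul_eq_mul_integral hH.1 hV.1, hUV, hH0]
  ring

namespace BlindRegression

section Concentration

variable {m n : ℕ} {X₁ X₂ : Type*} [MeasurableSpace X₂]

/-- The mean over the columns of the difference of the rows with features `a` and `b`. -/
noncomputable def meanDiff (P₂ : Measure X₂) (f : X₁ → X₂ → ℝ) (a b : X₁) : ℝ :=
  ∫ y, (f a y - f b y) ∂P₂

/-- The variance over the columns of the difference of the rows with features `a` and `b`. -/
noncomputable def varDiff (P₂ : Measure X₂) (f : X₁ → X₂ → ℝ) (a b : X₁) : ℝ :=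
  ∫ y, (f a y - f b y - meanDiff P₂ f a b) ^ 2 ∂P₂

/-- The centred difference of the rows `u` and `v`, with features `a` and `b`, in column `j`. -/
noncomputable def centredDiff (P₂ : Measure X₂) (f : X₁ → X₂ → ℝ) (a b : X₁) (u v : Fin m)
    (j : Fin n) (z : (Fin n → X₂) × (Fin m × Fin n → ℝ)) : ℝ :=
  f a (z.1 j) + z.2 (u, j) - (f b (z.1 j) + z.2 (v, j)) - meanDiff P₂ f a b

variable {P₂ : Measure X₂} {f : X₁ → X₂ → ℝ} {c : ℝ} {γ B : ℝ}
  {ν : Fin m × Fin n → Measure ℝ}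

theorem varDiff_nonneg (a b : X₁) : 0 ≤ varDiff P₂ f a b :=
  integral_nonneg fun _ => sq_nonneg _

theorem varDiff_self (a : X₁) : varDiff P₂ f a a = 0 := by
  simp [varDiff, meanDiff]

theorem measurable_centredDiff (hfm : ∀ a, Measurable (f a)) (a b : X₁) (u v : Fin m)
    (j : Fin n) : Measurable (centredDiff P₂ f a b u v j) := by
  unfold centredDiff
  have h : Measurable fun z : (Fin n → X₂) × (Fin m × Fin n → ℝ) => z.1 j :=
    (measurable_pi_apply j).comp measurable_fst
  have ha : Measurable fun z : (Fin n → X₂) × (Fin m × Fin n → ℝ) => f a (z.1 j) :=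
    (hfm a).comp h
  have hb : Measurable fun z : (Fin n → X₂) × (Fin m × Fin n → ℝ) => f b (z.1 j) :=
    (hfm b).comp h
  fun_prop

variable [IsProbabilityMeasure P₂]

theorem abs_meanDiff_le (hc : ∀ a b y, |f a y - f b y| ≤ c) (a b : X₁) :
    |meanDiff P₂ f a b| ≤ c := by
  have h := norm_integral_le_of_norm_le_const (μ := P₂) (f := fun y => f a y - f b y) (C := c)
    (.of_forall fun y => hc a b y)
  simpa [meanDiff] using h

theorem integrable_diff (hfm : ∀ a, Measurable (f a)) (hc : ∀ a b y, |f a y - f b y| ≤ c)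
    (a b : X₁) : Integrable (fun y => f a y - f b y) P₂ :=
  Integrable.of_bound ((hfm a).sub (hfm b)).aestronglyMeasurable c (.of_forall fun y => hc a b y)

/-- Zero variance means that the two rows are translates of each other, so the correction by the row
mean leaves no bias. -/
theorem ae_eq_meanDiff (hfm : ∀ a, Measurable (f a)) (hc : ∀ a b y, |f a y - f b y| ≤ c)
    {a b : X₁} (h : varDiff P₂ f a b = 0) : ∀ᵐ y ∂P₂, f a y - f b y = meanDiff P₂ f a b := by
  have hb : ∀ y, |f a y - f b y - meanDiff P₂ f a b| ≤ 2 * c := fun y => by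
    refine (abs_sub _ _).trans ?_
    have := hc a b y
    have := abs_meanDiff_le (P₂ := P₂) hc a b
    linarith
  have hint : Integrable (fun y => (f a y - f b y - meanDiff P₂ f a b) ^ 2) P₂ := by
    refine Integrable.of_bound (C := (2 * c) ^ 2)
      ((((hfm a).sub (hfm b)).sub_const _).pow_const 2).aestronglyMeasurable
      (.of_forall fun y => ?_)
    rw [Real.norm_eq_abs, abs_pow]
    gcongr
    exact hb y
  have := (integral_eq_zero_iff_of_nonneg (fun y => sq_nonneg _) hint).1 h
  filter_upwards [this] with y hy
  have hy' : (f a y - f b y - meanDiff P₂ f a b) ^ 2 = 0 := hy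
  have := pow_eq_zero_iff (two_ne_zero) |>.1 hy'
  linarith

theorem iIndepFun_centredDiff (hfm : ∀ a, Measurable (f a)) [∀ e, IsProbabilityMeasure (ν e)]
    (a b : X₁) (u v : Fin m) :
    iIndepFun (centredDiff (n := n) P₂ f a b u v)
      ((Measure.pi fun _ => P₂).prod (Measure.pi ν)) := by
  have h1 : iIndepFun (fun (j : Fin n) (y : Fin n → X₂) => y j) (Measure.pi fun _ => P₂) :=
    iIndepFun_pi (X := fun _ x => x) fun _ => aemeasurable_id'
  have h2 := h1.prodMap (iIndepFun_columns ν) (fun _ => by fun_prop) (fun _ => by fun_prop)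
  have h3 : Measurable fun q : X₂ × (Fin m → ℝ) =>
      f a q.1 + q.2 u - (f b q.1 + q.2 v) - meanDiff P₂ f a b := by
    have ha : Measurable fun q : X₂ × (Fin m → ℝ) => f a q.1 := (hfm a).comp measurable_fst
    have hb : Measurable fun q : X₂ × (Fin m → ℝ) => f b q.1 := (hfm b).comp measurable_fst
    fun_prop
  exact h2.comp (fun _ => fun q : X₂ × (Fin m → ℝ) =>
      f a q.1 + q.2 u - (f b q.1 + q.2 v) - meanDiff P₂ f a b) fun _ => h3

theorem ae_abs_centredDiff_le (hc : ∀ a b y, |f a y - f b y| ≤ c)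
    (hν : ∀ e, IsNoiseLaw γ B (ν e)) (a b : X₁) (u v : Fin m) (j : Fin n) :
    ∀ᵐ z ∂(Measure.pi fun _ => P₂).prod (Measure.pi ν),
      |centredDiff P₂ f a b u v j z| ≤ 2 * c + 2 * B := by
  have := fun e => (hν e).isProbabilityMeasure
  filter_upwards [Measure.quasiMeasurePreserving_snd.ae (IsNoiseLaw.ae_pi hν)] with z hz
  have h1 := abs_le.1 (hc a b (z.1 j))
  have h2 := abs_le.1 (abs_meanDiff_le (P₂ := P₂) hc a b)
  have h3 := abs_le.1 (hz (u, j))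
  have h4 := abs_le.1 (hz (v, j))
  rw [centredDiff, abs_le]
  constructor <;> linarith

theorem integral_fst_eval (hg : X₂ → ℝ) (hgm : Measurable hg) [∀ e, IsProbabilityMeasure (ν e)]
    (j : Fin n) :
    ∫ z, hg (z.1 j) ∂(Measure.pi fun _ => P₂).prod (Measure.pi ν) = ∫ y, hg y ∂P₂ := by
  have h := measurePreserving_eval (fun _ : Fin n => P₂) j
  have h1 := (measurePreserving_fst (μ := Measure.pi fun _ : Fin n => P₂) (ν := Measure.pi ν))
  have h2 := h.comp h1
  have h3 := integral_map (μ := (Measure.pi fun _ : Fin n => P₂).prod (Measure.pi ν))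
    h2.measurable.aemeasurable (f := hg) hgm.aestronglyMeasurable
  rw [h2.map_eq] at h3
  exact h3.symm

theorem integral_snd_noise (hg : (Fin m × Fin n → ℝ) → ℝ) (hgm : Measurable hg)
    [∀ e, IsProbabilityMeasure (ν e)] :
    ∫ z, hg z.2 ∂(Measure.pi fun _ : Fin n => P₂).prod (Measure.pi ν) =
      ∫ η, hg η ∂Measure.pi ν := by
  have h2 := (measurePreserving_snd (μ := Measure.pi fun _ : Fin n => P₂) (ν := Measure.pi ν))
  have h3 := integral_map (μ := (Measure.pi fun _ : Fin n => P₂).prod (Measure.pi ν))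
    h2.measurable.aemeasurable (f := hg) hgm.aestronglyMeasurable
  rw [h2.map_eq] at h3
  exact h3.symm

theorem integral_centredDiff (hfm : ∀ a, Measurable (f a)) (hc : ∀ a b y, |f a y - f b y| ≤ c)
    (hν : ∀ e, IsNoiseLaw γ B (ν e)) (a b : X₁) {u v : Fin m} (huv : u ≠ v) (j : Fin n) :
    ∫ z, centredDiff P₂ f a b u v j z ∂(Measure.pi fun _ => P₂).prod (Measure.pi ν) = 0 ∧
    ∫ z, centredDiff P₂ f a b u v j z ^ 2 ∂(Measure.pi fun _ => P₂).prod (Measure.pi ν) =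
      varDiff P₂ f a b + 2 * γ ^ 2 := by
  have := fun e => (hν e).isProbabilityMeasure
  set μ' := (Measure.pi fun _ : Fin n => P₂).prod (Measure.pi ν) with hμ'
  set h : X₂ → ℝ := fun y => f a y - f b y - meanDiff P₂ f a b with hh
  have hm : Measurable h := ((hfm a).sub (hfm b)).sub_const _
  have hb : ∀ y, |h y| ≤ 2 * c := fun y => by
    refine (abs_sub _ _).trans ?_
    have := hc a b y
    have := abs_meanDiff_le (P₂ := P₂) hc a b
    linarith
  have hz : ∀ᵐ z ∂μ', ∀ e, |z.2 e| ≤ B :=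
    Measure.quasiMeasurePreserving_snd.ae (IsNoiseLaw.ae_pi hν)
  have mev : ∀ e, Measurable fun z : (Fin n → X₂) × (Fin m × Fin n → ℝ) => z.2 e :=
    fun e => by fun_prop
  have mH : Measurable fun z : (Fin n → X₂) × (Fin m × Fin n → ℝ) => h (z.1 j) :=
    hm.comp ((measurable_pi_apply j).comp measurable_fst)
  have lH : MemLp (fun z : (Fin n → X₂) × (Fin m × Fin n → ℝ) => h (z.1 j)) 2 μ' :=
    MemLp.of_bound mH.aestronglyMeasurable (2 * c) (.of_forall fun z => hb _)
  have lE : ∀ e, MemLp (fun z : (Fin n → X₂) × (Fin m × Fin n → ℝ) => z.2 e) 2 μ' := fun e =>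
    MemLp.of_bound (mev e).aestronglyMeasurable B
      (by filter_upwards [hz] with z hz using hz e)
  have iH : ∫ z, h (z.1 j) ∂μ' = 0 := by
    rw [integral_fst_eval h hm j, hh, integral_sub (integrable_diff hfm hc a b)
      (integrable_const _)]
    simp [meanDiff]
  have iH2 : ∫ z, h (z.1 j) ^ 2 ∂μ' = varDiff P₂ f a b :=
    integral_fst_eval (fun y => h y ^ 2) (hm.pow_const 2) j
  have iE : ∀ e, ∫ z, z.2 e ∂μ' = 0 := fun e =>
    (integral_snd_noise (fun η => η e) (by fun_prop)).trans (IsNoiseLaw.integral_eval hν e)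
  have iE2 : ∀ e, ∫ z, z.2 e ^ 2 ∂μ' = γ ^ 2 := fun e =>
    (integral_snd_noise (fun η => η e ^ 2) (by fun_prop)).trans (IsNoiseLaw.integral_eval_sq hν e)
  have indHE : ∀ e, IndepFun (fun z : (Fin n → X₂) × (Fin m × Fin n → ℝ) => h (z.1 j))
      (fun z => z.2 e) μ' := fun e =>
    indepFun_prod (X := fun y : Fin n → X₂ => h (y j)) (Y := fun η : Fin m × Fin n → ℝ => η e)
      (hm.comp (measurable_pi_apply j)) (measurable_pi_apply e)
  have hne : (u, j) ≠ (v, j) := fun h => huv (congrArg Prod.fst h)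
  have iUV : ∫ z, z.2 (u, j) * z.2 (v, j) ∂μ' = 0 := by
    refine (integral_snd_noise (fun η => η (u, j) * η (v, j)) (by fun_prop)).trans ?_
    rw [((iIndepFun_noise ν).indepFun hne).integral_fun_mul_eq_mul_integral
      (measurable_pi_apply _).aestronglyMeasurable (measurable_pi_apply _).aestronglyMeasurable,
      IsNoiseLaw.integral_eval hν, zero_mul]
  have e : ∀ z, centredDiff P₂ f a b u v j z = h (z.1 j) + z.2 (u, j) - z.2 (v, j) := fun z => by
    rw [centredDiff, hh]
    ring
  constructor
  · simp_rw [e]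
    have l1 := lH.integrable one_le_two
    have l2 := fun e => (lE e).integrable one_le_two
    have l3 : Integrable (fun z => h (z.1 j) + z.2 (u, j)) μ' := l1.add (l2 _)
    rw [integral_sub l3 (l2 _), integral_add l1 (l2 _), iH, iE, iE]
    simp
  · simp_rw [e]
    rw [integral_sq_add_sub_of_indepFun lH (lE _) (lE _) (indHE _) (indHE _) iH iUV,
      iH2, iE2, iE2]
    ring

/-- The left side is the second moment of `centredDiff`, which is bounded by `b₀`; the column `j`
only serves to realise it. -/
theorem varDiff_add_le (hfm : ∀ a, Measurable (f a)) (hc : ∀ a b y, |f a y - f b y| ≤ c)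
    (hν : ∀ e, IsNoiseLaw γ B (ν e)) (a b : X₁) {u v : Fin m} (huv : u ≠ v) (j : Fin n) {b₀ : ℝ}
    (hb₀ : 2 * c + 2 * B ≤ b₀) : varDiff P₂ f a b + 2 * γ ^ 2 ≤ b₀ ^ 2 := by
  have := fun e => (hν e).isProbabilityMeasure
  rw [← (integral_centredDiff hfm hc hν a b huv j).2]
  have hbd : ∀ᵐ z ∂(Measure.pi fun _ => P₂).prod (Measure.pi ν),
      ‖centredDiff P₂ f a b u v j z ^ 2‖ ≤ b₀ ^ 2 := by
    filter_upwards [ae_abs_centredDiff_le hc hν a b u v j] with z hz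
    rw [Real.norm_eq_abs, abs_pow]
    gcongr
    exact hz.trans hb₀
  refine (le_abs_self _).trans ((norm_integral_le_of_norm_le_const hbd).trans ?_)
  simp

theorem measureReal_sum_centredDiff_le (hfm : ∀ a, Measurable (f a))
    (hc : ∀ a b y, |f a y - f b y| ≤ c) (hν : ∀ e, IsNoiseLaw γ B (ν e)) (a b : X₁)
    {u v : Fin m} (huv : u ≠ v) (O : Finset (Fin n)) {b₀ t : ℝ} (hb₀ : 2 * c + 2 * B ≤ b₀)
    (ht : 0 ≤ t) :
    ((Measure.pi fun _ => P₂).prod (Measure.pi ν)).real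
      {z | t * O.card ≤ |∑ j ∈ O, centredDiff P₂ f a b u v j z|} ≤
      2 * Real.exp (-(t ^ 2 * O.card) / (2 * b₀ ^ 2)) := by
  have := fun e => (hν e).isProbabilityMeasure
  refine measureReal_abs_sum_ge_le_of_iIndepFun (iIndepFun_centredDiff hfm a b u v) O
    (fun j _ => (measurable_centredDiff hfm a b u v j).aemeasurable) (fun j _ => ?_)
    (fun j _ => (integral_centredDiff hfm hc hν a b huv j).1) ht
  filter_upwards [ae_abs_centredDiff_le hc hν a b u v j] with z hz using hz.trans hb₀

/-- The square and its mean both lie in `[0, b₀ ^ 2]`, so their difference is bounded by `b₀ ^ 2`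
and Hoeffding applies. -/
theorem measureReal_sum_centredDiff_sq_le (hfm : ∀ a, Measurable (f a))
    (hc : ∀ a b y, |f a y - f b y| ≤ c) (hν : ∀ e, IsNoiseLaw γ B (ν e)) (a b : X₁)
    {u v : Fin m} (huv : u ≠ v) (O : Finset (Fin n)) {b₀ t : ℝ} (hb₀ : 2 * c + 2 * B ≤ b₀)
    (ht : 0 ≤ t) :
    ((Measure.pi fun _ => P₂).prod (Measure.pi ν)).real
      {z | t * O.card ≤ |∑ j ∈ O, (centredDiff P₂ f a b u v j z ^ 2 -
        (varDiff P₂ f a b + 2 * γ ^ 2))|} ≤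
      2 * Real.exp (-(t ^ 2 * O.card) / (2 * (b₀ ^ 2) ^ 2)) := by
  have := fun e => (hν e).isProbabilityMeasure
  have hsq : ∀ j : Fin n, ∀ᵐ z ∂(Measure.pi fun _ => P₂).prod (Measure.pi ν),
      centredDiff P₂ f a b u v j z ^ 2 ≤ b₀ ^ 2 := fun j => by
    filter_upwards [ae_abs_centredDiff_le hc hν a b u v j] with z hz
    rw [← sq_abs]
    gcongr
    exact hz.trans hb₀
  refine measureReal_abs_sum_ge_le_of_iIndepFun
    ((iIndepFun_centredDiff (ν := ν) (P₂ := P₂) hfm a b u v).comp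
      (fun _ x => x ^ 2 - (varDiff P₂ f a b + 2 * γ ^ 2)) fun _ => by fun_prop) O
    (fun j _ => (((measurable_centredDiff hfm a b u v j).pow_const 2).sub_const _).aemeasurable)
    (fun j _ => ?_) (fun j _ => ?_) ht
  · filter_upwards [hsq j] with z hz
    have h1 := varDiff_add_le (P₂ := P₂) hfm hc hν a b huv j hb₀
    have h2 : 0 ≤ varDiff P₂ f a b := varDiff_nonneg a b
    simp only [Function.comp_apply]
    rw [abs_le]
    constructor <;> nlinarith [sq_nonneg γ, sq_nonneg (centredDiff P₂ f a b u v j z)]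
  · simp only [Function.comp_apply]
    rw [integral_sub, (integral_centredDiff hfm hc hν a b huv j).2]
    · simp
    · refine Integrable.of_bound (C := b₀ ^ 2)
        ((measurable_centredDiff hfm a b u v j).pow_const 2).aestronglyMeasurable ?_
      filter_upwards [hsq j] with z hz
      rwa [Real.norm_eq_abs, abs_of_nonneg (sq_nonneg _)]
    · exact integrable_const _

end Concentration

end BlindRegression

theorem measure_exists_le {Ω ι : Type*} [MeasurableSpace Ω] [Fintype ι] {μ : Measure Ω}
    {A : ι → Set Ω} {c : ℝ} (hc : ∀ i, μ (A i) ≤ ENNReal.ofReal c) :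
    μ {ω | ∃ i, ω ∈ A i} ≤ ENNReal.ofReal (Fintype.card ι * c) := by
  have : {ω | ∃ i, ω ∈ A i} = ⋃ i, A i := by
    ext
    simp
  rw [this, ENNReal.ofReal_mul (by positivity), ENNReal.ofReal_natCast]
  refine (measure_iUnion_fintype_le _ _).trans ((Finset.sum_le_sum fun i _ => hc i).trans ?_)
  simp

namespace BlindRegression

/-! ### From exceptional events to the mean squared error. -/

section Bounds

variable {m n : ℕ} {X₁ X₂ : Type*} [MeasurableSpace X₁] [MeasurableSpace X₂]
  {P₁ : Measure X₁} [IsProbabilityMeasure P₁] {P₂ : Measure X₂} [IsProbabilityMeasure P₂]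
  {f : X₁ → X₂ → ℝ} {ν : Fin m × Fin n → Measure ℝ} {p : I}

/-- `G` is a global failure, while `E u i` is charged to its own entry. A union of the latter over
the columns is avoided, since `n` may be huge compared with `m p`. -/
theorem mse_le_of_forall (hm : 0 < m) (hn : 0 < n) [∀ e, IsProbabilityMeasure (ν e)] {β : ℝ}
    {k : ℕ} {r : Outcome m n X₁ X₂ → Fin m → Fin m → ℕ} {R Q δ₁ δ₂ : ℝ} (hR : 0 ≤ R) (hQ : 0 ≤ Q)
    (hδ₁ : 0 ≤ δ₁) (hδ₂ : 0 ≤ δ₂) {G : Set (Outcome m n X₁ X₂)}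
    {E : Fin m → Fin n → Set (Outcome m n X₁ X₂)}
    (hG : modelLaw P₁ P₂ ν p G ≤ ENNReal.ofReal δ₁)
    (hE : ∀ u i, modelLaw P₁ P₂ ν p (E u i) ≤ ENNReal.ofReal δ₂)
    (hle : ∀ᵐ ω ∂modelLaw P₁ P₂ ν p, ∀ u i,
      (estimate β k (observed ω) (noisy f ω) (r ω u) u i - signal f ω (u, i)) ^ 2 ≤ Q)
    (hgood : ∀ᵐ ω ∂modelLaw P₁ P₂ ν p, ω ∉ G → ∀ u, ∀ J : Finset (Fin n), (∀ i ∈ J, ω ∉ E u i) →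
      ∑ i ∈ J, (estimate β k (observed ω) (noisy f ω) (r ω u) u i - signal f ω (u, i)) ^ 2 ≤
        n * R) :
    mse P₁ P₂ f ν p β k r ≤ ENNReal.ofReal (R + Q * δ₁ + Q * δ₂) := by
  classical
  set μ := modelLaw P₁ P₂ ν p with hμ
  -- Measurable hulls of the same measure, so that the indicators can be integrated.
  set G' := toMeasurable μ G
  set E' := fun u i => toMeasurable μ (E u i)
  have hm' : (0 : ℝ) < m := by exact_mod_cast hm
  have hn' : (0 : ℝ) < n := by exact_mod_cast hn
  have hpt : ∀ᵐ ω ∂μ, ENNReal.ofReal ((1 / ((m : ℝ) * (n : ℝ))) * ∑ u : Fin m, ∑ i : Fin n,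
      (estimate β k (observed ω) (noisy f ω) (r ω u) u i - signal f ω (u, i)) ^ 2) ≤
      ENNReal.ofReal R + G'.indicator (fun _ => ENNReal.ofReal Q) ω +
        ∑ u : Fin m, ∑ i : Fin n, (E' u i).indicator
          (fun _ => ENNReal.ofReal (Q / (m * n))) ω := by
    filter_upwards [hle, hgood] with ω h1 h2
    by_cases hωG : ω ∈ G
    · have hωG' : ω ∈ G' := subset_toMeasurable μ G hωG
      rw [Set.indicator_of_mem hωG']
      refine le_trans ?_ (le_trans le_add_self le_self_add)
      apply ENNReal.ofReal_le_ofReal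
      rw [one_div, inv_mul_le_iff₀ (by positivity)]
      refine (Finset.sum_le_sum fun u _ => Finset.sum_le_sum fun i _ => h1 u i).trans ?_
      simp [mul_assoc]
    · refine le_trans ?_ (add_le_add_left (b := ENNReal.ofReal R) le_self_add _)
      have hsum : ∑ u : Fin m, ∑ i : Fin n, (E' u i).indicator
          (fun _ => ENNReal.ofReal (Q / (m * n))) ω =
          ENNReal.ofReal (∑ u : Fin m, ∑ i : Fin n,
            (E' u i).indicator (fun _ => Q / (m * n)) ω) := by
        have hnn : ∀ u i, 0 ≤ (E' u i).indicator (fun _ => Q / (m * n : ℝ)) ω := fun u i =>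
          Set.indicator_nonneg (fun _ _ => by positivity) _
        rw [ENNReal.ofReal_sum_of_nonneg fun u _ => Finset.sum_nonneg fun i _ => hnn u i]
        refine Finset.sum_congr rfl fun u _ => ?_
        rw [ENNReal.ofReal_sum_of_nonneg fun i _ => hnn u i]
        refine Finset.sum_congr rfl fun i _ => ?_
        by_cases h : ω ∈ E' u i <;> simp [h]
      rw [hsum, ← ENNReal.ofReal_add hR (Finset.sum_nonneg fun u _ => Finset.sum_nonneg fun i _ =>
        Set.indicator_nonneg (fun _ _ => by positivity) _)]
      apply ENNReal.ofReal_le_ofReal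
      have hrow : ∀ u, ∑ i, (estimate β k (observed ω) (noisy f ω) (r ω u) u i -
          signal f ω (u, i)) ^ 2 ≤ n * R + ∑ i, (E' u i).indicator (fun _ => Q) ω := by
        intro u
        rw [← Finset.sum_filter_add_sum_filter_not Finset.univ (fun i => ω ∉ E u i)]
        apply add_le_add
        · exact h2 hωG u _ fun i hi => (Finset.mem_filter.1 hi).2
        · rw [Finset.sum_filter]
          refine Finset.sum_le_sum fun i _ => ?_
          by_cases h : ω ∈ E u i
          · have h' : ω ∈ E' u i := subset_toMeasurable μ _ h
            simpa [h, h'] using h1 u i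
          · simpa [h] using Set.indicator_nonneg (fun _ _ => hQ) _
      have e1 : ∀ u i, (E' u i).indicator (fun _ => Q / (m * n : ℝ)) ω =
          (1 / (m * n)) * (E' u i).indicator (fun _ => Q) ω := fun u i => by
        by_cases h : ω ∈ E' u i <;> simp [h]
        ring
      simp_rw [e1, ← Finset.mul_sum]
      calc _ ≤ 1 / ((m : ℝ) * n) * ∑ u : Fin m, (n * R + ∑ i, (E' u i).indicator (fun _ => Q) ω) :=
            by
              gcongr with u
              exact hrow u
        _ = _ := by
          rw [Finset.sum_add_distrib, mul_add]
          congr 1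
          simp only [Finset.sum_const, Finset.card_univ, Fintype.card_fin, nsmul_eq_mul]
          field_simp
  have hind : ∀ u i, Measurable ((E' u i).indicator
      (fun _ : Outcome m n X₁ X₂ => ENNReal.ofReal (Q / (m * n)))) := fun u i =>
    measurable_const.indicator (measurableSet_toMeasurable _ _)
  have hindG : Measurable (G'.indicator (fun _ : Outcome m n X₁ X₂ => ENNReal.ofReal Q)) :=
    measurable_const.indicator (measurableSet_toMeasurable _ _)
  rw [mse]
  refine (lintegral_mono_ae hpt).trans ?_
  rw [lintegral_add_left (by fun_prop), lintegral_add_left (by fun_prop),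
    lintegral_finsetSum _ (fun u _ => by fun_prop)]
  simp_rw [fun u => lintegral_finsetSum (μ := μ) Finset.univ (fun i _ => hind u i)]
  have hEint : ∀ u i, ∫⁻ ω, (E' u i).indicator (fun _ => ENNReal.ofReal (Q / (m * n))) ω ∂μ =
      ENNReal.ofReal (Q / (m * n)) * μ (E u i) := fun u i => by
    rw [lintegral_indicator_const (measurableSet_toMeasurable μ (E u i)), measure_toMeasurable]
  simp_rw [hEint]
  rw [lintegral_indicator_const (measurableSet_toMeasurable μ G), measure_toMeasurable,
    lintegral_const, measure_univ, mul_one, ENNReal.ofReal_add (by positivity) (by positivity),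
    ENNReal.ofReal_add (by positivity) (by positivity)]
  gcongr
  · rw [ENNReal.ofReal_mul hQ]
    gcongr
  · calc _ ≤ ∑ u : Fin m, ∑ i : Fin n, ENNReal.ofReal (Q / (m * n)) * ENNReal.ofReal δ₂ := by
          gcongr with u _ i _
          exact hE u i
      _ = ENNReal.ofReal (Q * δ₂) := by
          simp only [Finset.sum_const, Finset.card_univ, Fintype.card_fin, nsmul_eq_mul]
          rw [← ENNReal.ofReal_mul (by positivity), ← ENNReal.ofReal_natCast,
            ← ENNReal.ofReal_natCast, ← ENNReal.ofReal_mul (by positivity),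
            ← ENNReal.ofReal_mul (by positivity)]
          congr 1
          field_simp

theorem modelLaw_exists_overlap_le [∀ e, IsProbabilityMeasure (ν e)] :
    modelLaw P₁ P₂ ν p {ω | ∃ q : Fin m × Fin m, q.1 ≠ q.2 ∧
      ((overlap (observed ω) q.1 q.2).card : ℝ) ≤ overlapThreshold n p} ≤
      ENNReal.ofReal (m ^ 2 * Real.exp (-(n * (p : ℝ) ^ 2) / 10)) := by
  have h := measure_exists_le (μ := modelLaw P₁ P₂ ν p)
    (A := fun q : Fin m × Fin m => {ω | ω.2.2.2 ∈ {D | q.1 ≠ q.2 ∧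
      ((overlap D q.1 q.2).card : ℝ) ≤ overlapThreshold n p}})
    (c := Real.exp (-(n * (p : ℝ) ^ 2) / 10)) fun q => by
      rw [modelLaw_pattern_le]
      by_cases hq : q.1 = q.2
      · simp [hq]
      · refine (measure_mono fun D hD => ?_).trans
          (measure_le_ofReal_of_measureReal_le (patternLaw_overlap_le p hq))
        exact hD.2
  refine h.trans (le_of_eq ?_)
  congr 1
  simp [sq]

theorem modelLaw_exists_sparse_columns_le [∀ e, IsProbabilityMeasure (ν e)] {K k b : ℕ}
    (hk : (k : ℝ) ≤ K * p / 2) :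
    modelLaw P₁ P₂ ν p {ω | ∃ ρ : Fin K → Fin m, Function.Injective ρ ∧
      b ≤ (Finset.univ.filter fun i =>
      (Finset.univ.filter fun j => observed ω (ρ j, i) = true).card < k).card} ≤
      ENNReal.ofReal (m ^ K * (2 ^ n * Real.exp (-(b * K * p) / 10))) := by
  have h := measure_exists_le (μ := modelLaw P₁ P₂ ν p)
    (A := fun ρ : Fin K → Fin m => {ω | ω.2.2.2 ∈ {D | Function.Injective ρ ∧
      b ≤ (Finset.univ.filter fun i =>
      (Finset.univ.filter fun j => D (ρ j, i) = true).card < k).card}})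
    (c := 2 ^ n * Real.exp (-(b * K * p) / 10)) fun ρ => by
      rw [modelLaw_pattern_le]
      by_cases hρ : Function.Injective ρ
      · refine (measure_mono fun D hD => ?_).trans
          (measure_le_ofReal_of_measureReal_le (patternLaw_sparse_columns_le p hρ hk))
        exact hD.2
      · simp [hρ]
  refine h.trans (le_of_eq ?_)
  congr 1
  simp

theorem modelLaw_exists_noise_le {γ B : ℝ} (hB : 0 < B) (hν : ∀ e, IsNoiseLaw γ B (ν e)) (K k : ℕ)
    (s : ℝ) :
    modelLaw P₁ P₂ ν p {ω | ∃ ρ : Fin K → Fin m, 4 * B ^ 2 * s ≤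
      ∑ i, (∑ v ∈ firstObserved k (observed ω) ρ i, ω.2.2.1 (v, i)) ^ 2 /
        (firstObserved k (observed ω) ρ i).card} ≤
      ENNReal.ofReal (m ^ K * (2 ^ n * Real.exp (-s))) := by
  have := fun e => (hν e).isProbabilityMeasure
  refine modelLaw_setOf_mem_le P₁ P₂ ν p (fun D => {z | ∃ ρ : Fin K → Fin m, 4 * B ^ 2 * s ≤
      ∑ i, (∑ v ∈ firstObserved k D ρ i, z.2.2 (v, i)) ^ 2 /
        (firstObserved k D ρ i).card}) fun D => ?_
  have h := measure_exists_le (μ := Measure.pi ν)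
    (A := fun ρ : Fin K → Fin m => {η | 4 * B ^ 2 * s ≤
      ∑ i, (∑ v ∈ firstObserved k D ρ i, η (v, i)) ^ 2 / (firstObserved k D ρ i).card})
    (c := 2 ^ n * Real.exp (-s)) fun ρ => IsNoiseLaw.measure_sum_sq_le hB hν _ s
  have hset : {z : (Fin m → X₁) × (Fin n → X₂) × (Fin m × Fin n → ℝ) |
      ∃ ρ : Fin K → Fin m, 4 * B ^ 2 * s ≤
      ∑ i, (∑ v ∈ firstObserved k D ρ i, z.2.2 (v, i)) ^ 2 / (firstObserved k D ρ i).card} =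
      Set.univ ×ˢ (Set.univ ×ˢ {η | ∃ ρ : Fin K → Fin m, η ∈ {η : Fin m × Fin n → ℝ |
        4 * B ^ 2 * s ≤ ∑ i, (∑ v ∈ firstObserved k D ρ i, η (v, i)) ^ 2 /
          (firstObserved k D ρ i).card}}) := by
    ext z
    simp
  rw [hset, Measure.prod_prod, Measure.prod_prod, measure_univ, measure_univ, one_mul, one_mul]
  refine h.trans (le_of_eq ?_)
  congr 1
  simp

/-- The row features are random, but they take values in a finite set, so a union over pairs `(a,
b)` of fixed features replaces conditioning on them. The overlaps are fixed by the pattern. -/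
theorem modelLaw_exists_deviation_le {γ B c : ℝ} (hfm : ∀ a, Measurable (f a))
    (hc : ∀ a b y, |f a y - f b y| ≤ c) (hν : ∀ e, IsNoiseLaw γ B (ν e)) {b₀ τ t : ℝ}
    (hb₀ : 2 * c + 2 * B ≤ b₀) (hτ : 0 ≤ τ) (ht : 0 ≤ t) (T : Finset X₁) :
    modelLaw P₁ P₂ ν p {ω | ∃ q : (Fin m × Fin m) × (T × T), q.1.1 ≠ q.1.2 ∧
      overlapThreshold n p ≤ ((overlap (observed ω) q.1.1 q.1.2).card : ℝ) ∧
      (τ * (overlap (observed ω) q.1.1 q.1.2).card ≤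
        |∑ j ∈ overlap (observed ω) q.1.1 q.1.2,
          centredDiff P₂ f q.2.1 q.2.2 q.1.1 q.1.2 j (ω.2.1, ω.2.2.1)| ∨
       t * (overlap (observed ω) q.1.1 q.1.2).card ≤
        |∑ j ∈ overlap (observed ω) q.1.1 q.1.2,
          (centredDiff P₂ f q.2.1 q.2.2 q.1.1 q.1.2 j (ω.2.1, ω.2.2.1) ^ 2 -
            (varDiff P₂ f q.2.1 q.2.2 + 2 * γ ^ 2))|)} ≤
      ENNReal.ofReal ((m ^ 2 * (T.card : ℝ) ^ 2) *
        (2 * Real.exp (-(τ ^ 2 * overlapThreshold n p) / (2 * b₀ ^ 2)) +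
          2 * Real.exp (-(t ^ 2 * overlapThreshold n p) / (2 * (b₀ ^ 2) ^ 2)))) := by
  have := fun e => (hν e).isProbabilityMeasure
  set A : (Fin m × Fin n → Bool) → (Fin m × Fin m) × (T × T) →
    Set ((Fin n → X₂) × (Fin m × Fin n → ℝ)) := fun D q =>
    {z | q.1.1 ≠ q.1.2 ∧ overlapThreshold n p ≤ ((overlap D q.1.1 q.1.2).card : ℝ) ∧
      (τ * (overlap D q.1.1 q.1.2).card ≤
        |∑ j ∈ overlap D q.1.1 q.1.2, centredDiff P₂ f q.2.1 q.2.2 q.1.1 q.1.2 j z| ∨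
       t * (overlap D q.1.1 q.1.2).card ≤
        |∑ j ∈ overlap D q.1.1 q.1.2, (centredDiff P₂ f q.2.1 q.2.2 q.1.1 q.1.2 j z ^ 2 -
            (varDiff P₂ f q.2.1 q.2.2 + 2 * γ ^ 2))|)} with hA
  refine modelLaw_setOf_mem_le P₁ P₂ ν p (fun D => {z | ∃ q, z.2 ∈ A D q}) fun D => ?_
  have hset : {z : (Fin m → X₁) × (Fin n → X₂) × (Fin m × Fin n → ℝ) | ∃ q, z.2 ∈ A D q} =
      Set.univ ×ˢ {z | ∃ q, z ∈ A D q} := by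
    ext z
    simp
  rw [hset, Measure.prod_prod, measure_univ, one_mul]
  refine (measure_exists_le (c := 2 * Real.exp (-(τ ^ 2 * overlapThreshold n p) / (2 * b₀ ^ 2)) +
          2 * Real.exp (-(t ^ 2 * overlapThreshold n p) / (2 * (b₀ ^ 2) ^ 2))) fun q => ?_).trans
    (le_of_eq ?_)
  · by_cases hq : q.1.1 ≠ q.1.2 ∧ overlapThreshold n p ≤ ((overlap D q.1.1 q.1.2).card : ℝ)
    · have h1 := measureReal_sum_centredDiff_le (P₂ := P₂) hfm hc hν q.2.1 q.2.2 hq.1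
        (overlap D q.1.1 q.1.2) hb₀ hτ
      have h2 := measureReal_sum_centredDiff_sq_le (P₂ := P₂) hfm hc hν q.2.1 q.2.2 hq.1
        (overlap D q.1.1 q.1.2) hb₀ ht
      apply measure_le_ofReal_of_measureReal_le
      refine (measureReal_mono (fun z hz => hz.2.2) (measure_ne_top _ _)).trans ?_
      refine (measureReal_union_le _ _).trans (add_le_add (h1.trans ?_) (h2.trans ?_))
      · gcongr
        exact hq.2
      · gcongr
        exact hq.2
    · have : A D q = ∅ := by
        ext z
        simp only [hA, Set.mem_ofPred_eq, Set.mem_empty_iff_false, iff_false]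
        exact fun h => hq ⟨h.1, h.2.1⟩
      simp [this]
  · congr 1
    simp only [Fintype.card_prod, Fintype.card_fin, Fintype.card_coe]
    push_cast
    ring

/-- The rows other than `u` in which column `i` is observed. -/
def observedRows (D : Fin m × Fin n → Bool) (u : Fin m) (i : Fin n) : Finset (Fin m) :=
  Finset.univ.filter fun v => v ≠ u ∧ D (v, i) = true

theorem patternLaw_observedRows_le (p : I) (u : Fin m) (i : Fin n) :
    (patternLaw m n p).real {D | ((observedRows D u i).card : ℝ) ≤ ((m : ℝ) - 1) * p / 2} ≤
      Real.exp (-(((m : ℝ) - 1) * p) / 10) := by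
  classical
  have h := patternLaw_count_le p ((Finset.univ.erase u).map
    ⟨fun v => (v, i), fun v w h => congrArg Prod.fst h⟩)
  have hm : 1 ≤ m := u.pos
  simp only [Finset.card_map, Finset.filter_map, Finset.card_erase_of_mem (Finset.mem_univ _),
    Finset.card_univ, Fintype.card_fin, Nat.cast_sub hm, Nat.cast_one] at h
  refine le_trans (le_of_eq ?_) h
  congr 1
  ext D
  simp only [Set.mem_ofPred_eq, observedRows]
  have : (Finset.univ.filter fun v => v ≠ u ∧ D (v, i) = true) =
      (Finset.univ.erase u).filter ((fun e => D e = true) ∘ fun v => (v, i)) := by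
    ext v
    simp
  rw [this]
  rfl

/-- Two halvings: usually at least half the expected number of rows is observed in column `i`; given
the pattern, at least half the expected number of these have feature `a`. Taking all `a` in `T`
covers the random feature of row `u`. -/
theorem modelLaw_identicalRows_le [MeasurableSingletonClass X₁] [DecidableEq X₁]
    [∀ e, IsProbabilityMeasure (ν e)] {T : Finset X₁} {π : ℝ} (hπ : 0 ≤ π)
    (hT : ∀ a ∈ T, π ≤ P₁.real {a}) (u : Fin m) (i : Fin n) :
    modelLaw P₁ P₂ ν p {ω | ∃ a : T, (((observedRows (observed ω) u i).filter
      fun v => ω.1 v = a).card : ℝ) ≤ ((m : ℝ) - 1) * p * π / 4} ≤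
      ENNReal.ofReal (Real.exp (-(((m : ℝ) - 1) * p) / 10) +
        T.card * Real.exp (-(((m : ℝ) - 1) * p * π) / 20)) := by
  have hm : (0 : ℝ) ≤ (m : ℝ) - 1 := by
    have : (1 : ℝ) ≤ m := by exact_mod_cast u.pos
    linarith
  have hp := p.2.1
  set A : Set (Fin m × Fin n → Bool) :=
    {D | ((observedRows D u i).card : ℝ) ≤ ((m : ℝ) - 1) * p / 2} with hA
  set C : (Fin m × Fin n → Bool) → T → Set (Fin m → X₁) := fun D a =>
    {x | D ∉ A ∧ (((observedRows D u i).filter fun v => x v = a).card : ℝ) ≤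
      ((m : ℝ) - 1) * p * π / 4} with hC
  have h1 : modelLaw P₁ P₂ ν p {ω | ω.2.2.2 ∈ A} ≤
      ENNReal.ofReal (Real.exp (-(((m : ℝ) - 1) * p) / 10)) := by
    rw [modelLaw_pattern_le]
    exact measure_le_ofReal_of_measureReal_le (patternLaw_observedRows_le p u i)
  have h2 : modelLaw P₁ P₂ ν p {ω | (ω.1, ω.2.1, ω.2.2.1) ∈
      {z : (Fin m → X₁) × (Fin n → X₂) × (Fin m × Fin n → ℝ) | ∃ a, z.1 ∈ C ω.2.2.2 a}} ≤
      ENNReal.ofReal (T.card * Real.exp (-(((m : ℝ) - 1) * p * π) / 20)) := by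
    refine modelLaw_setOf_mem_le P₁ P₂ ν p (fun D => {z | ∃ a, z.1 ∈ C D a}) fun D => ?_
    have hset : {z : (Fin m → X₁) × (Fin n → X₂) × (Fin m × Fin n → ℝ) | ∃ a, z.1 ∈ C D a} =
        {x | ∃ a, x ∈ C D a} ×ˢ Set.univ := by
      ext z
      simp
    rw [hset, Measure.prod_prod, measure_univ, mul_one]
    refine (measure_exists_le (c := Real.exp (-(((m : ℝ) - 1) * p * π) / 20))
      fun a => ?_).trans (le_of_eq (by simp))
    by_cases hD : D ∈ A
    · have : C D a = ∅ := by
        ext x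
        simp [hC, hD]
      simp [this]
    · have hD' : ((m : ℝ) - 1) * p / 2 < (observedRows D u i).card := by
        simpa [hA] using hD
      apply measure_le_ofReal_of_measureReal_le
      have h3 : ((m : ℝ) - 1) * p * π / 2 ≤ (observedRows D u i).card * P₁.real {(a : X₁)} := by
        have := hT a a.2
        calc ((m : ℝ) - 1) * p * π / 2 = ((m : ℝ) - 1) * p / 2 * π := by ring
          _ ≤ _ := by gcongr
      refine (measureReal_mono (fun x hx => ?_) (measure_ne_top _ _)).trans
        ((measureReal_card_eq_le P₁ (observedRows D u i) (a : X₁)).trans ?_)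
      · have := hx.2
        rw [Set.mem_ofPred_eq]
        linarith
      · exact Real.exp_le_exp.2 (by linarith)
  rw [ENNReal.ofReal_add (by positivity) (by positivity)]
  refine le_trans (measure_mono fun ω hω => ?_) ((measure_union_le _ _).trans (add_le_add h1 h2))
  obtain ⟨a, ha⟩ := hω
  by_cases hD : ω.2.2.2 ∈ A
  · exact Or.inl hD
  · exact Or.inr ⟨a, hD, ha⟩

end Bounds

/-! ### The squared error of one row on the good event. -/

section RowError

variable {m n : ℕ} {X₁ X₂ : Type*} [MeasurableSpace X₂] {P₂ : Measure X₂} {f : X₁ → X₂ → ℝ}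

/-- The squared error in row `u`, on the event that the overlaps with row `u` are large, the sample
moments are accurate, and the noise averages over sequences of rows are small. -/
theorem sum_sq_error_le (hn : 0 < n) {γ B₀ β : ℝ} {ω : Outcome m n X₁ X₂}
    {u : Fin m} {t τ t' s : ℝ} {k K b : ℕ} (hk : 0 < k) (hKm : K + 1 ≤ m) (hβ : 2 ≤ β)
    (ht : (2 * B₀) ^ 2 / (β - 1) + 2 * t' + 2 * τ ^ 2 ≤ t)
    {r : Fin m → ℕ} (hr : IsVarianceRanking β (observed ω) (noisy f ω) u r)
    (hη : ∀ e, |ω.2.2.1 e| ≤ B₀)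
    (hov : ∀ v, v ≠ u → β < (overlap (observed ω) u v).card)
    (hsums : ∀ v, v ≠ u →
      |∑ j ∈ overlap (observed ω) u v, (noisy f ω (u, j) - noisy f ω (v, j) -
        meanDiff P₂ f (ω.1 u) (ω.1 v))| ≤ τ * (overlap (observed ω) u v).card ∧
      |∑ j ∈ overlap (observed ω) u v, ((noisy f ω (u, j) - noisy f ω (v, j) -
        meanDiff P₂ f (ω.1 u) (ω.1 v)) ^ 2 - (varDiff P₂ f (ω.1 u) (ω.1 v) + 2 * γ ^ 2))| ≤
        t' * (overlap (observed ω) u v).card)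
    (hvarle : ∀ v, v ≠ u → varDiff P₂ f (ω.1 u) (ω.1 v) + 2 * γ ^ 2 ≤ (2 * B₀) ^ 2)
    (hgap : ∀ v, varDiff P₂ f (ω.1 u) (ω.1 v) = 0 ∨ 2 * t < varDiff P₂ f (ω.1 u) (ω.1 v))
    (hflat : ∀ v, varDiff P₂ f (ω.1 u) (ω.1 v) = 0 → ∀ i,
      f (ω.1 u) (ω.2.1 i) - f (ω.1 v) (ω.2.1 i) = meanDiff P₂ f (ω.1 u) (ω.1 v))
    (hnoise : ∀ ρ : Fin K → Fin m,
      ∑ i, (∑ v ∈ firstObserved k (observed ω) ρ i, ω.2.2.1 (v, i)) ^ 2 /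
        (firstObserved k (observed ω) ρ i).card ≤ 4 * B₀ ^ 2 * s)
    (hsparse : ∀ ρ : Fin K → Fin m, Function.Injective ρ → (Finset.univ.filter fun i =>
      (Finset.univ.filter fun j => observed ω (ρ j, i) = true).card < k).card ≤ b)
    {J : Finset (Fin n)} [DecidableEq X₁]
    (hJ : ∀ i ∈ J, k ≤ ((observedRows (observed ω) u i).filter fun v => ω.1 v = ω.1 u).card) :
    ∑ i ∈ J, (estimate β k (observed ω) (noisy f ω) r u i - signal f ω (u, i)) ^ 2 ≤
      n * (2 * (4 * B₀ ^ 2 * s / k + b * B₀ ^ 2) / n + 2 * τ ^ 2) := by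
  classical
  have hn' : (0 : ℝ) < n := by exact_mod_cast hn
  have hcomp : ∀ v, v ≠ u → v ∈ comparableRows β (observed ω) u := by
    intro v hv
    simp only [comparableRows, Finset.mem_filter, Finset.mem_univ, true_and]
    exact ⟨hv, (hov v hv).le⟩
  have hcomp' : ∀ v ∈ comparableRows β (observed ω) u, v ≠ u := by
    intro v hv
    simp only [comparableRows, Finset.mem_filter, Finset.mem_univ, true_and] at hv
    exact hv.1
  have hdev : ∀ v, v ≠ u →
      |rowMean (observed ω) (noisy f ω) u v - meanDiff P₂ f (ω.1 u) (ω.1 v)| ≤ τ ∧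
      |rowVar (observed ω) (noisy f ω) u v -
        (varDiff P₂ f (ω.1 u) (ω.1 v) + 2 * γ ^ 2)| ≤ t := by
    intro v hv
    set O := overlap (observed ω) u v with hO
    have hO1 := hov v hv
    have hO2 : 2 < O.card := by
      have : (2 : ℝ) < O.card := lt_of_le_of_lt hβ hO1
      exact_mod_cast this
    obtain ⟨h1, h2⟩ := hsums v hv
    refine ⟨abs_sampleMean_sub_le (zero_lt_two.trans hO2) h1, ?_⟩
    have hvar0 : 0 ≤ varDiff P₂ f (ω.1 u) (ω.1 v) := varDiff_nonneg _ _
    refine (abs_sampleVar_sub_le (b := (2 * B₀) ^ 2) hO2.le (by positivity)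
      (hvarle v hv) h1 h2).trans ?_
    refine le_trans ?_ ht
    have : 0 < β - 1 := by linarith
    gcongr
  -- Rows with the same feature as `u` reach the minimal level `2 * γ ^ 2`.
  have hcand : ∀ i ∈ J, k ≤ ((candidates β (observed ω) u i).filter
      fun w => varDiff P₂ f (ω.1 u) (ω.1 w) + 2 * γ ^ 2 = 2 * γ ^ 2).card := by
    intro i hi
    have h2 := hJ i hi
    refine h2.trans (Finset.card_le_card fun v hv => ?_)
    simp only [observedRows, Finset.mem_filter, Finset.mem_univ, true_and] at hv
    rw [Finset.mem_filter, mem_candidates, hv.2, varDiff_self, zero_add]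
    exact ⟨⟨hcomp v hv.1.1, hv.1.2⟩, rfl⟩
  have hcard : ∀ i ∈ J,
      (neighbours β k (observed ω) r u i).card = k := by
    intro i hi
    rw [card_neighbours hr.1]
    exact min_eq_left ((hcand i hi).trans (Finset.card_filter_le _ _))
  have hnb : ∀ i, ∀ v ∈ neighbours β k (observed ω) r u i, v ≠ u := by
    intro i v hv
    exact hcomp' v (mem_candidates.1 (Finset.mem_filter.1 hv).1).1
  have hrow : ∀ i ∈ J,
      (estimate β k (observed ω) (noisy f ω) r u i -
        signal f ω (u, i)) ^ 2 ≤
      2 * ((∑ v ∈ neighbours β k (observed ω) r u i,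
        ω.2.2.1 (v, i)) / k) ^ 2 + 2 * τ ^ 2 := by
    intro i hi
    refine sq_estimate_sub_le (a := signal f ω) (h := ω.2.2.1)
      (g := fun v => meanDiff P₂ f (ω.1 u) (ω.1 v)) hk (hcard i hi) (fun v hv => ?_)
      (fun v hv => (hdev v (hnb i v hv)).1)
    have hv1 := le_add_of_mem_neighbours hr
      (G := fun w => varDiff P₂ f (ω.1 u) (ω.1 w) + 2 * γ ^ 2) (g₀ := 2 * γ ^ 2)
      (fun w hw => (hdev w (hcomp' w hw)).2) (hcand i hi) hv
    -- Ranking gives `varDiff ≤ 2 * t`, and the gap leaves only zero.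
    have hv2 : varDiff P₂ f (ω.1 u) (ω.1 v) = 0 := by
      rcases hgap v with h | h
      · exact h
      · linarith
    have hv3 := hflat v hv2 i
    simp only [signal]
    linarith
  have havg := sum_sq_average_le (b := b) (s := 4 * B₀ ^ 2 * s) hk hr.1 hcomp hKm
    hη (fun ρ _ => hnoise ρ) hsparse hcard
  calc _ ≤ ∑ i ∈ J, (2 * ((∑ v ∈ neighbours β k (observed ω) r u i,
        ω.2.2.1 (v, i)) / k) ^ 2 + 2 * τ ^ 2) := Finset.sum_le_sum hrow
    _ = 2 * ∑ i ∈ J, ((∑ v ∈ neighbours β k (observed ω) r u i,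
        ω.2.2.1 (v, i)) / k) ^ 2 + J.card * (2 * τ ^ 2) := by
        rw [Finset.sum_add_distrib, Finset.mul_sum, Finset.sum_const, nsmul_eq_mul]
    _ ≤ 2 * (4 * B₀ ^ 2 * s / k + b * B₀ ^ 2) + n * (2 * τ ^ 2) := by
        gcongr
        simpa using J.card_le_univ
    _ = n * (2 * (4 * B₀ ^ 2 * s / k + b * B₀ ^ 2) / n + 2 * τ ^ 2) := by
        field_simp

end RowError

/-! ### Bounds for finite `m` and `n`. -/

section Main

variable {m n : ℕ} {X₁ X₂ : Type*} [MeasurableSpace X₁] [MeasurableSpace X₂]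
  {P₁ : Measure X₁} {P₂ : Measure X₂} {f : X₁ → X₂ → ℝ} {ν : Fin m × Fin n → Measure ℝ} {p : I}

theorem IsNoiseLaw.mono {γ B B' : ℝ} {ν : Measure ℝ} (h : IsNoiseLaw γ B ν) (hB : B ≤ B') :
    IsNoiseLaw γ B' ν :=
  ⟨h.1, h.2.mono fun _ hx => hx.trans hB, h.3, h.4⟩

theorem ae_noise_le {γ B : ℝ} (hν : ∀ e, IsNoiseLaw γ B (ν e)) :
    ∀ᵐ ω ∂modelLaw P₁ P₂ ν p, ∀ e, |ω.2.2.1 e| ≤ B := by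
  have := fun e => (hν e).isProbabilityMeasure
  exact Measure.quasiMeasurePreserving_snd.ae (Measure.quasiMeasurePreserving_snd.ae
    (Measure.quasiMeasurePreserving_fst.ae (IsNoiseLaw.ae_pi hν)))

theorem ae_rowFeature_mem [IsProbabilityMeasure P₁] [∀ e, IsProbabilityMeasure (ν e)]
    {T : Set X₁} (hT : P₁ Tᶜ = 0) :
    ∀ᵐ ω ∂modelLaw P₁ P₂ ν p, ∀ u, ω.1 u ∈ T := by
  rw [ae_all_iff]
  intro u
  exact Measure.quasiMeasurePreserving_fst.ae
    ((Measure.quasiMeasurePreserving_eval (fun _ : Fin m => P₁) u).ae (p := fun x => x ∈ T) hT)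

theorem ae_columnFeature [IsProbabilityMeasure P₂] [∀ e, IsProbabilityMeasure (ν e)] {q : X₂ → Prop}
    (hq : ∀ᵐ y ∂P₂, q y) : ∀ᵐ ω ∂modelLaw P₁ P₂ ν p, ∀ i, q (ω.2.1 i) := by
  rw [ae_all_iff]
  intro i
  exact Measure.quasiMeasurePreserving_snd.ae (Measure.quasiMeasurePreserving_fst.ae
    ((Measure.quasiMeasurePreserving_eval (fun _ : Fin n => P₂) i).ae hq))

theorem ae_sq_error_le {γ Be c B₀ Q : ℝ} (hc : ∀ a b y, |f a y - f b y| ≤ c)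
    (hν : ∀ e, IsNoiseLaw γ Be (ν e)) (hB₀ : c + 2 * Be ≤ B₀) (hc0 : 0 ≤ c) (hBe : 0 ≤ Be)
    (hF : ∀ x y, f x y ^ 2 ≤ Q) (hQ : 4 * B₀ ^ 2 ≤ Q) {β : ℝ} {k : ℕ}
    (r : Outcome m n X₁ X₂ → Fin m → Fin m → ℕ) :
    ∀ᵐ ω ∂modelLaw P₁ P₂ ν p, ∀ u i,
      ((neighbours β k (observed ω) (r ω u) u i).Nonempty →
        (estimate β k (observed ω) (noisy f ω) (r ω u) u i - signal f ω (u, i)) ^ 2 ≤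
          4 * B₀ ^ 2) ∧
      (estimate β k (observed ω) (noisy f ω) (r ω u) u i - signal f ω (u, i)) ^ 2 ≤ Q := by
  have := fun e => (hν e).isProbabilityMeasure
  filter_upwards [ae_noise_le hν] with ω hω u i
  have h1 : (neighbours β k (observed ω) (r ω u) u i).Nonempty →
      (estimate β k (observed ω) (noisy f ω) (r ω u) u i - signal f ω (u, i)) ^ 2 ≤
        4 * B₀ ^ 2 := by
    intro hne
    refine (sq_estimate_sub_le_of_nonempty (a := signal f ω) (h := ω.2.2.1) hne
      (fun v w j => hc _ _ _) hω).trans ?_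
    nlinarith
  refine ⟨h1, ?_⟩
  by_cases hne : (neighbours β k (observed ω) (r ω u) u i).Nonempty
  · exact (h1 hne).trans hQ
  · rw [estimate_eq_zero hne, zero_sub, neg_sq]
    exact hF _ _

variable [IsProbabilityMeasure P₁] [IsProbabilityMeasure P₂]

/-- A bound on the mean squared error for finite `m` and `n`. -/
theorem mse_le_of_finite [MeasurableSingletonClass X₁] (hn : 0 < n)
    {γ Be c B₀ Q : ℝ} (hfm : ∀ a, Measurable (f a)) (hc : ∀ a b y, |f a y - f b y| ≤ c)
    (hν : ∀ e, IsNoiseLaw γ Be (ν e)) (hB₀ : c + 2 * Be ≤ B₀) (hc0 : 0 ≤ c) (hBe : 0 ≤ Be)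
    (hB₀pos : 0 < B₀) (hF : ∀ x y, f x y ^ 2 ≤ Q) (hQ : 4 * B₀ ^ 2 ≤ Q)
    {T : Finset X₁} {π : ℝ} (hπ : 0 ≤ π) (hTsupp : P₁ (T : Set X₁)ᶜ = 0)
    (hT : ∀ a ∈ T, π ≤ P₁.real {a}) {t : ℝ}
    (hgap : ∀ a ∈ T, ∀ b ∈ T, varDiff P₂ f a b = 0 ∨ 2 * t < varDiff P₂ f a b)
    {k K b : ℕ} {s τ t' : ℝ} (hk : 0 < k) (hkK : (k : ℝ) ≤ K * p / 2) (hKm : K + 1 ≤ m)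
    (hkπ : (k : ℝ) ≤ ((m : ℝ) - 1) * p * π / 4) (hW : 2 ≤ overlapThreshold n p) (hτ : 0 ≤ τ)
    (ht' : 0 ≤ t') (hs : 0 ≤ s)
    (hsum : (2 * B₀) ^ 2 / (overlapThreshold n p - 1) + 2 * t' + 2 * τ ^ 2 ≤ t)
    {r : Outcome m n X₁ X₂ → Fin m → Fin m → ℕ}
    (hr : IsRankingRule f (overlapThreshold n p) r) :
    mse P₁ P₂ f ν p (overlapThreshold n p) k r ≤ ENNReal.ofReal
      ((2 * (4 * B₀ ^ 2 * s / k + b * B₀ ^ 2) / n + 2 * τ ^ 2) +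
      Q * (m ^ 2 * Real.exp (-(n * (p : ℝ) ^ 2) / 10) +
        m ^ K * (2 ^ n * Real.exp (-(b * K * p) / 10)) +
        m ^ K * (2 ^ n * Real.exp (-s)) +
        (m ^ 2 * (T.card : ℝ) ^ 2) *
        (2 * Real.exp (-(τ ^ 2 * overlapThreshold n p) / (2 * (2 * B₀) ^ 2)) +
          2 * Real.exp (-(t' ^ 2 * overlapThreshold n p) / (2 * ((2 * B₀) ^ 2) ^ 2)))) +
      Q * (Real.exp (-(((m : ℝ) - 1) * p) / 10) +
        T.card * Real.exp (-(((m : ℝ) - 1) * p * π) / 20))) := by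
  classical
  have := fun e => (hν e).isProbabilityMeasure
  have hm : 0 < m := by omega
  have hn' : (0 : ℝ) < n := by exact_mod_cast hn
  have hk' : (0 : ℝ) < k := by exact_mod_cast hk
  have hm1 : (0 : ℝ) ≤ (m : ℝ) - 1 := by
    have : (1 : ℝ) ≤ m := by exact_mod_cast hm
    linarith
  have hQ0 : 0 ≤ Q := le_trans (by positivity) hQ
  have hR : 0 ≤ 2 * (4 * B₀ ^ 2 * s / k + b * B₀ ^ 2) / n + 2 * τ ^ 2 := by positivity
  have hδ₁₁ : 0 ≤ (m : ℝ) ^ 2 * Real.exp (-(n * (p : ℝ) ^ 2) / 10) := by positivity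
  have hδ₁₂ : 0 ≤ (m : ℝ) ^ K * (2 ^ n * Real.exp (-(b * K * p) / 10)) := by positivity
  have hδ₁₃ : 0 ≤ (m : ℝ) ^ K * (2 ^ n * Real.exp (-s)) := by positivity
  have hδ₁₄ : 0 ≤ ((m : ℝ) ^ 2 * (T.card : ℝ) ^ 2) *
        (2 * Real.exp (-(τ ^ 2 * overlapThreshold n p) / (2 * (2 * B₀) ^ 2)) +
          2 * Real.exp (-(t' ^ 2 * overlapThreshold n p) / (2 * ((2 * B₀) ^ 2) ^ 2))) := by
    positivity
  have hδ₁ := add_nonneg (add_nonneg (add_nonneg hδ₁₁ hδ₁₂) hδ₁₃) hδ₁₄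
  have hδ₂ : 0 ≤ Real.exp (-(((m : ℝ) - 1) * p) / 10) +
        T.card * Real.exp (-(((m : ℝ) - 1) * p * π) / 20) := by positivity
  -- `Be` may be zero, while the exponential moment bound needs a positive bound on the noise.
  have hν' : ∀ e, IsNoiseLaw γ B₀ (ν e) := fun e => (hν e).mono (by linarith)
  set G₁ : Set (Outcome m n X₁ X₂) := {ω | ∃ q : Fin m × Fin m, q.1 ≠ q.2 ∧
    ((overlap (observed ω) q.1 q.2).card : ℝ) ≤ overlapThreshold n p} with hG₁
  have hG₁le : modelLaw P₁ P₂ ν p G₁ ≤ _ := modelLaw_exists_overlap_le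
  set G₂ : Set (Outcome m n X₁ X₂) := {ω | ∃ ρ : Fin K → Fin m, Function.Injective ρ ∧
    b ≤ (Finset.univ.filter fun i =>
      (Finset.univ.filter fun j => observed ω (ρ j, i) = true).card < k).card} with hG₂
  have hG₂le : modelLaw P₁ P₂ ν p G₂ ≤ _ := modelLaw_exists_sparse_columns_le hkK
  set G₃ : Set (Outcome m n X₁ X₂) := {ω | ∃ ρ : Fin K → Fin m, 4 * B₀ ^ 2 * s ≤
    ∑ i, (∑ v ∈ firstObserved k (observed ω) ρ i, ω.2.2.1 (v, i)) ^ 2 /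
      (firstObserved k (observed ω) ρ i).card} with hG₃
  have hG₃le : modelLaw P₁ P₂ ν p G₃ ≤ _ := modelLaw_exists_noise_le hB₀pos hν' K k s
  have hG₄le := modelLaw_exists_deviation_le (P₁ := P₁) (P₂ := P₂) (p := p) hfm hc hν
    (b₀ := 2 * B₀) (by linarith) hτ ht' T
  set G₄ : Set (Outcome m n X₁ X₂) := {ω | ∃ q : (Fin m × Fin m) × (T × T), q.1.1 ≠ q.1.2 ∧
      overlapThreshold n p ≤ ((overlap (observed ω) q.1.1 q.1.2).card : ℝ) ∧
      (τ * (overlap (observed ω) q.1.1 q.1.2).card ≤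
        |∑ j ∈ overlap (observed ω) q.1.1 q.1.2,
          centredDiff P₂ f q.2.1 q.2.2 q.1.1 q.1.2 j (ω.2.1, ω.2.2.1)| ∨
       t' * (overlap (observed ω) q.1.1 q.1.2).card ≤
        |∑ j ∈ overlap (observed ω) q.1.1 q.1.2,
          (centredDiff P₂ f q.2.1 q.2.2 q.1.1 q.1.2 j (ω.2.1, ω.2.2.1) ^ 2 -
            (varDiff P₂ f q.2.1 q.2.2 + 2 * γ ^ 2))|)} with hG₄
  have hgap' : ∀ᵐ ω ∂modelLaw P₁ P₂ ν p, ∀ q : T × T, varDiff P₂ f q.1 q.2 = 0 →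
      ∀ i, f q.1 (ω.2.1 i) - f q.2 (ω.2.1 i) = meanDiff P₂ f q.1 q.2 := by
    rw [ae_all_iff]
    intro q
    by_cases hq : varDiff P₂ f q.1 q.2 = 0
    · filter_upwards [ae_columnFeature (P₁ := P₁) (ν := ν) (p := p)
        (ae_eq_meanDiff (P₂ := P₂) hfm hc hq)] with ω hω _ using hω
    · exact .of_forall fun ω h => absurd h hq
  have herr := ae_sq_error_le (P₁ := P₁) (P₂ := P₂) (p := p) (β := overlapThreshold n p) (k := k)
    hc hν hB₀ hc0 hBe hF hQ r
  refine mse_le_of_forall (G := G₁ ∪ G₂ ∪ G₃ ∪ G₄)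
    (E := fun u i => {ω | ∃ a : T, (((observedRows (observed ω) u i).filter
      fun v => ω.1 v = a).card : ℝ) ≤ ((m : ℝ) - 1) * p * π / 4})
    hm hn hR hQ0 hδ₁ hδ₂ ?_
    (fun u i => modelLaw_identicalRows_le hπ hT u i)
    (herr.mono fun ω h u i => (h u i).2) ?_
  · rw [ENNReal.ofReal_add (add_nonneg (add_nonneg hδ₁₁ hδ₁₂) hδ₁₃) hδ₁₄,
      ENNReal.ofReal_add (add_nonneg hδ₁₁ hδ₁₂) hδ₁₃, ENNReal.ofReal_add hδ₁₁ hδ₁₂]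
    refine (measure_union_le _ _).trans (add_le_add ?_ hG₄le)
    refine (measure_union_le _ _).trans (add_le_add ?_ hG₃le)
    exact (measure_union_le _ _).trans (add_le_add hG₁le hG₂le)
  filter_upwards [ae_noise_le hν, ae_rowFeature_mem (P₂ := P₂) (ν := ν) (p := p) hTsupp, hgap']
    with ω hη hx hflat hωG u J hJ
  simp only [Set.mem_union, not_or] at hωG
  obtain ⟨⟨⟨hω1, hω2⟩, hω3⟩, hω4⟩ := hωG
  refine sum_sq_error_le (P₂ := P₂) (γ := γ) (t := t) (τ := τ) (t' := t') hn hk hKm hW hsum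
    (hr.isRanking ω u) (fun e => (hη e).trans (by linarith)) (fun v hv => ?_)
    (fun v hv => ?_) (fun v hv => ?_) (fun v => hgap _ (hx u) _ (hx v))
    (fun v => hflat (⟨_, hx u⟩, ⟨_, hx v⟩)) (fun ρ => ?_) (fun ρ hρ => ?_) (fun i hi => ?_)
  · by_contra! h
    exact hω1 ⟨(u, v), hv.symm, h⟩
  · have hO : overlapThreshold n p ≤ (overlap (observed ω) u v).card := by
      by_contra! h
      exact hω1 ⟨(u, v), hv.symm, h.le⟩
    constructor
    · by_contra! h
      exact hω4 ⟨((u, v), (⟨_, hx u⟩, ⟨_, hx v⟩)), hv.symm, hO, Or.inl h.le⟩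
    · by_contra! h
      exact hω4 ⟨((u, v), (⟨_, hx u⟩, ⟨_, hx v⟩)), hv.symm, hO, Or.inr h.le⟩
  · exact varDiff_add_le (P₂ := P₂) hfm hc hν (ω.1 u) (ω.1 v) hv.symm ⟨0, hn⟩ (by linarith)
  · by_contra! h
    exact hω3 ⟨ρ, h.le⟩
  · by_contra! h
    exact hω2 ⟨ρ, hρ, h.le⟩
  · have h1 : ((m : ℝ) - 1) * p * π / 4 < ((observedRows (observed ω) u i).filter
        fun v => ω.1 v = ω.1 u).card := by
      by_contra! h
      exact hJ i hi ⟨⟨_, hx u⟩, h⟩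
    exact_mod_cast hkπ.trans h1.le

/-- A bound on the mean squared error that does not require many columns. -/
theorem mse_le_of_exists_neighbour (hn : 0 < n)
    {γ Be c B₀ Q : ℝ} (hc : ∀ a b y, |f a y - f b y| ≤ c)
    (hν : ∀ e, IsNoiseLaw γ Be (ν e)) (hB₀ : c + 2 * Be ≤ B₀) (hc0 : 0 ≤ c) (hBe : 0 ≤ Be)
    (hF : ∀ x y, f x y ^ 2 ≤ Q) (hQ : 4 * B₀ ^ 2 ≤ Q)
    {k N : ℕ} (hk : 0 < k) (hNm : N + 1 ≤ m) (hm : 0 < m)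
    {r : Outcome m n X₁ X₂ → Fin m → Fin m → ℕ}
    (hr : IsRankingRule f (overlapThreshold n p) r) :
    mse P₁ P₂ f ν p (overlapThreshold n p) k r ≤ ENNReal.ofReal
      (4 * B₀ ^ 2 + Q * (Real.exp (-(N * p) / 10) + N * Real.exp (-(n * (p : ℝ) ^ 2) / 10))) := by
  classical
  have := fun e => (hν e).isProbabilityMeasure
  have hQ0 : 0 ≤ Q := le_trans (by positivity) hQ
  have hp := p.2.1
  have herr := ae_sq_error_le (P₁ := P₁) (P₂ := P₂) (p := p) (β := overlapThreshold n p) (k := k)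
    hc hν hB₀ hc0 hBe hF hQ r
  set E : Fin m → Fin n → Set (Outcome m n X₁ X₂) := fun u i =>
    {ω | ¬ (neighbours (overlapThreshold n p) k (observed ω) (r ω u) u i).Nonempty} with hE
  have hEle : ∀ u i, modelLaw P₁ P₂ ν p (E u i) ≤ ENNReal.ofReal
      (Real.exp (-(N * p) / 10) + N * Real.exp (-(n * (p : ℝ) ^ 2) / 10)) := by
    intro u i
    -- Only `N` rows are examined, so that the union bound over overlaps costs `N` rather than `m`,
    -- which may exceed every exponential in `n p²`.
    obtain ⟨R, hRsub, hR⟩ := Finset.exists_subset_card_eq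
      (show N ≤ (Finset.univ.erase u).card by
        rw [Finset.card_erase_of_mem (Finset.mem_univ _), Finset.card_univ, Fintype.card_fin]
        omega)
    set F := R.map (⟨fun v => (v, i), fun v w h => congrArg Prod.fst h⟩ :
      Fin m ↪ Fin m × Fin n) with hFdef
    have hFcard : F.card = N := by rw [hFdef, Finset.card_map, hR]
    have h1 : modelLaw P₁ P₂ ν p {ω | ω.2.2.2 ∈ {D : Fin m × Fin n → Bool |
        ((F.filter fun e => D e = true).card : ℝ) ≤ F.card * p / 2}} ≤
        ENNReal.ofReal (Real.exp (-(N * p) / 10)) := by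
      rw [modelLaw_pattern_le]
      refine measure_le_ofReal_of_measureReal_le ((patternLaw_count_le p F).trans (le_of_eq ?_))
      rw [hFcard]
    have h2 := measure_exists_le (μ := modelLaw P₁ P₂ ν p)
      (A := fun v : R => {ω | ω.2.2.2 ∈ {D | ((overlap D u v).card : ℝ) ≤ overlapThreshold n p}})
      (c := Real.exp (-(n * (p : ℝ) ^ 2) / 10)) fun v => by
        rw [modelLaw_pattern_le]
        exact measure_le_ofReal_of_measureReal_le
          (patternLaw_overlap_le p (Finset.mem_erase.1 (hRsub v.2)).1.symm)
    rw [Fintype.card_coe, hR] at h2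
    rw [ENNReal.ofReal_add (by positivity) (by positivity)]
    refine le_trans (measure_mono fun ω hω => ?_)
      ((measure_union_le _ _).trans (add_le_add h1 h2))
    by_contra hnot
    simp only [Set.mem_union, not_or] at hnot
    obtain ⟨hn1, hn2⟩ := hnot
    have hn1' : F.card * (p : ℝ) / 2 < (F.filter fun e => ω.2.2.2 e = true).card := by
      simpa using hn1
    have hpos : 0 < (F.filter fun e => ω.2.2.2 e = true).card := by
      have : (0 : ℝ) < (F.filter fun e => ω.2.2.2 e = true).card :=
        lt_of_le_of_lt (by positivity) hn1'
      exact_mod_cast this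
    obtain ⟨e, he⟩ := Finset.card_pos.1 hpos
    rw [Finset.mem_filter, hFdef, Finset.mem_map] at he
    obtain ⟨⟨v, hv, rfl⟩, hvD⟩ := he
    have hvcand : v ∈ candidates (overlapThreshold n p) (observed ω) u i := by
      rw [mem_candidates]
      refine ⟨?_, hvD⟩
      simp only [comparableRows, Finset.mem_filter, Finset.mem_univ, true_and]
      refine ⟨(Finset.mem_erase.1 (hRsub hv)).1, ?_⟩
      by_contra! h
      exact hn2 ⟨⟨v, hv⟩, h.le⟩
    apply hω
    rw [← Finset.card_pos, card_neighbours (hr.isRanking ω u).1]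
    exact lt_min hk (Finset.card_pos.2 ⟨v, hvcand⟩)
  have h := mse_le_of_forall (P₁ := P₁) (P₂ := P₂) (f := f) (p := p) (k := k) (r := r)
    (β := overlapThreshold n p) (G := ∅) (E := E) (R := 4 * B₀ ^ 2) (Q := Q) (δ₁ := 0) hm hn
    (by positivity) hQ0 le_rfl (by positivity) (by simp) hEle (herr.mono fun ω h u i => (h u i).2)
    (herr.mono fun ω h _ u J hJ => by
      refine (Finset.sum_le_sum fun i hi => (h u i).1 (not_not.1 (hJ i hi))).trans ?_
      rw [Finset.sum_const, nsmul_eq_mul]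
      gcongr
      simpa using J.card_le_univ)
  simpa using h

end Main

end BlindRegression

/-! ### Choice of the parameters and the resulting rate. -/

/-- The exponent is that of `m ^ 2 * exp (-c y²)` with log m ≤ y. For y ≥ 4/c it is at most -2y, and
exp(-2y) ≤ y⁻². -/
theorem exists_forall_mul_exp_le (A : ℝ) {c ε : ℝ} (hc : 0 < c) (hε : 0 < ε) :
    ∃ Y : ℝ, 1 ≤ Y ∧ ∀ y, Y ≤ y → A * Real.exp (2 * y - c * y ^ 2) ≤ ε * y⁻¹ := by
  refine ⟨max 1 (max (4 / c) (A / ε)), le_max_left _ _, fun y hy => ?_⟩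
  have hy1 : 1 ≤ y := (le_max_left _ _).trans hy
  have hy2 : 4 / c ≤ y := (le_max_left _ _).trans ((le_max_right _ _).trans hy)
  have hy3 : A / ε ≤ y := (le_max_right _ _).trans ((le_max_right _ _).trans hy)
  have hy0 : 0 < y := by linarith
  rw [div_le_iff₀ hc] at hy2
  rw [div_le_iff₀ hε] at hy3
  have h1 : 2 * y - c * y ^ 2 ≤ -(2 * y) := by nlinarith
  have h2 : Real.exp (2 * y - c * y ^ 2) ≤ y⁻¹ * y⁻¹ := by
    refine (Real.exp_le_exp.2 h1).trans ?_
    rw [Real.exp_neg, two_mul, Real.exp_add, mul_inv]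
    have : y ≤ Real.exp y := by linarith [Real.add_one_le_exp y]
    gcongr
  calc A * Real.exp (2 * y - c * y ^ 2) ≤ (y * ε) * (y⁻¹ * y⁻¹) := by gcongr
    _ = ε * y⁻¹ := by field_simp

/-- The leading term of the error bound, with `y = (n p²)^{1/3}` and `z = (m p)^{1/3}`. -/
theorem leading_term_le {n k K p B₀ l s b y z : ℝ} (hn : 0 < n) (hk : 0 < k) (hp : 0 < p)
    (hp1 : p ≤ 1) (hy : 1 ≤ y) (hz : 0 < z) (hy3 : n * p ^ 2 = y ^ 3) (hkz : z / 16 ≤ k)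
    (hl0 : 0 ≤ l) (hl : l ≤ y) (hKl : 2 * k ≤ K * p) (hKu : K * p ≤ 3 * k)
    (hs : s = 2 * n + K * l) (hb : b ≤ 10 * s / (K * p) + 1) :
    2 * (4 * B₀ ^ 2 * s / k + b * B₀ ^ 2) / n + 2 * (B₀ ^ 2 * y⁻¹) ≤
      634 * B₀ ^ 2 * max y⁻¹ z⁻¹ := by
  set F := max y⁻¹ z⁻¹ with hF
  have hy0 : 0 < y := by linarith
  have hFy : y⁻¹ ≤ F := le_max_left _ _
  have hFz : z⁻¹ ≤ F := le_max_right _ _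
  have hF0 : 0 < F := lt_of_lt_of_le (by positivity) hFy
  have hKp : 0 < K * p := by linarith
  have hK : 0 < K := pos_of_mul_pos_left hKp hp.le
  have hs0 : 0 ≤ s := by rw [hs]; positivity
  have hnp : y ^ 3 ≤ n * p := by
    rw [← hy3]
    nlinarith [mul_pos hn hp]
  have h1 : 1 / k ≤ 16 * F := by
    calc 1 / k ≤ 1 / (z / 16) := by gcongr
      _ = 16 * z⁻¹ := by field_simp
      _ ≤ 16 * F := by gcongr
  have h2 : l / (n * p) ≤ F := by
    calc l / (n * p) ≤ y / y ^ 3 := by gcongr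
      _ = y⁻¹ * y⁻¹ := by field_simp
      _ ≤ y⁻¹ * 1 := by
        gcongr
        exact inv_le_one_of_one_le₀ hy
      _ ≤ F := by linarith
  have h3 : 1 / n ≤ F := by
    have hny : y ≤ n := by nlinarith [mul_pos hn hp, sq_nonneg y]
    calc 1 / n ≤ 1 / y := by gcongr
      _ = y⁻¹ := one_div y
      _ ≤ F := hFy
  -- 35 = 2 · 16 + 3, from the terms `2 n` and `K l` of `s`.
  have h4 : s / (k * n) ≤ 35 * F := by
    have e : s / (k * n) = 2 * (1 / k) + (K * p / k) * (l / (n * p)) := by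
      rw [hs]
      field_simp
    have h5 : K * p / k ≤ 3 := by rw [div_le_iff₀ hk]; exact hKu
    have h6 : (K * p / k) * (l / (n * p)) ≤ 3 * F := by gcongr
    rw [e]
    linarith
  -- 176 = 5 · 35 + 1; the final 634 is 8 · 35 + 2 · 176 + 2.
  have h7 : b / n ≤ 176 * F := by
    have h8 : 10 * s / (K * p) ≤ 5 * (s / k) := by
      rw [div_le_iff₀ hKp]
      have : 5 * (s / k) * (K * p) = 5 * s * ((K * p) / k) := by ring
      rw [this]
      have h9 : 2 ≤ K * p / k := by rw [le_div_iff₀ hk]; exact hKl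
      nlinarith
    calc b / n ≤ (5 * (s / k) + 1) / n := by gcongr; linarith
      _ = 5 * (s / (k * n)) + 1 / n := by field_simp
      _ ≤ 176 * F := by linarith
  have e : 2 * (4 * B₀ ^ 2 * s / k + b * B₀ ^ 2) / n + 2 * (B₀ ^ 2 * y⁻¹) =
      B₀ ^ 2 * (8 * (s / (k * n)) + 2 * (b / n) + 2 * y⁻¹) := by
    field_simp
    ring
  rw [e]
  have h10 := sq_nonneg B₀
  calc B₀ ^ 2 * (8 * (s / (k * n)) + 2 * (b / n) + 2 * y⁻¹) ≤ B₀ ^ 2 * (634 * F) := by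
        gcongr
        linarith
    _ = 634 * B₀ ^ 2 * F := by ring

namespace BlindRegression

/-- In `s`, the part `K l` pays for the lists, one `n` for `2 ^ n`, and the other `n` is the gain.
-/
theorem pow_mul_two_pow_mul_exp_le {m n K : ℕ} {s l y : ℝ} (hm : 0 < m) (hl : Real.log m = l)
    (hs : 2 * n + K * l ≤ s) (hy : y ≤ n) :
    (m : ℝ) ^ K * (2 ^ n * Real.exp (-s)) ≤ Real.exp (-y) := by
  have hm' : (0 : ℝ) < m := by exact_mod_cast hm
  have h1 : (m : ℝ) ^ K = Real.exp (K * l) := by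
    rw [← hl, Real.exp_nat_mul, Real.exp_log hm']
  have h2 : (2 : ℝ) ^ n ≤ Real.exp n := by
    have : (2 : ℝ) ≤ Real.exp 1 := by linarith [Real.add_one_le_exp 1]
    calc (2 : ℝ) ^ n ≤ Real.exp 1 ^ n := by gcongr
      _ = Real.exp n := by rw [← Real.exp_nat_mul, mul_one]
  rw [h1]
  calc Real.exp (K * l) * (2 ^ n * Real.exp (-s))
      ≤ Real.exp (K * l) * (Real.exp n * Real.exp (-s)) := by gcongr
    _ = Real.exp (K * l + (n + -s)) := by rw [Real.exp_add, Real.exp_add]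
    _ ≤ Real.exp (-y) := Real.exp_le_exp.2 (by linarith)

/-- The bounds on the failure probabilities that are exponentially small in a power of `n p²`. -/
theorem column_remainder_le {m n K : ℕ} {p b s y c t N B₀ Q : ℝ} (hm : 0 < m) (hB₀ : 0 < B₀)
    (hQ : 0 ≤ Q) (hy : 4 ≤ y) (hy3 : n * p ^ 2 = y ^ 3) (hyn : y ^ 3 ≤ n)
    (hlog : Real.log m ≤ y) (hs : 2 * n + K * Real.log m = s) (hb : s ≤ b * K * p / 10)
    (hc0 : 0 ≤ c) (hc : c ≤ 1 / 16) (hct : c ≤ (t / 8) ^ 2 / (64 * B₀ ^ 4)) :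
    Q * (m ^ 2 * Real.exp (-(n * p ^ 2) / 10) +
        m ^ K * (2 ^ n * Real.exp (-(b * K * p) / 10)) +
        m ^ K * (2 ^ n * Real.exp (-s)) +
        (m ^ 2 * N ^ 2) *
        (2 * Real.exp (-(B₀ ^ 2 * y⁻¹ * (n * p ^ 2 / 2)) / (2 * (2 * B₀) ^ 2)) +
          2 * Real.exp (-((t / 8) ^ 2 * (n * p ^ 2 / 2)) / (2 * ((2 * B₀) ^ 2) ^ 2)))) ≤
      Q * (3 + 4 * N ^ 2) * Real.exp (2 * y - c * y ^ 2) := by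
  have hm' : (0 : ℝ) < m := by exact_mod_cast hm
  have hy0 : 0 < y := by linarith
  have hy32 : y ^ 2 ≤ y ^ 3 := pow_le_pow_right₀ (by linarith) (by norm_num)
  have hyy : y ≤ y ^ 3 := le_self_pow₀ (by linarith) (by norm_num)
  have hcy : c * y ^ 2 ≤ 1 / 16 * y ^ 2 := mul_le_mul_of_nonneg_right hc (sq_nonneg y)
  have hexpl : (m : ℝ) ^ 2 ≤ Real.exp (2 * y) := by
    calc (m : ℝ) ^ 2 = Real.exp (2 * Real.log m) := by
          rw [two_mul, Real.exp_add, Real.exp_log hm', sq]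
      _ ≤ Real.exp (2 * y) := Real.exp_le_exp.2 (by linarith)
  generalize hey : Real.exp (2 * y - c * y ^ 2) = ey
  have hmul : ∀ x : ℝ, x ≤ -(c * y ^ 2) → (m : ℝ) ^ 2 * Real.exp x ≤ ey := by
    intro x hx
    calc (m : ℝ) ^ 2 * Real.exp x ≤ Real.exp (2 * y) * Real.exp (-(c * y ^ 2)) :=
          mul_le_mul hexpl (Real.exp_le_exp.2 hx) (Real.exp_nonneg _) (Real.exp_nonneg _)
      _ = ey := by rw [← Real.exp_add, ← hey, sub_eq_add_neg]
  have hy2 : 0 ≤ y ^ 2 := sq_nonneg y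
  have hsmall : Real.exp (-y ^ 3) ≤ ey := by
    rw [← hey]
    exact Real.exp_le_exp.2 (by linarith)
  have b1 : (m : ℝ) ^ 2 * Real.exp (-(n * p ^ 2) / 10) ≤ ey := by
    apply hmul
    rw [hy3]
    linarith
  have b2 : (m : ℝ) ^ K * (2 ^ n * Real.exp (-(b * K * p) / 10)) ≤ ey := by
    rw [neg_div]
    exact (pow_mul_two_pow_mul_exp_le hm rfl (hs.le.trans hb) hyn).trans hsmall
  have b3 : (m : ℝ) ^ K * (2 ^ n * Real.exp (-s)) ≤ ey :=
    (pow_mul_two_pow_mul_exp_le hm rfl hs.le hyn).trans hsmall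
  -- With τ² = B₀²/y the exponent is y²/16, which still beats log m² ≤ 2y.
  have b4 : (m : ℝ) ^ 2 *
      Real.exp (-(B₀ ^ 2 * y⁻¹ * (n * p ^ 2 / 2)) / (2 * (2 * B₀) ^ 2)) ≤ ey := by
    apply hmul
    rw [hy3]
    have : -(B₀ ^ 2 * y⁻¹ * (y ^ 3 / 2)) / (2 * (2 * B₀) ^ 2) = -(1 / 16 * y ^ 2) := by
      field_simp
      ring
    rw [this]
    linarith
  have b5 : (m : ℝ) ^ 2 *
      Real.exp (-((t / 8) ^ 2 * (n * p ^ 2 / 2)) / (2 * ((2 * B₀) ^ 2) ^ 2)) ≤ ey := by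
    apply hmul
    rw [hy3]
    have : -((t / 8) ^ 2 * (y ^ 3 / 2)) / (2 * ((2 * B₀) ^ 2) ^ 2) =
        -((t / 8) ^ 2 / (64 * B₀ ^ 4) * y ^ 3) := by
      field_simp
      ring
    rw [this, neg_le_neg_iff]
    exact mul_le_mul hct hy32 hy2 (hc0.trans hct)
  have e : ∀ u v : ℝ, (m ^ 2 * N ^ 2) * (2 * u + 2 * v) =
      2 * N ^ 2 * (m ^ 2 * u) + 2 * N ^ 2 * (m ^ 2 * v) := fun u v => by ring
  have hN : 0 ≤ 2 * N ^ 2 := by positivity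
  rw [e]
  calc _ ≤ Q * (ey + ey + ey + (2 * N ^ 2 * ey + 2 * N ^ 2 * ey)) :=
        mul_le_mul_of_nonneg_left (add_le_add (add_le_add (add_le_add b1 b2) b3)
          (add_le_add (mul_le_mul_of_nonneg_left b4 hN) (mul_le_mul_of_nonneg_left b5 hN))) hQ
    _ = Q * (3 + 4 * N ^ 2) * ey := by ring

/-- The bounds on the failure probabilities that are exponentially small in a power of `m p`. -/
theorem row_remainder_le {w z c π N Q : ℝ} (hQ : 0 ≤ Q) (hN : 0 ≤ N) (hπ : 0 < π) (hz : 8 ≤ z)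
    (hw : z ^ 3 / 2 ≤ w) (hc : c ≤ 1 / 20) (hcπ : c ≤ π / 40) :
    Q * (Real.exp (-w / 10) + N * Real.exp (-(w * π) / 20)) ≤
      Q * (1 + N) * Real.exp (2 * z - c * z ^ 2) := by
  have hz32 : z ^ 2 ≤ z ^ 3 := pow_le_pow_right₀ (by linarith) (by norm_num)
  have hz2 : 0 ≤ z ^ 2 := sq_nonneg z
  have hcz : c * z ^ 2 ≤ 1 / 20 * z ^ 2 := mul_le_mul_of_nonneg_right hc hz2
  have hcz' : c * z ^ 2 ≤ π / 40 * z ^ 3 := mul_le_mul hcπ hz32 hz2 (by linarith)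
  have h1 : Real.exp (-w / 10) ≤ Real.exp (2 * z - c * z ^ 2) :=
    Real.exp_le_exp.2 (by linarith)
  have h2 : Real.exp (-(w * π) / 20) ≤ Real.exp (2 * z - c * z ^ 2) := by
    apply Real.exp_le_exp.2
    have : z ^ 3 / 2 * π ≤ w * π := mul_le_mul_of_nonneg_right hw hπ.le
    linarith
  calc _ ≤ Q * (Real.exp (2 * z - c * z ^ 2) + N * Real.exp (2 * z - c * z ^ 2)) :=
        mul_le_mul_of_nonneg_left (add_le_add h1 (mul_le_mul_of_nonneg_left h2 hN)) hQ
    _ = _ := by ring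

/-- Among `K ≈ 2 k / p` rows, about `2 k` are observed in a given column. -/
theorem exists_numRows {m k : ℕ} {p z : ℝ} (hp : 0 < p) (hp1 : p ≤ 1) (hz : 8 ≤ z)
    (hz3 : m * p = z ^ 3) (hk : k = ⌊(1 / 8 : ℝ) * z⌋₊) :
    ∃ K : ℕ, 1 ≤ k ∧ (k : ℝ) ≤ 1 / 8 * z ∧ z / 16 ≤ k ∧ 2 * (k : ℝ) ≤ K * p ∧
      (K : ℝ) * p ≤ 3 * k ∧ K + 1 ≤ m := by
  have hk1 : 1 ≤ k := by
    rw [hk, Nat.one_le_floor_iff]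
    linarith
  have hk1' : (1 : ℝ) ≤ k := by exact_mod_cast hk1
  have hkle : (k : ℝ) ≤ 1 / 8 * z := hk ▸ Nat.floor_le (by linarith)
  have hkge : z / 16 ≤ k := by
    have h1 : (1 / 8 : ℝ) * z < k + 1 := hk ▸ Nat.lt_floor_add_one _
    linarith
  have hKlt : (⌈2 * (k : ℝ) / p⌉₊ : ℝ) < 2 * (k : ℝ) / p + 1 :=
    Nat.ceil_lt_add_one (by positivity)
  have hKp : (⌈2 * (k : ℝ) / p⌉₊ : ℝ) * p ≤ 2 * k + p := by
    have : (2 * (k : ℝ) / p + 1) * p = 2 * k + p := by field_simp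
    rw [← this]
    exact mul_le_mul_of_nonneg_right hKlt.le hp.le
  -- Rounding up adds at most `p ≤ 1 ≤ k` to `K p`.
  refine ⟨⌈2 * (k : ℝ) / p⌉₊, hk1, hkle, hkge, ?_, by linarith, ?_⟩
  · rw [← div_le_iff₀ hp]
    exact Nat.le_ceil _
  · have hz3z : z ≤ z ^ 3 := le_self_pow₀ (by linarith) (by norm_num)
    have h1 : ((⌈2 * (k : ℝ) / p⌉₊ : ℝ) + 1) * p ≤ m * p := by
      rw [hz3, add_mul, one_mul]
      linarith
    have h2 : (⌈2 * (k : ℝ) / p⌉₊ : ℝ) + 1 ≤ m := le_of_mul_le_mul_right h1 hp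
    exact_mod_cast h2

/-- The two bias terms are below the gap `t` once `y` is large. -/
theorem bias_le_gap {B₀ t y : ℝ} (ht : 0 < t) (hy : 4 ≤ y) (hyt : 8 * B₀ ^ 2 / t ≤ y)
    (hyt' : 2 * (1 + 16 * B₀ ^ 2 / t) ≤ y) :
    (2 * B₀) ^ 2 / (y ^ 3 / 2 - 1) + 2 * (t / 8) + 2 * (B₀ ^ 2 * y⁻¹) ≤ t := by
  have hy0 : 0 < y := by linarith
  have hyy : y ≤ y ^ 3 := le_self_pow₀ (by linarith) (by norm_num)
  rw [div_le_iff₀ ht] at hyt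
  have h1 : B₀ ^ 2 * y⁻¹ ≤ t / 8 := by
    rw [← div_eq_mul_inv, div_le_iff₀ hy0]
    linarith
  have h2 : (2 * B₀) ^ 2 / (y ^ 3 / 2 - 1) ≤ t / 4 := by
    rw [div_le_iff₀ (by linarith)]
    have h3 : 16 * B₀ ^ 2 / t ≤ y ^ 3 / 2 - 1 := by linarith
    rw [div_le_iff₀ ht] at h3
    linarith
  linarith

section Asymptotics

variable {X₁ X₂ : Type*} [MeasurableSpace X₁] [MeasurableSpace X₂] [MeasurableSingletonClass X₁]
  {P₁ : Measure X₁} [IsProbabilityMeasure P₁] {P₂ : Measure X₂} [IsProbabilityMeasure P₂]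
  {f : X₁ → X₂ → ℝ}

/-- The rate of convergence when the number of rows is at most exponential in `(n p²)^{1/3}`. -/
theorem exists_mse_le_rate
    {Be c B₀ Q : ℝ} (hfm : ∀ a, Measurable (f a)) (hc : ∀ a b y, |f a y - f b y| ≤ c)
    (hB₀ : c + 2 * Be ≤ B₀) (hc0 : 0 ≤ c) (hBe : 0 ≤ Be)
    (hB₀pos : 0 < B₀) (hF : ∀ x y, f x y ^ 2 ≤ Q) (hQ : 4 * B₀ ^ 2 ≤ Q)
    {T : Finset X₁} {π : ℝ} (hπ : 0 < π) (hTsupp : P₁ (T : Set X₁)ᶜ = 0)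
    (hT : ∀ a ∈ T, π ≤ P₁.real {a}) {t : ℝ} (ht : 0 < t)
    (hgap : ∀ a ∈ T, ∀ b ∈ T, varDiff P₂ f a b = 0 ∨ 2 * t < varDiff P₂ f a b) :
    ∃ Y Z : ℝ, ∀ (m n : ℕ) (p : I) (y z : ℝ), Y ≤ y → Z ≤ z → (n : ℝ) * (p : ℝ) ^ 2 = y ^ 3 →
      (m : ℝ) * p = z ^ 3 → Real.log m ≤ y → ∀ (γ : ℝ) (ν : Fin m × Fin n → Measure ℝ),
      (∀ e, IsNoiseLaw γ Be (ν e)) → ∀ r : Outcome m n X₁ X₂ → Fin m → Fin m → ℕ,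
      IsRankingRule f (overlapThreshold n p) r →
      mse P₁ P₂ f ν p (overlapThreshold n p) ⌊(1 / 8 : ℝ) * z⌋₊ r ≤
        ENNReal.ofReal (636 * B₀ ^ 2 * max y⁻¹ z⁻¹) := by
  have hQ0 : 0 ≤ Q := le_trans (by positivity) hQ
  obtain ⟨N, hN⟩ : ∃ N : ℝ, N = T.card := ⟨_, rfl⟩
  have hN0 : 0 ≤ N := by rw [hN]; positivity
  obtain ⟨c₁, hc₁pos, hc₁a, hc₁b⟩ : ∃ c₁ : ℝ, 0 < c₁ ∧ c₁ ≤ 1 / 16 ∧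
      c₁ ≤ (t / 8) ^ 2 / (64 * B₀ ^ 4) :=
    ⟨min (1 / 16) ((t / 8) ^ 2 / (64 * B₀ ^ 4)), lt_min (by norm_num) (by positivity),
      min_le_left _ _, min_le_right _ _⟩
  obtain ⟨c₂, hc₂pos, hc₂a, hc₂b⟩ : ∃ c₂ : ℝ, 0 < c₂ ∧ c₂ ≤ 1 / 20 ∧ c₂ ≤ π / 40 :=
    ⟨min (1 / 20) (π / 40), lt_min (by norm_num) (by positivity), min_le_left _ _,
      min_le_right _ _⟩
  obtain ⟨Y₁, hY₁, hY₁'⟩ := exists_forall_mul_exp_le (Q * (3 + 4 * N ^ 2)) (ε := B₀ ^ 2)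
    hc₁pos (by positivity)
  obtain ⟨Z₁, hZ₁, hZ₁'⟩ := exists_forall_mul_exp_le (Q * (1 + N)) (ε := B₀ ^ 2)
    hc₂pos (by positivity)
  -- `Y₁` and `Z₁` absorb the failure probabilities, the quotients by `t` bring the bias below the
  -- gap, and `1 / π` provides `k` rows of each type. None of them depends on `p` or on the noise
  -- laws.
  refine ⟨max (max Y₁ 4) (max (8 * B₀ ^ 2 / t) (2 * (1 + 16 * B₀ ^ 2 / t))),
    max (max Z₁ 8) (1 / π), ?_⟩
  intro m n p y z hy hz hy3 hz3 hlog γ ν hν r hr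
  have hyY₁ : Y₁ ≤ y := (le_max_left _ _).trans ((le_max_left _ _).trans hy)
  have hy4 : 4 ≤ y := (le_max_right _ _).trans ((le_max_left _ _).trans hy)
  have hyt : 8 * B₀ ^ 2 / t ≤ y := (le_max_left _ _).trans ((le_max_right _ _).trans hy)
  have hyt' : 2 * (1 + 16 * B₀ ^ 2 / t) ≤ y :=
    (le_max_right _ _).trans ((le_max_right _ _).trans hy)
  have hzZ₁ : Z₁ ≤ z := (le_max_left _ _).trans ((le_max_left _ _).trans hz)
  have hz8 : 8 ≤ z := (le_max_right _ _).trans ((le_max_left _ _).trans hz)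
  have hzπ : 1 / π ≤ z := (le_max_right _ _).trans hz
  have hy0 : 0 < y := by linarith
  have hz0 : 0 < z := by linarith
  have hp0 : 0 ≤ (p : ℝ) := p.2.1
  have hp1 : (p : ℝ) ≤ 1 := p.2.2
  have hz3z : z ≤ z ^ 3 := le_self_pow₀ (by linarith) (by norm_num)
  have hyy : y ≤ y ^ 3 := le_self_pow₀ (by linarith) (by norm_num)
  have hy3pos : 0 < y ^ 3 := pow_pos hy0 3
  have hz3pos : 0 < z ^ 3 := pow_pos hz0 3
  have hp : 0 < (p : ℝ) := by
    rcases hp0.eq_or_lt with h | h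
    · rw [← h, mul_zero] at hz3
      linarith
    · exact h
  have hnpos : (0 : ℝ) < n := pos_of_mul_pos_left (hy3 ▸ hy3pos) (sq_nonneg (p : ℝ))
  have hmpos : (0 : ℝ) < m := pos_of_mul_pos_left (hz3 ▸ hz3pos) hp0
  have hn : 0 < n := by exact_mod_cast hnpos
  have hm : 0 < m := by exact_mod_cast hmpos
  have hyn : y ^ 3 ≤ n := by
    rw [← hy3]
    exact mul_le_of_le_one_right hnpos.le (pow_le_one₀ hp0 hp1)
  have hm1p : z ^ 3 / 2 ≤ ((m : ℝ) - 1) * p := by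
    rw [sub_mul, one_mul, hz3]
    linarith
  obtain ⟨k, hk⟩ : ∃ k : ℕ, k = ⌊(1 / 8 : ℝ) * z⌋₊ := ⟨_, rfl⟩
  obtain ⟨K, hk1, hkle, hkge, hKl, hKu, hKm⟩ := exists_numRows hp hp1 hz8 hz3 hk
  rw [← hk]
  have hkpos : (0 : ℝ) < k := by exact_mod_cast hk1
  have hKpos : (0 : ℝ) < K * p := by linarith
  have hl0 : 0 ≤ Real.log m := Real.log_natCast_nonneg m
  obtain ⟨s, hs⟩ : ∃ s : ℝ, 2 * n + K * Real.log m = s := ⟨_, rfl⟩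
  have hs0 : 0 ≤ s := by rw [← hs]; positivity
  -- `b` is the least integer for which the Chernoff exponent of `b` sparse columns reaches `s`.
  obtain ⟨b, hble, hbge⟩ : ∃ b : ℕ, (b : ℝ) ≤ 10 * s / (K * p) + 1 ∧ s ≤ b * K * p / 10 := by
    refine ⟨⌈10 * s / (K * p)⌉₊, (Nat.ceil_lt_add_one (by positivity)).le, ?_⟩
    have h1 : 10 * s / (K * p) ≤ ⌈10 * s / (K * p)⌉₊ := Nat.le_ceil _
    rw [div_le_iff₀ hKpos] at h1
    linarith
  -- τ² is of the order of the target rate.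
  obtain ⟨τ, hτ0, hτ2⟩ : ∃ τ : ℝ, 0 ≤ τ ∧ τ ^ 2 = B₀ ^ 2 * y⁻¹ := by
    refine ⟨B₀ * (√y)⁻¹, by positivity, ?_⟩
    rw [mul_pow, inv_pow, Real.sq_sqrt hy0.le]
  have hWdef : overlapThreshold n p = y ^ 3 / 2 := by rw [overlapThreshold, hy3]
  have hkπ : (k : ℝ) ≤ ((m : ℝ) - 1) * p * π / 4 := by
    rw [div_le_iff₀ hπ] at hzπ
    have h1 : z ≤ z ^ 3 * π := by
      calc z = 1 * z := (one_mul z).symm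
        _ ≤ (z * π) * z ^ 2 :=
          mul_le_mul hzπ (le_self_pow₀ (by linarith) (by norm_num)) hz0.le (by positivity)
        _ = z ^ 3 * π := by ring
    have h2 : z ^ 3 / 2 * π ≤ ((m : ℝ) - 1) * p * π := mul_le_mul_of_nonneg_right hm1p hπ.le
    linarith
  have hsum : (2 * B₀) ^ 2 / (overlapThreshold n p - 1) + 2 * (t / 8) + 2 * τ ^ 2 ≤ t := by
    rw [hWdef, hτ2]
    exact bias_le_gap ht hy4 hyt hyt'
  have hbase := mse_le_of_finite (P₁ := P₁) (P₂ := P₂) (f := f) (p := p) (k := k) (K := K) (b := b)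
    (s := s) (τ := τ) (t' := t / 8) (t := t) hn hfm hc hν hB₀ hc0 hBe hB₀pos hF hQ hπ.le hTsupp hT
    hgap hk1 (by linarith) hKm hkπ (by rw [hWdef]; linarith) hτ0 (by linarith) hs0 hsum hr
  refine hbase.trans (ENNReal.ofReal_le_ofReal ?_)
  have hlead := leading_term_le (B₀ := B₀) hnpos hkpos hp hp1 (by linarith) hz0 hy3 hkge hl0 hlog
    hKl hKu hs.symm hble
  have hB2 : 0 ≤ B₀ ^ 2 := sq_nonneg _
  have hcol := (column_remainder_le (N := N) hm hB₀pos hQ0 hy4 hy3 hyn hlog hs hbge hc₁pos.le hc₁a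
    hc₁b).trans ((hY₁' y hyY₁).trans (mul_le_mul_of_nonneg_left (le_max_left _ z⁻¹) hB2))
  have hrow := (row_remainder_le (N := N) hQ0 hN0 hπ hz8 hm1p hc₂a hc₂b).trans
    ((hZ₁' z hzZ₁).trans (mul_le_mul_of_nonneg_left (le_max_right y⁻¹ _) hB2))
  rw [hN] at hcol hrow
  rw [hτ2, overlapThreshold]
  -- 634 from the leading term and 1 from each of the two remainders.
  linarith

end Asymptotics

end BlindRegression

/-! ### Growth of the effective sample sizes, uniformly in `p`. -/

open Filter in
theorem exists_forall_le_natCast_rpow {δ : ℝ} (hδ : 0 < δ) (R : ℝ) :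
    ∃ N₀ : ℕ, 1 ≤ N₀ ∧ ∀ m : ℕ, N₀ ≤ m → R ≤ (m : ℝ) ^ δ := by
  have h := ((tendsto_rpow_atTop hδ).comp tendsto_natCast_atTop_atTop).eventually_ge_atTop R
  obtain ⟨N, hN⟩ := eventually_atTop.1 h
  exact ⟨max 1 N, le_max_left _ _, fun m hm => hN m ((le_max_right _ _).trans hm)⟩

open Filter in
theorem exists_forall_natCast_mul_exp_le {δ c ε : ℝ} (hδ : 0 < δ) (hc : 0 < c) (hε : 0 < ε)
    (A : ℝ) :
    ∃ N₀ : ℕ, ∀ n : ℕ, N₀ ≤ n → A * (n * Real.exp (-c * (n : ℝ) ^ δ)) ≤ ε := by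
  have h := ((tendsto_rpow_mul_exp_neg_mul_atTop_nhds_zero (1 / δ) c hc).comp
    ((tendsto_rpow_atTop hδ).comp tendsto_natCast_atTop_atTop)).const_mul A
  rw [mul_zero] at h
  obtain ⟨N, hN⟩ := eventually_atTop.1 (h.eventually_le_const hε)
  refine ⟨N, fun n hn => ?_⟩
  have := hN n hn
  simp only [Function.comp_apply] at this
  rwa [← Real.rpow_mul (Nat.cast_nonneg n), mul_one_div_cancel hδ.ne', Real.rpow_one] at this

theorem natCast_rpow_le_mul {m : ℕ} (hm : 1 ≤ m) {δ p : ℝ} (hp : (m : ℝ) ^ (-1 + δ) ≤ p) :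
    (m : ℝ) ^ δ ≤ m * p := by
  have hm' : (0 : ℝ) < m := by exact_mod_cast hm
  calc (m : ℝ) ^ δ = m * (m : ℝ) ^ (-1 + δ) := by
        nth_rw 2 [← Real.rpow_one (m : ℝ)]
        rw [← Real.rpow_add hm']
        congr 1
        ring
    _ ≤ m * p := mul_le_mul_of_nonneg_left hp hm'.le

theorem natCast_rpow_le_mul_sq {n : ℕ} (hn : 1 ≤ n) {δ p : ℝ}
    (hp : (n : ℝ) ^ (-(1 / 2) + δ) ≤ p) : (n : ℝ) ^ (2 * δ) ≤ n * p ^ 2 := by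
  have hn' : (0 : ℝ) < n := by exact_mod_cast hn
  calc (n : ℝ) ^ (2 * δ) = n * ((n : ℝ) ^ (-(1 / 2) + δ)) ^ 2 := by
        nth_rw 2 [← Real.rpow_one (n : ℝ)]
        rw [← Real.rpow_mul_natCast hn'.le, ← Real.rpow_add hn']
        congr 1
        push_cast
        ring
    _ ≤ n * p ^ 2 := by gcongr

/-- The two effective sample sizes tend to infinity, uniformly in `p`. -/
theorem exists_forall_le_cubeRoot {δ : ℝ} (hδ : 0 < δ) (Y Z : ℝ) :
    ∃ N₀ : ℕ, ∀ m n : ℕ, N₀ ≤ m → N₀ ≤ n → ∀ p : ℝ,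
      max ((m : ℝ) ^ (-1 + δ)) ((n : ℝ) ^ (-(1 / 2) + δ)) ≤ p →
      Y ≤ ((n : ℝ) * p ^ 2) ^ (1 / 3 : ℝ) ∧ Z ≤ ((m : ℝ) * p) ^ (1 / 3 : ℝ) := by
  obtain ⟨N₁, h1, hN₁⟩ := exists_forall_le_natCast_rpow (by positivity : 0 < 2 * δ / 3) Y
  obtain ⟨N₂, h2, hN₂⟩ := exists_forall_le_natCast_rpow (by positivity : 0 < δ / 3) Z
  refine ⟨max N₁ N₂, fun m n hm hn p hp => ⟨?_, ?_⟩⟩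
  · have hn1 := (le_max_left _ _).trans hn
    calc Y ≤ (n : ℝ) ^ (2 * δ / 3) := hN₁ n hn1
      _ = ((n : ℝ) ^ (2 * δ)) ^ (1 / 3 : ℝ) := by
        rw [← Real.rpow_mul (Nat.cast_nonneg n)]
        congr 1
        ring
      _ ≤ _ := Real.rpow_le_rpow (by positivity)
        (natCast_rpow_le_mul_sq (h1.trans hn1) ((le_max_right _ _).trans hp)) (by norm_num)
  · have hm1 := (le_max_right _ _).trans hm
    calc Z ≤ (m : ℝ) ^ (δ / 3) := hN₂ m hm1
      _ = ((m : ℝ) ^ δ) ^ (1 / 3 : ℝ) := by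
        rw [← Real.rpow_mul (Nat.cast_nonneg m)]
        congr 1
        ring
      _ ≤ _ := Real.rpow_le_rpow (by positivity)
        (natCast_rpow_le_mul (h2.trans hm1) ((le_max_left _ _).trans hp)) (by norm_num)

/-- Some number of rows makes it likely that one of them is a candidate for a given entry. -/
theorem exists_numRows_failure_le {δ Q ε : ℝ} (hδ : 0 < δ) (hQ : 0 ≤ Q) (hε : 0 < ε) :
    ∃ N₀ : ℕ, ∀ m n : ℕ, N₀ ≤ m → N₀ ≤ n → ∀ p : ℝ, p ≤ 1 →
      max ((m : ℝ) ^ (-1 + δ)) ((n : ℝ) ^ (-(1 / 2) + δ)) ≤ p →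
      ∃ N : ℕ, N + 1 ≤ m ∧
        Q * (Real.exp (-(N * p) / 10) + N * Real.exp (-(n * p ^ 2) / 10)) ≤ 2 * ε := by
  obtain ⟨Λ, hΛ0, hΛ⟩ : ∃ Λ : ℝ, 0 ≤ Λ ∧ Q * Real.exp (-Λ / 10) ≤ ε := by
    -- With x = Q/ε the claim is x ≤ exp x.
    refine ⟨10 * (Q / ε), by positivity, ?_⟩
    have h1 : Q / ε ≤ Real.exp (Q / ε) := by linarith [Real.add_one_le_exp (Q / ε)]
    rw [div_le_iff₀ hε] at h1
    calc Q * Real.exp (-(10 * (Q / ε)) / 10) = Q * (Real.exp (Q / ε))⁻¹ := by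
          rw [← Real.exp_neg]
          congr 2
          ring
      _ ≤ ε := by
        rw [← div_eq_mul_inv, div_le_iff₀ (Real.exp_pos _)]
        linarith
  obtain ⟨N₁, h1, hN₁⟩ := exists_forall_le_natCast_rpow hδ (Λ + 2)
  obtain ⟨N₂, hN₂⟩ := exists_forall_natCast_mul_exp_le (by positivity : 0 < 2 * δ)
    (by norm_num : (0 : ℝ) < 1 / 10) hε (Q * (Λ + 1))
  refine ⟨max N₁ N₂, fun m n hm hn p hp1 hp => ?_⟩
  have hm1 := (le_max_left _ _).trans hm
  have hn1 : 1 ≤ n := h1.trans ((le_max_left _ _).trans hn)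
  have hn1' : (1 : ℝ) ≤ n := by exact_mod_cast hn1
  have hpn := (le_max_right _ _).trans hp
  have hp0 : 0 < p := lt_of_lt_of_le (Real.rpow_pos_of_pos (by linarith) _) hpn
  -- This gives Λ/p ≤ Λ n, so the number of rows is at most (Λ + 1) n whatever `m` is, and
  -- exp(-n^{2δ}/10) beats it.
  have hpn' : (n : ℝ)⁻¹ ≤ p := by
    refine le_trans ?_ hpn
    rw [← Real.rpow_neg_one]
    exact Real.rpow_le_rpow_of_exponent_le hn1' (by linarith)
  have hN : (⌈Λ / p⌉₊ : ℝ) ≤ Λ / p + 1 := (Nat.ceil_lt_add_one (by positivity)).le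
  have hNp : Λ ≤ ⌈Λ / p⌉₊ * p := by
    rw [← div_le_iff₀ hp0]
    exact Nat.le_ceil _
  refine ⟨⌈Λ / p⌉₊, ?_, ?_⟩
  · have h2 : ((⌈Λ / p⌉₊ : ℝ) + 1) * p ≤ m * p := by
      calc ((⌈Λ / p⌉₊ : ℝ) + 1) * p ≤ (Λ / p + 1 + 1) * p := by gcongr
        _ = Λ + 2 * p := by field_simp; ring
        _ ≤ Λ + 2 := by linarith
        _ ≤ m * p := (hN₁ m hm1).trans
          (natCast_rpow_le_mul (h1.trans hm1) ((le_max_left _ _).trans hp))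
    have h3 : (⌈Λ / p⌉₊ : ℝ) + 1 ≤ m := le_of_mul_le_mul_right h2 hp0
    exact_mod_cast h3
  · have h2 : Q * Real.exp (-(⌈Λ / p⌉₊ * p) / 10) ≤ ε := by
      refine le_trans ?_ hΛ
      gcongr
    have h3 : Q * (⌈Λ / p⌉₊ * Real.exp (-(n * p ^ 2) / 10)) ≤ ε := by
      refine le_trans ?_ (hN₂ n ((le_max_right _ _).trans hn))
      have h4 : (⌈Λ / p⌉₊ : ℝ) ≤ (Λ + 1) * n := by
        have : Λ / p ≤ Λ * n := by
          rw [div_eq_mul_inv]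
          gcongr
          exact inv_le_of_inv_le₀ (by linarith) hpn'
        linarith
      have h5 : Real.exp (-(n * p ^ 2) / 10) ≤ Real.exp (-(1 / 10) * (n : ℝ) ^ (2 * δ)) := by
        have := natCast_rpow_le_mul_sq hn1 hpn
        gcongr
        linarith
      calc Q * (⌈Λ / p⌉₊ * Real.exp (-(n * p ^ 2) / 10))
          ≤ Q * ((Λ + 1) * n * Real.exp (-(1 / 10) * (n : ℝ) ^ (2 * δ))) := by gcongr
        _ = _ := by ring
    linarith

theorem Finset.exists_pos_forall_le {ι : Type*} (s : Finset ι) {g : ι → ℝ}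
    (hg : ∀ a ∈ s, 0 < g a) : ∃ t : ℝ, 0 < t ∧ ∀ a ∈ s, t ≤ g a := by
  rcases s.eq_empty_or_nonempty with rfl | hs
  · exact ⟨1, one_pos, by simp⟩
  · obtain ⟨a, ha, hmin⟩ := s.exists_min_image g hs
    exact ⟨g a, hg a ha, hmin⟩

theorem le_mul_log_of_mul_exp_one_le {x B : ℝ} (hx : 0 < x) (h : x * Real.exp 1 ≤ B) :
    x ≤ 21 / 4 * x * Real.log (B / x) := by
  have h1 : 1 ≤ Real.log (B / x) := by
    rw [Real.le_log_iff_exp_le (div_pos (lt_of_lt_of_le (by positivity) h) hx), le_div_iff₀ hx]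
    linarith
  nlinarith

/-! ### Finite support, the two regimes, and the conclusion. -/

namespace BlindRegression

theorem FinitelySupported.exists_finset_atoms {X : Type*} [MeasurableSpace X] {P : Measure X}
    [IsFiniteMeasure P] (h : FinitelySupported P) :
    ∃ (T : Finset X) (π : ℝ), 0 < π ∧ P (T : Set X)ᶜ = 0 ∧ ∀ a ∈ T, π ≤ P.real {a} := by
  classical
  obtain ⟨S, hS, hS0⟩ := h
  obtain ⟨π, hπ, hT⟩ := (hS.toFinset.filter fun a => P {a} ≠ 0).exists_pos_forall_le
    (g := fun a => P.real {a}) fun a ha =>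
      ENNReal.toReal_pos (Finset.mem_filter.1 ha).2 (measure_ne_top _ _)
  refine ⟨hS.toFinset.filter fun a => P {a} ≠ 0, π, hπ, ?_, hT⟩
  have hnull : P (⋃ a ∈ {a ∈ S | P {a} = 0}, {a}) = 0 := by
    rw [measure_biUnion_null_iff (hS.subset fun a ha => ha.1).countable]
    exact fun a ha => ha.2
  refine measure_mono_null (fun a ha => ?_) (measure_union_null hS0 hnull)
  by_cases haS : a ∈ S
  · refine Or.inr (Set.mem_biUnion (x := a) ⟨haS, ?_⟩ rfl)
    by_contra hne
    exact ha (by simpa using ⟨haS, hne⟩)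
  · exact Or.inl haS

theorem exists_varDiff_gap {X₁ X₂ : Type*} [MeasurableSpace X₂] (P₂ : Measure X₂)
    (f : X₁ → X₂ → ℝ) (T : Finset X₁) :
    ∃ t : ℝ, 0 < t ∧ ∀ a ∈ T, ∀ b ∈ T, varDiff P₂ f a b = 0 ∨ 2 * t < varDiff P₂ f a b := by
  classical
  obtain ⟨t, ht, hle⟩ := ((T ×ˢ T).filter fun q => varDiff P₂ f q.1 q.2 ≠ 0).exists_pos_forall_le
    (g := fun q => varDiff P₂ f q.1 q.2) fun q hq =>
      lt_of_le_of_ne (varDiff_nonneg _ _) (Finset.mem_filter.1 hq).2.symm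
  -- One third rather than one half, as the gap is strict.
  refine ⟨t / 3, by positivity, fun a ha b hb => or_iff_not_imp_left.2 fun hne => ?_⟩
  have := hle (a, b) (Finset.mem_filter.2 ⟨Finset.mk_mem_product ha hb, hne⟩)
  simp only at this
  linarith

/-- In this regime m exp(-y) ≥ 1, so the claimed bound exceeds a fixed multiple of `B₀ ^ 2`. -/
theorem six_le_F₂ {m n : ℕ} {p : ℝ} (hm : 1 ≤ m)
    (h : ((n : ℝ) * p ^ 2) ^ (1 / 3 : ℝ) ≤ Real.log m) : 6 ≤ F₂ 1 1 m n p := by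
  have hm' : (0 : ℝ) < m := by exact_mod_cast hm
  have h1 : (m : ℝ)⁻¹ ≤ Real.exp (-1 * ((n : ℝ) * p ^ 2) ^ (1 / 3 : ℝ)) := by
    rw [← Real.exp_log (inv_pos.2 hm'), Real.log_inv]
    exact Real.exp_le_exp.2 (by linarith)
  have h2 : 6 * (m : ℝ) * (m : ℝ)⁻¹ ≤
      6 * (m : ℝ) * Real.exp (-1 * ((n : ℝ) * p ^ 2) ^ (1 / 3 : ℝ)) := by gcongr
  rw [mul_assoc, mul_inv_cancel₀ hm'.ne'] at h2
  have h3 := Real.exp_pos (-1 * ((m : ℝ) * p) ^ (1 / 3 : ℝ))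
  rw [F₂]
  linarith

theorem F₂_nonneg (c₁ c₂ : ℝ) (m n : ℕ) (p : ℝ) : 0 ≤ F₂ c₁ c₂ m n p := by
  rw [F₂]
  positivity

theorem F₁_eq {C : ℝ} {m n : ℕ} {p : ℝ} (hp : 0 ≤ p) :
    F₁ C m n p = C * max (((n : ℝ) * p ^ 2) ^ (1 / 3 : ℝ))⁻¹ (((m : ℝ) * p) ^ (1 / 3 : ℝ))⁻¹ := by
  rw [F₁, Real.rpow_neg (by positivity), Real.rpow_neg (by positivity)]

/-- With no neighbours the estimate is zero and the error is `f ^ 2`, which `B₀` does not control.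
The bound `Q` may depend on `f`, because it only multiplies small probabilities. -/
theorem exists_sq_le_of_lipschitz {X₁ X₂ : Type*} [MetricSpace X₁] [MetricSpace X₂]
    [CompactSpace X₂] {L D₁ : ℝ} (hL : 0 ≤ L) {f : X₁ → X₂ → ℝ} (hD : ∀ x x' : X₁, dist x x' ≤ D₁)
    (hf : ∀ (x x' : X₁) (y y' : X₂), |f x y - f x' y'| ≤ L * max (dist x x') (dist y y')) :
    ∃ Q : ℝ, ∀ x y, f x y ^ 2 ≤ Q := by
  rcases isEmpty_or_nonempty X₁ with _ | ⟨⟨x₀⟩⟩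
  · exact ⟨0, fun x => isEmptyElim x⟩
  rcases isEmpty_or_nonempty X₂ with _ | ⟨⟨y₀⟩⟩
  · exact ⟨0, fun _ y => isEmptyElim y⟩
  refine ⟨(|f x₀ y₀| + L * max D₁ (Metric.diam (Set.univ : Set X₂))) ^ 2, fun x y => ?_⟩
  have h1 : dist y y₀ ≤ Metric.diam (Set.univ : Set X₂) :=
    Metric.dist_le_diam_of_mem isCompact_univ.isBounded (Set.mem_univ _) (Set.mem_univ _)
  have h2 : |f x y - f x₀ y₀| ≤ L * max D₁ (Metric.diam (Set.univ : Set X₂)) :=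
    (hf x x₀ y y₀).trans (mul_le_mul_of_nonneg_left (max_le_max (hD x x₀) h1) hL)
  rw [← sq_abs]
  gcongr
  have h3 := abs_add_le (f x y - f x₀ y₀) (f x₀ y₀)
  rw [sub_add_cancel] at h3
  linarith

theorem measurable_of_lipschitz {X₁ X₂ : Type*} [MetricSpace X₁] [MetricSpace X₂]
    [MeasurableSpace X₂] [BorelSpace X₂] {L : ℝ} (hL : 0 ≤ L) {f : X₁ → X₂ → ℝ}
    (hf : ∀ (x x' : X₁) (y y' : X₂), |f x y - f x' y'| ≤ L * max (dist x x') (dist y y'))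
    (a : X₁) : Measurable (f a) := by
  have : LipschitzWith ⟨L, hL⟩ (f a) := LipschitzWith.of_dist_le_mul fun y y' => by
    have h := hf a a y y'
    rwa [dist_self, max_eq_right dist_nonneg] at h
  exact this.continuous.measurable

/-- The error is at most a constant multiple of `B₀²` without any condition on the number of rows
relative to the number of columns. -/
theorem exists_mse_le_const {X₁ X₂ : Type*} [MeasurableSpace X₁] [MeasurableSpace X₂]
    {P₁ : Measure X₁} [IsProbabilityMeasure P₁] {P₂ : Measure X₂} [IsProbabilityMeasure P₂]
    {f : X₁ → X₂ → ℝ} {Be c B₀ Q δ : ℝ} (hc : ∀ a b y, |f a y - f b y| ≤ c)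
    (hB₀ : c + 2 * Be ≤ B₀) (hc0 : 0 ≤ c) (hBe : 0 ≤ Be) (hB₀pos : 0 < B₀)
    (hF : ∀ x y, f x y ^ 2 ≤ Q) (hQ : 4 * B₀ ^ 2 ≤ Q) (hδ : 0 < δ) :
    ∃ N₀ : ℕ, ∀ m n : ℕ, N₀ ≤ m → N₀ ≤ n → ∀ p : I,
      max ((m : ℝ) ^ (-1 + δ)) ((n : ℝ) ^ (-(1 / 2) + δ)) ≤ (p : ℝ) →
      ∀ (γ : ℝ) (ν : Fin m × Fin n → Measure ℝ), (∀ e, IsNoiseLaw γ Be (ν e)) →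
      ∀ r : Outcome m n X₁ X₂ → Fin m → Fin m → ℕ, IsRankingRule f (overlapThreshold n p) r →
      mse P₁ P₂ f ν p (overlapThreshold n p) (numNeighbours m p) r ≤
        ENNReal.ofReal (24 * B₀ ^ 2) := by
  have hB2 : 0 < B₀ ^ 2 := pow_pos hB₀pos 2
  obtain ⟨N₁, hN₁⟩ := exists_numRows_failure_le hδ (by linarith : 0 ≤ Q) hB2
  obtain ⟨N₂, hN₂⟩ := exists_forall_le_cubeRoot hδ 0 8
  refine ⟨max 1 (max N₁ N₂), fun m n hm hn p hp γ ν hν r hr => ?_⟩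
  simp only [max_le_iff] at hm hn
  obtain ⟨N, hNm, hN⟩ := hN₁ m n hm.2.1 hn.2.1 p p.2.2 hp
  have hz := (hN₂ m n hm.2.2 hn.2.2 p hp).2
  have hk : 0 < numNeighbours m p := by
    rw [numNeighbours, Nat.floor_pos]
    linarith
  refine (mse_le_of_exists_neighbour hn.1 hc hν hB₀ hc0 hBe hF hQ hk hNm hm.1 hr).trans
    (ENNReal.ofReal_le_ofReal ?_)
  -- 4 B₀² when a neighbour exists and 2 B₀² for the failure; 24 B₀² is what `six_le_F₂` makes
  -- available.
  linarith

/-- The rate of convergence for a finitely supported law of the row features. -/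
theorem FinitelySupported.exists_mse_le_rate {X₁ X₂ : Type*} [MeasurableSpace X₁]
    [MeasurableSpace X₂] [MeasurableSingletonClass X₁] {P₁ : Measure X₁} [IsProbabilityMeasure P₁]
    {P₂ : Measure X₂} [IsProbabilityMeasure P₂] {f : X₁ → X₂ → ℝ} (hP₁ : FinitelySupported P₁)
    {Be c B₀ Q δ : ℝ} (hfm : ∀ a, Measurable (f a)) (hc : ∀ a b y, |f a y - f b y| ≤ c)
    (hB₀ : c + 2 * Be ≤ B₀) (hc0 : 0 ≤ c) (hBe : 0 ≤ Be) (hB₀pos : 0 < B₀)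
    (hF : ∀ x y, f x y ^ 2 ≤ Q) (hQ : 4 * B₀ ^ 2 ≤ Q) (hδ : 0 < δ) {ε : ℝ} (hε : 0 < ε) :
    ∃ N₀ : ℕ, ∀ m n : ℕ, N₀ ≤ m → N₀ ≤ n → ∀ p : I,
      max ((m : ℝ) ^ (-1 + δ)) ((n : ℝ) ^ (-(1 / 2) + δ)) ≤ (p : ℝ) →
      1 ≤ (n : ℝ) * (p : ℝ) ^ 2 ∧ 0 < F₁ (636 * B₀ ^ 2) m n p ∧ F₁ (636 * B₀ ^ 2) m n p ≤ ε ∧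
      (Real.log m ≤ ((n : ℝ) * (p : ℝ) ^ 2) ^ (1 / 3 : ℝ) →
        ∀ (γ : ℝ) (ν : Fin m × Fin n → Measure ℝ), (∀ e, IsNoiseLaw γ Be (ν e)) →
        ∀ r : Outcome m n X₁ X₂ → Fin m → Fin m → ℕ, IsRankingRule f (overlapThreshold n p) r →
        mse P₁ P₂ f ν p (overlapThreshold n p) (numNeighbours m p) r ≤
          ENNReal.ofReal (F₁ (636 * B₀ ^ 2) m n p)) := by
  obtain ⟨T, π, hπ, hT0, hT⟩ := hP₁.exists_finset_atoms
  obtain ⟨t, ht, hgap⟩ := exists_varDiff_gap P₂ f T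
  obtain ⟨Y, Z, hYZ⟩ := BlindRegression.exists_mse_le_rate hfm hc hB₀ hc0 hBe hB₀pos hF hQ hπ hT0
    hT ht hgap
  have hC : 0 < 636 * B₀ ^ 2 := by positivity
  -- The thresholds `636 * B₀ ^ 2 / ε` for y and z are what F₁ ≤ ε requires.
  obtain ⟨N₀, hN₀⟩ := exists_forall_le_cubeRoot hδ (max 1 (max Y (636 * B₀ ^ 2 / ε)))
    (max 1 (max Z (636 * B₀ ^ 2 / ε)))
  refine ⟨N₀, fun m n hm hn p hp => ?_⟩
  obtain ⟨hy, hz⟩ := hN₀ m n hm hn p hp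
  simp only [max_le_iff] at hy hz
  rw [F₁_eq p.2.1]
  have hp0 := p.2.1
  have hcube : ∀ w : ℝ, 0 ≤ w → w = (w ^ (1 / 3 : ℝ)) ^ 3 := fun w hw => by
    rw [← Real.rpow_mul_natCast hw]
    norm_num
  have hy3 := hcube ((n : ℝ) * (p : ℝ) ^ 2) (by positivity)
  have hz3 := hcube ((m : ℝ) * (p : ℝ)) (by positivity)
  have hkz : numNeighbours m p = ⌊(1 / 8 : ℝ) * ((m : ℝ) * p) ^ (1 / 3 : ℝ)⌋₊ := rfl
  rw [hkz]
  generalize ((n : ℝ) * (p : ℝ) ^ 2) ^ (1 / 3 : ℝ) = y at *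
  generalize ((m : ℝ) * (p : ℝ)) ^ (1 / 3 : ℝ) = z at *
  have hy0 : 0 < y := by linarith
  have hz0 : 0 < z := by linarith
  refine ⟨hy3 ▸ one_le_pow₀ hy.1, by positivity, ?_,
    fun hlog => hYZ m n p y z hy.2.1 hz.2.1 hy3 hz3 hlog⟩
  have hmax : max y⁻¹ z⁻¹ ≤ ε / (636 * B₀ ^ 2) := by
    rw [← inv_div]
    exact max_le (inv_anti₀ (by positivity) hy.2.2) (inv_anti₀ (by positivity) hz.2.2)
  rw [le_div_iff₀ hC] at hmax
  linarith

end BlindRegression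

theorem corollary4p4
    (L D₁ Be : ℝ) (hL : 0 ≤ L) (hD₁ : 0 ≤ D₁) (hBe : 0 ≤ Be)
    (B₀ : ℝ) (hB₀ : B₀ = L * D₁ + 2 * Be) (hB₀_pos : 0 < B₀) :
    ∃ C : ℝ, 0 < C ∧ ∃ c₁ : ℝ, 0 < c₁ ∧ ∃ c₂ : ℝ, 0 < c₂ ∧
      ∀ (X₁ : Type*) [MetricSpace X₁] [CompactSpace X₁] [MeasurableSpace X₁] [BorelSpace X₁]
        (X₂ : Type*) [MetricSpace X₂] [CompactSpace X₂] [MeasurableSpace X₂] [BorelSpace X₂]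
        (P₁ : Measure X₁) [IsProbabilityMeasure P₁] (P₂ : Measure X₂) [IsProbabilityMeasure P₂]
        (f : X₁ → X₂ → ℝ),
        BlindRegression.FinitelySupported P₁ →
        (∀ x x' : X₁, dist x x' ≤ D₁) →
        (∀ (x x' : X₁) (y y' : X₂), |f x y - f x' y'| ≤ L * max (dist x x') (dist y y')) →
        ∀ δ : ℝ, 0 < δ →
          -- the bound on the mean squared error, for all sufficiently large `m` and `n`
          (∃ N₀ : ℕ, ∀ m n : ℕ, N₀ ≤ m → N₀ ≤ n → ∀ p : I,
            max ((m : ℝ) ^ (-1 + δ)) ((n : ℝ) ^ (-(1 / 2) + δ)) ≤ (p : ℝ) →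
            ∀ (γ : ℝ) (ν : Fin m × Fin n → Measure ℝ),
              (∀ e, BlindRegression.IsNoiseLaw γ Be (ν e)) →
            ∀ r : BlindRegression.Outcome m n X₁ X₂ → Fin m → Fin m → ℕ,
              BlindRegression.IsRankingRule f (BlindRegression.overlapThreshold n p) r →
            BlindRegression.mse P₁ P₂ f ν p (BlindRegression.overlapThreshold n p)
                (BlindRegression.numNeighbours m p) r ≤
              ENNReal.ofReal
                (21 / 4 * BlindRegression.F₁ C m n p *
                    Real.log (2 * B₀ / BlindRegression.F₁ C m n p) +
                  4 * B₀ ^ 2 * BlindRegression.F₂ c₁ c₂ m n p)) ∧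
          -- consistency: the mean squared error tends to zero as `m, n → ∞`
          (∀ δ' : ℝ, 0 < δ' → δ' < 1 → ∀ ε : ℝ, 0 < ε →
            ∃ N₀ : ℕ, ∀ m n : ℕ, N₀ ≤ m → N₀ ≤ n → ∀ p : I,
            max ((m : ℝ) ^ (-1 + δ)) ((n : ℝ) ^ (-(1 / 2) + δ)) ≤ (p : ℝ) →
            Real.log m < ((n : ℝ) * (p : ℝ) ^ 2) ^ (δ' / 3) →
            ∀ (γ : ℝ) (ν : Fin m × Fin n → Measure ℝ),
              (∀ e, BlindRegression.IsNoiseLaw γ Be (ν e)) →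
            ∀ r : BlindRegression.Outcome m n X₁ X₂ → Fin m → Fin m → ℕ,
              BlindRegression.IsRankingRule f (BlindRegression.overlapThreshold n p) r →
            BlindRegression.mse P₁ P₂ f ν p (BlindRegression.overlapThreshold n p)
                (BlindRegression.numNeighbours m p) r ≤ ENNReal.ofReal ε) := by
  -- `c₂ = 1` places the change of regime exactly at log m = (n p²)^{1/3}; the first regime only
  -- uses F₂ ≥ 0.
  refine ⟨636 * B₀ ^ 2, by positivity, 1, one_pos, 1, one_pos, ?_⟩
  intro X₁ _ _ _ _ X₂ _ _ _ _ P₁ _ P₂ _ f hP₁ hD hf δ hδ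
  have hc : ∀ a b y, |f a y - f b y| ≤ L * D₁ := fun a b y => by
    have h := hf a b y y
    rw [dist_self, max_eq_left dist_nonneg] at h
    exact h.trans (mul_le_mul_of_nonneg_left (hD a b) hL)
  have hc0 : 0 ≤ L * D₁ := mul_nonneg hL hD₁
  obtain ⟨Q', hQ'⟩ := BlindRegression.exists_sq_le_of_lipschitz hL hD hf
  have hF : ∀ x y, f x y ^ 2 ≤ max Q' (4 * B₀ ^ 2) := fun x y => (hQ' x y).trans (le_max_left _ _)
  have hrate := fun {ε : ℝ} (hε : 0 < ε) =>
    hP₁.exists_mse_le_rate (P₂ := P₂) (BlindRegression.measurable_of_lipschitz hL hf) hc hB₀.ge hc0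
      hBe hB₀_pos hF (le_max_right _ _) hδ hε
  constructor
  · obtain ⟨N₁, hN₁⟩ := BlindRegression.exists_mse_le_const (P₁ := P₁) (P₂ := P₂) hc hB₀.ge hc0 hBe
      hB₀_pos hF (le_max_right _ _) hδ
    -- F₁ ≤ 2B₀/e makes the logarithm at least 1.
    obtain ⟨N₂, hN₂⟩ := hrate (div_pos (mul_pos two_pos hB₀_pos) (Real.exp_pos 1))
    refine ⟨max 1 (max N₁ N₂), fun m n hm hn p hp γ ν hν r hr => ?_⟩
    simp only [max_le_iff] at hm hn
    obtain ⟨-, hF₁0, hF₁, hle⟩ := hN₂ m n hm.2.2 hn.2.2 p hp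
    rw [le_div_iff₀ (Real.exp_pos 1)] at hF₁
    have hlead := le_mul_log_of_mul_exp_one_le hF₁0 hF₁
    have hB2 : 0 ≤ 4 * B₀ ^ 2 := by positivity
    rcases le_total (Real.log m) (((n : ℝ) * (p : ℝ) ^ 2) ^ (1 / 3 : ℝ)) with h | h
    · refine (hle h γ ν hν r hr).trans (ENNReal.ofReal_le_ofReal ?_)
      have := mul_nonneg hB2 (BlindRegression.F₂_nonneg 1 1 m n p)
      linarith
    · refine (hN₁ m n hm.2.1 hn.2.1 p hp γ ν hν r hr).trans (ENNReal.ofReal_le_ofReal ?_)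
      have := mul_le_mul_of_nonneg_left (BlindRegression.six_le_F₂ hm.1 h) hB2
      linarith
  · intro δ' hδ' hδ'1 ε hε
    obtain ⟨N₀, hN₀⟩ := hrate hε
    refine ⟨N₀, fun m n hm hn p hp hlog γ ν hν r hr => ?_⟩
    obtain ⟨hone, -, hF₁, hle⟩ := hN₀ m n hm hn p hp
    -- Since n p² ≥ 1 and δ' < 1, the hypothesis implies log m ≤ (n p²)^{1/3}.
    exact (hle (hlog.le.trans (Real.rpow_le_rpow_of_exponent_le hone (by linarith))) γ ν hν r
      hr).trans (ENNReal.ofReal_le_ofReal hF₁)
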